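/- **Setting.** All spaces are real. An *sc-Banach space* is a Banach space $E=E_0$ with a decreasing sequence of Banach spaces $E_0\supseteq E_1\supseteq\cdots$ such that the inclusions $E_{m+1}\hookrightarrow E_m$ are compact and $E_\infty=\bigcap_i E_i$ is dense in every $E_m$; it is *reflexive* if every $E_m$ is. A map $f:E\to F$ is *sc$^0$* if for every $m$ it restricts to a continuous map $E_m\to F_m$. It is *sc$^1$* if it is sc$^0$, if for each $x\in E_1$ there is a bounded operator $Df(x):E_0\to F_0$ with $\|f(x+h)-f(x)-Df(x)h\|_0/\|h\|_1\to0$ as $\|h\|_1\to 0$, and if the tangent map $Tf(x,h)=(f(x),Df(x)h)$ is sc$^0$ from $TE=E^1\oplus E$ (with levels $E_{m+1}\oplus E_m$) to $TF$. It is *sc$^{k}$*, $k\ge2$, if it is sc$^0$, is sc-differentiable in this sense at every $x\in E_1$, and $Tf$ is sc$^{k-1}$; it is *sc-smooth* if it is sc$^k$ for all $k$. An *sc-smooth retraction* is an sc-smooth $r:E\to E$ with $r\circ r=r$. Its image $X=r(E)$ is an M-polyfold with the identity as a global chart. Write $X_1=X\cap E_1$, $T_pX=\operatorname{im}Dr(p)\subseteq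 E_0$ for $p\in X_1$, with levels $T_pX\cap E_m$, and $TX=Tr(TE)=\{(p,v):p\in X_1,\ v\in T_pX\}$. A map $J:TX\to TX$ is sc-smooth if $J\circ Tr:TE\to TE$ is. $X$ is *even-dimensional* if every $T_pX$, $p\in X_1$, is infinite-dimensional or of even dimension. An *almost complex structure* on $X$ is an sc-smooth map $J:TX\to TX$ that restricts for each $p\in X_1$ to a linear sc$^0$ map $J_p:T_pX\to T_pX$ with $J_p^2=-\mathrm{id}$. **The class $\Gamma$.** Let $0=\delta_0<\delta_1<\delta_2<\cdots$ be real numbers, and let $\beta:\mathbb R\to[-1,1]$ be a smooth odd function with $\beta(s)=1$ for $s\ge1$. Give $L^2(\mathbb R)$ the levels $$W^{m,\delta_m}=\Big\{f\in L^2(\mathbb R):\ \|f\|_m^2=\sum_{j\le m}\int_{\mathbb R}|D^jf(s)|^2e^{\delta_m s\beta(s)}\,ds<\infty\Big\},\qquad m\ge0,$$ where the $D^jf$ are weak derivatives. Let $n,k\ge0$ be integers, and let $\gamma_1,\dots,\gamma_k$ be smooth, compactly supported, $L^2$-orthonormal real functions on $\mathbb R$. For $t>0$ put $\gamma_{j,t}=\gamma_j(\cdot+e^{1/t})$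 and $\rho_{j,t}=\frac{d}{dt}\gamma_{j,t}$. Let $\pi_t=0$ for $t\le0$ and $\pi_t f=\sum_j\langle f,\gamma_{j,t}\rangle_{L^2}\gamma_{j,t}$ for $t>0$. On $E=\mathbb R^n\oplus\mathbb R\oplus L^2(\mathbb R)$, with levels $\mathbb R^n\oplus\mathbb R\oplus W^{m,\delta_m}$, let $r(x,t,f)=(x,t,\pi_tf)$, and let $\Gamma_n^k=r(E)$. **Theorem 3.5.** For all such data: 1. $E$ is a reflexive sc-Banach space and $r$ is an sc-smooth retraction, so $\Gamma_n^k$ is a reflexive M-polyfold. 2. $\Gamma_n^k$ is even-dimensional if and only if $n$ is odd and $k$ is even. 3. If $\Gamma_n^k$ is even-dimensional, then it admits an almost complex structure $J$. Moreover, $J$ in (3) can be chosen to be given by the following formulas at every $p=(x,t,f)\in X_1$. For $a=(\delta x_1,\dots,\delta x_n,\delta t)$ put $a'=(-\delta x_2,\delta x_1,\dots,-\delta x_{n-1},\delta x_{n-2},-\delta t,\delta x_n)$. If $t\le0$, every vector of $T_pX$ has the form $(a,0)$, and $J_p(a,0)=(a',0)$. If $t>0$, put $\xi_t=\sum_j\langle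 f,\gamma_{j,t}\rangle_{L^2}\,\rho_{j,t}$; every vector of $T_pX$ has the form $\big(a,\ \sum_j b_j\gamma_{j,t}+\delta t\,\xi_t\big)$ with $b\in\mathbb R^k$, and $$J_p\Big(a,\ \sum_{j=1}^k b_j\gamma_{j,t}+\delta t\,\xi_t\Big)=\Big(a',\ \sum_{i=1}^{k/2}\big(b_{2i-1}\gamma_{2i,t}-b_{2i}\gamma_{2i-1,t}\big)+\delta x_n\,\xi_t\Big).$$ -/

import Mathlib

open MeasureTheory Set Function
open scoped ContDiff

noncomputable section

/-! ## Scales of normed spaces and sc-Banach spaces -/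

/-- A decreasing sequence `E₀ ⊇ E₁ ⊇ E₂ ⊇ ⋯` of real normed spaces with continuous inclusions.
The inclusion `E_{m+1} ⊆ E_m` is recorded as the injective continuous linear map `incl m`. -/
structure ScScale where
  level : ℕ → Type
  [normedGroup : ∀ m, NormedAddCommGroup (level m)]
  [normedSpace : ∀ m, NormedSpace ℝ (level m)]
  incl : ∀ m, level (m + 1) →L[ℝ] level m
  incl_injective : ∀ m, Injective (incl m)

attribute [instance] ScScale.normedGroup ScScale.normedSpace

namespace ScScale

/-- The inclusion `E_m ⊆ E₀`. -/
def emb (E : ScScale) : ∀ m, E.level m →L[ℝ] E.level 0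
  | 0 => ContinuousLinearMap.id ℝ (E.level 0)
  | m + 1 => (E.emb m).comp (E.incl m)

theorem emb_injective (E : ScScale) : ∀ m, Injective (E.emb m)
  | 0 => fun _ _ h => h
  | m + 1 => (emb_injective E m).comp (E.incl_injective m)

/-- The points of `E_m` that are smooth, that is, the subset `E_∞ = ⋂ᵢ Eᵢ` of `E_m`. -/
def smoothPoints (E : ScScale) (m : ℕ) : Set (E.level m) :=
  {x | ∀ i, E.emb m x ∈ range (E.emb i)}

/-- The scale is an sc-structure on `E₀`: all levels are Banach spaces, the inclusions
`E_{m+1} ⊆ E_m` are compact, and `E_∞` is dense in every `E_m`. -/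
structure IsScBanach (E : ScScale) : Prop where
  complete : ∀ m, CompleteSpace (E.level m)
  compact : ∀ m, IsCompactOperator (E.incl m)
  dense : ∀ m, Dense (E.smoothPoints m)

/-- Every level is a reflexive normed space. -/
def IsReflexive (E : ScScale) : Prop :=
  ∀ m, Surjective (NormedSpace.inclusionInDoubleDual ℝ (E.level m))

/-- The constant scale on a normed space (an sc-structure exactly in finite dimension). -/
def const (V : Type) [NormedAddCommGroup V] [NormedSpace ℝ V] : ScScale where
  level _ := V
  incl _ := ContinuousLinearMap.id ℝ V
  incl_injective _ := injective_id

/-- The direct sum `E ⊕ F`, with levels `E_m ⊕ F_m`. -/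
def prod (E F : ScScale) : ScScale where
  level m := E.level m × F.level m
  incl m := (E.incl m).prodMap (F.incl m)
  incl_injective m := (E.incl_injective m).prodMap (F.incl_injective m)

/-- The tangent bundle `TE = E¹ ⊕ E`, with levels `E_{m+1} ⊕ E_m`; an element of its zeroth
level is a pair (base point in `E₁`, vector in `E₀`). -/
def tangent (E : ScScale) : ScScale where
  level m := E.level (m + 1) × E.level m
  incl m := (E.incl (m + 1)).prodMap (E.incl m)
  incl_injective m := (E.incl_injective (m + 1)).prodMap (E.incl_injective m)

/-- A linear subspace `S ⊆ E₀` with the induced scale `S_m = S ∩ E_m` (norm of `E_m`). -/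
def sub (E : ScScale) (S : Submodule ℝ (E.level 0)) : ScScale where
  level m := S.comap (E.emb m).toLinearMap
  incl m := ((E.incl m).comp (S.comap (E.emb (m + 1)).toLinearMap).subtypeL).codRestrict
    (S.comap (E.emb m).toLinearMap) (fun x => x.2)
  incl_injective m := fun _ _ h =>
    Subtype.ext (E.incl_injective m (congrArg Subtype.val h))

end ScScale

/-! ## sc-calculus on whole sc-spaces -/

section ScCalculus

variable {E F : ScScale}

/-- `f : E → F` is sc-continuous (`sc⁰`): for every `m` it maps `E_m` to `F_m`, and the
restriction `E_m → F_m` is continuous. -/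
def ScContinuous (f : E.level 0 → F.level 0) : Prop :=
  ∀ m, ∃ g : E.level m → F.level m, Continuous g ∧ ∀ x, F.emb m (g x) = f (E.emb m x)

/-- `A : E₀ → F₀` is the sc-derivative of `f` at `x ∈ E₁`:
`‖f (x + h) - f x - A h‖₀ / ‖h‖₁ → 0` as `h ∈ E₁`, `‖h‖₁ → 0`. -/
def HasScDerivAt (f : E.level 0 → F.level 0) (A : E.level 0 →L[ℝ] F.level 0)
    (x : E.level 1) : Prop :=
  HasFDerivAt (fun y : E.level 1 => f (E.incl 0 y)) (A.comp (E.incl 0)) x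

open Classical in
/-- The sc-derivative `Df(x) : E₀ → F₀` at `x ∈ E₁` (zero if there is none; it is unique if
`E₁` is dense in `E₀`). -/
def scDeriv (f : E.level 0 → F.level 0) (x : E.level 1) : E.level 0 →L[ℝ] F.level 0 :=
  if h : ∃ A, HasScDerivAt f A x then h.choose else 0

/-- The tangent map `Tf : TE → TF`, `Tf (x, h) = (f x, Df(x) h)`. Here `x ∈ E₁`, and `f x ∈ F₀`
is regarded as a point of `F₁`, which is possible as soon as `f` is sc-continuous. -/
def scTangentMap (f : E.level 0 → F.level 0) : E.tangent.level 0 → F.tangent.level 0 :=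
  fun w : E.level 1 × E.level 0 =>
    (⟨invFun (F.incl 0) (f (E.incl 0 w.1)), scDeriv f w.1 w.2⟩ : F.level 1 × F.level 0)

end ScCalculus

/-- `f` is of class `scᵏ`: `sc⁰` is sc-continuity, and `f` is `sc^{k+1}` if it is sc-continuous,
sc-differentiable at every point of `E₁`, and `Tf : TE → TF` is `scᵏ`. -/
def ScDiff : ℕ → ∀ (E F : ScScale), (E.level 0 → F.level 0) → Prop
  | 0, _, _, f => ScContinuous f
  | k + 1, E, F, f => ScContinuous f ∧ (∀ x, ∃ A, HasScDerivAt f A x) ∧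
      ScDiff k E.tangent F.tangent (scTangentMap f)

/-- `f` is sc-smooth. -/
def ScSmooth {E F : ScScale} (f : E.level 0 → F.level 0) : Prop :=
  ∀ k, ScDiff k E F f

/-! ## sc-smooth retracts

An sc-smooth retraction `r : E → E` makes `X = r(E)` an M-polyfold whose atlas is generated by
the single global chart `id : X → X`; its topology is the (metrizable) subspace topology. In
this chart the tangent bundle of `X`, the tangent spaces, and sc-smoothness of maps are those of
the retract, as defined below. -/

section Retracts

variable {E F : ScScale}

/-- `r : E → E` is an sc-smooth retraction. -/
structure IsScRetraction (r : E.level 0 → E.level 0) : Prop where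
  smooth : ScSmooth r
  idem : ∀ x, r (r x) = r x

/-- A map `f : r(E) → s(F)` between retracts is sc-smooth if `f ∘ r : E → F` is. -/
def ScSmoothOnRetract (r : E.level 0 → E.level 0) (s : F.level 0 → F.level 0)
    (f : range r → range s) : Prop :=
  ScSmooth (E := E) (F := F) fun x => (f (rangeFactorization r x) : F.level 0)

/-- The set `X₁` of points of regularity one of `X = r(E)`. -/
def regularPoints (r : E.level 0 → E.level 0) : Set (E.level 1) :=
  {p | E.incl 0 p ∈ range r}

/-- The tangent space `T_pX = im Dr(p) ⊆ E₀` of `X = r(E)` at `p ∈ X₁`, with the scale induced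
from `E`. -/
def tangentSpace (r : E.level 0 → E.level 0) (p : E.level 1) : ScScale :=
  E.sub (LinearMap.range (scDeriv r p).toLinearMap)

/-- The tangent bundle `TX = Tr(TE)`, itself a retract in `TE`; its elements are pairs
(base point in `X₁`, tangent vector). -/
def tangentBundle (r : E.level 0 → E.level 0) : Set (E.tangent.level 0) :=
  range (scTangentMap r)

/-- `X = r(E)` is even-dimensional: every tangent space `T_pX`, `p ∈ X₁`, is
infinite-dimensional or has even dimension. -/
def IsEvenDimensional (r : E.level 0 → E.level 0) : Prop :=
  ∀ p ∈ regularPoints r,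
    ¬ FiniteDimensional ℝ ((tangentSpace r p).level 0) ∨
      Even (Module.finrank ℝ ((tangentSpace r p).level 0))

/-- `J : TX → TX` is an almost complex structure on `X = r(E)`: it is sc-smooth, and it restricts
for every `p ∈ X₁` to a linear sc-continuous map `J_p : T_pX → T_pX` with `J_p² = -id`. -/
structure IsAlmostComplexStructure (r : E.level 0 → E.level 0)
    (J : tangentBundle r → tangentBundle r) : Prop where
  smooth : ScSmoothOnRetract (E := E.tangent) (F := E.tangent) (scTangentMap r) (scTangentMap r) J
  fibre : ∀ p ∈ regularPoints r,
    ∃ Jp : (tangentSpace r p).level 0 →ₗ[ℝ] (tangentSpace r p).level 0,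
      ScContinuous (E := tangentSpace r p) (F := tangentSpace r p) Jp ∧
      (∀ v, Jp (Jp v) = -v) ∧
      ∀ v : (tangentSpace r p).level 0,
        ∃ w : tangentBundle r, w.1 = (p, v.1) ∧ (J w).1 = (p, (Jp v).1)

end Retracts

/-! ## Weighted Sobolev spaces on the line -/

/-- The Hilbert space `L²(ℝ)` of real-valued functions. -/
abbrev L2 : Type := Lp ℝ 2 (volume : Measure ℝ)

/-- The parameters of the scale of weighted Sobolev spaces. -/
structure WeightData where
  δ : ℕ → ℝ
  δ_zero : δ 0 = 0
  δ_strictMono : StrictMono δ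
  β : ℝ → ℝ
  β_smooth : ContDiff ℝ ∞ β
  β_odd : ∀ s, β (-s) = -β s
  β_mem : ∀ s, β s ∈ Icc (-1 : ℝ) 1
  β_one : ∀ s, 1 ≤ s → β s = 1

/-- `g` is a weak `j`-th derivative of `f` on `ℝ`. -/
def IsWeakDeriv (j : ℕ) (f g : ℝ → ℝ) : Prop :=
  ∀ φ : ℝ → ℝ, ContDiff ℝ ∞ φ → HasCompactSupport φ →
    ∫ s, f s * iteratedDeriv j φ s = (-1) ^ j * ∫ s, g s * φ s

open Classical in
/-- The weak derivative `Dʲf ∈ L²(ℝ)` of `f ∈ L²(ℝ)` (zero if there is none in `L²(ℝ)`). -/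
def weakDeriv (j : ℕ) (f : L2) : L2 :=
  if h : ∃ g : L2, IsWeakDeriv j f g then h.choose else 0

theorem L2.integrable_mul_test (f : L2) {φ : ℝ → ℝ} (h1 : Continuous φ)
    (h2 : HasCompactSupport φ) : Integrable (fun s => f s * φ s) :=
  MemLp.integrable_mul (p := 2) (q := 2) (Lp.memLp f) (h1.memLp_of_hasCompactSupport h2)

theorem hasCompactSupport_iteratedDeriv {φ : ℝ → ℝ} (h : HasCompactSupport φ) (j : ℕ) :
    HasCompactSupport (iteratedDeriv j φ) := by
  induction j with
  | zero => simpa using h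
  | succ j ih => rw [iteratedDeriv_succ]; exact ih.deriv

theorem integrable_mul_iteratedDeriv (f : L2) (j : ℕ) {φ : ℝ → ℝ} (h1 : ContDiff ℝ ∞ φ)
    (h2 : HasCompactSupport φ) : Integrable (fun s => f s * iteratedDeriv j φ s) :=
  L2.integrable_mul_test f (h1.continuous_iteratedDeriv j (by exact_mod_cast le_top))
    (hasCompactSupport_iteratedDeriv h2 j)

theorem IsWeakDeriv.unique {j : ℕ} {f g g' : L2} (h : IsWeakDeriv j f g)
    (h' : IsWeakDeriv j f g') : g = g' := by
  have key : ∀ᵐ s, (g - g') s = 0 := by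
    apply ae_eq_zero_of_integral_contDiff_smul_eq_zero
    · exact (Lp.memLp (g - g')).locallyIntegrable (by norm_num)
    · intro φ h1 h2
      have e := (h φ h1 h2).symm.trans (h' φ h1 h2)
      have e' : ∫ s, g s * φ s = ∫ s, g' s * φ s := by
        have : ((-1 : ℝ) ^ j) ≠ 0 := pow_ne_zero _ (by norm_num)
        exact mul_left_cancel₀ this e
      have e2 : ∫ s, φ s • (g - g') s = ∫ s, (g s * φ s - g' s * φ s) := by
        apply integral_congr_ae
        filter_upwards [Lp.coeFn_sub g g'] with s hs
        rw [hs]; simp; ring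
      rw [e2, integral_sub (L2.integrable_mul_test g h1.continuous h2)
        (L2.integrable_mul_test g' h1.continuous h2), e', sub_self]
  have : g - g' = 0 := (Lp.eq_zero_iff_ae_eq_zero).2 key
  exact sub_eq_zero.1 this

theorem IsWeakDeriv.add {j : ℕ} {f g f' g' : L2} (h : IsWeakDeriv j f g)
    (h' : IsWeakDeriv j f' g') : IsWeakDeriv j (f + f' : L2) (g + g' : L2) := by
  intro φ h1 h2
  have a : ∫ s, (f + f' : L2) s * iteratedDeriv j φ s
      = ∫ s, (f s * iteratedDeriv j φ s + f' s * iteratedDeriv j φ s) := by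
    apply integral_congr_ae
    filter_upwards [Lp.coeFn_add f f'] with s hs
    rw [hs]; simp; ring
  have b : ∫ s, (g + g' : L2) s * φ s = ∫ s, (g s * φ s + g' s * φ s) := by
    apply integral_congr_ae
    filter_upwards [Lp.coeFn_add g g'] with s hs
    rw [hs]; simp; ring
  rw [a, b, integral_add (integrable_mul_iteratedDeriv f j h1 h2)
    (integrable_mul_iteratedDeriv f' j h1 h2),
    integral_add (L2.integrable_mul_test g h1.continuous h2)
      (L2.integrable_mul_test g' h1.continuous h2), h φ h1 h2, h' φ h1 h2, mul_add]

theorem IsWeakDeriv.smul {j : ℕ} {f g : L2} (c : ℝ) (h : IsWeakDeriv j f g) :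
    IsWeakDeriv j (c • f : L2) (c • g : L2) := by
  intro φ h1 h2
  have a : ∫ s, (c • f : L2) s * iteratedDeriv j φ s
      = ∫ s, c * (f s * iteratedDeriv j φ s) := by
    apply integral_congr_ae
    filter_upwards [Lp.coeFn_smul c f] with s hs
    rw [hs]; simp; ring
  have b : ∫ s, (c • g : L2) s * φ s = ∫ s, c * (g s * φ s) := by
    apply integral_congr_ae
    filter_upwards [Lp.coeFn_smul c g] with s hs
    rw [hs]; simp; ring
  rw [a, b, integral_const_mul, integral_const_mul, h φ h1 h2]
  ring

theorem IsWeakDeriv.zero_self (f : L2) : IsWeakDeriv 0 f f := by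
  intro φ _ _
  simp

theorem IsWeakDeriv.eq_weakDeriv {j : ℕ} {f g : L2} (h : IsWeakDeriv j f g) :
    weakDeriv j f = g := by
  have hex : ∃ g : L2, IsWeakDeriv j f g := ⟨g, h⟩
  rw [weakDeriv, dif_pos hex]
  exact hex.choose_spec.unique h

namespace WeightData

variable (W : WeightData)

/-- The weight `exp (δ_m s β(s))`. -/
def weight (m : ℕ) (s : ℝ) : ℝ := Real.exp (W.δ m * s * W.β s)

theorem weight_pos (m : ℕ) (s : ℝ) : 0 < W.weight m s := Real.exp_pos _

theorem continuous_weight (m : ℕ) : Continuous (W.weight m) := by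
  have := W.β_smooth.continuous
  unfold weight
  fun_prop

theorem weight_zero (s : ℝ) : W.weight 0 s = 1 := by
  simp [weight, W.δ_zero]

theorem neg_one_le_mul (s : ℝ) : -1 ≤ s * W.β s := by
  have hb := W.β_mem s
  rcases le_or_gt 1 s with h | h
  · rw [W.β_one s h]; linarith
  rcases le_or_gt s (-1) with h' | h'
  · have := W.β_odd (-s)
    rw [neg_neg, W.β_one (-s) (by linarith)] at this
    rw [this]; linarith
  · have h1 : |s * W.β s| ≤ 1 := by
      rw [abs_mul]
      have a1 : |s| ≤ 1 := abs_le.2 ⟨h'.le, h.le⟩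
      have a2 : |W.β s| ≤ 1 := abs_le.2 ⟨hb.1, hb.2⟩
      exact mul_le_one₀ a1 (abs_nonneg _) a2
    exact (abs_le.1 h1).1

theorem weight_le (m : ℕ) (s : ℝ) :
    W.weight m s ≤ Real.exp (W.δ (m + 1) - W.δ m) * W.weight (m + 1) s := by
  unfold weight
  rw [← Real.exp_add]
  apply Real.exp_le_exp.2
  have h1 := W.neg_one_le_mul s
  have h2 : W.δ m < W.δ (m + 1) := W.δ_strictMono (Nat.lt_succ_self m)
  nlinarith

/-- The weighted Sobolev space `W^{m,δ_m}(ℝ)` as a subspace of `L²(ℝ)`: the functions whose weak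
derivatives `Dʲf`, `j ≤ m`, exist and satisfy `∫ |Dʲf|² exp (δ_m s β(s)) ds < ∞`. Such derivatives
lie in `L²(ℝ)` automatically, since the weight is bounded below by a positive constant. -/
def sobolevSubmodule (m : ℕ) : Submodule ℝ L2 where
  carrier := {f | ∀ j ≤ m, ∃ g : L2, IsWeakDeriv j f g ∧
    Integrable (fun s => g s ^ 2 * W.weight m s)}
  add_mem' := by
    intro f f' hf hf' j hj
    obtain ⟨g, hg, ig⟩ := hf j hj
    obtain ⟨g', hg', ig'⟩ := hf' j hj
    refine ⟨g + g', hg.add hg', ?_⟩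
    refine ((ig.add ig').const_mul 2).mono' ?_ ?_
    · exact (((Lp.aestronglyMeasurable _).pow 2).mul
        (W.continuous_weight m).aestronglyMeasurable)
    · filter_upwards [Lp.coeFn_add g g'] with s hs
      have hw := W.weight_pos m s
      rw [hs, Real.norm_of_nonneg (by positivity)]
      simp only [Pi.add_apply]
      nlinarith [mul_nonneg (sq_nonneg (g s - g' s)) hw.le]
  zero_mem' := by
    intro j _
    refine ⟨0, ?_, ?_⟩
    · intro φ h1 h2
      have z : ∀ ψ : ℝ → ℝ, ∫ s, (0 : L2) s * ψ s = 0 := by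
        intro ψ
        rw [← integral_zero ℝ ℝ]
        apply integral_congr_ae
        filter_upwards [Lp.coeFn_zero ℝ 2 (volume : Measure ℝ)] with s hs
        rw [hs]; simp
      rw [z, z, mul_zero]
    · apply (integrable_zero ℝ ℝ volume).congr
      filter_upwards [Lp.coeFn_zero ℝ 2 (volume : Measure ℝ)] with s hs
      rw [hs]; simp
  smul_mem' := by
    intro c f hf j hj
    obtain ⟨g, hg, ig⟩ := hf j hj
    refine ⟨c • g, hg.smul c, ?_⟩
    apply (ig.const_mul (c ^ 2)).congr
    filter_upwards [Lp.coeFn_smul c g] with s hs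
    rw [hs]; simp; ring

/-- The space `W^{m,δ_m}(ℝ)` as a type of its own, carrying its own norm (defined below) and not
the one of `L²(ℝ)`. -/
def Sobolev (m : ℕ) : Type := W.sobolevSubmodule m

instance (m : ℕ) : AddCommGroup (W.Sobolev m) :=
  inferInstanceAs (AddCommGroup (W.sobolevSubmodule m))

instance (m : ℕ) : Module ℝ (W.Sobolev m) :=
  inferInstanceAs (Module ℝ (W.sobolevSubmodule m))

/-- The inclusion `W^{m,δ_m}(ℝ) ⊆ L²(ℝ)`. -/
def Sobolev.toL2 {W : WeightData} {m : ℕ} : W.Sobolev m →ₗ[ℝ] L2 :=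
  (W.sobolevSubmodule m).subtype

variable {W} {m : ℕ}

theorem Sobolev.toL2_injective : Injective (Sobolev.toL2 (W := W) (m := m)) :=
  Subtype.val_injective

theorem Sobolev.spec (f : W.Sobolev m) {j : ℕ} (hj : j ≤ m) :
    IsWeakDeriv j (Sobolev.toL2 f) (weakDeriv j (Sobolev.toL2 f)) ∧
      Integrable (fun s => weakDeriv j (Sobolev.toL2 f) s ^ 2 * W.weight m s) := by
  obtain ⟨g, hg, ig⟩ := f.2 j hj
  have : weakDeriv j (Sobolev.toL2 f) = g := hg.eq_weakDeriv
  rw [this]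
  exact ⟨hg, ig⟩

theorem Sobolev.integrable_mul (f g : W.Sobolev m) {j : ℕ} (hj : j ≤ m) :
    Integrable (fun s => weakDeriv j (Sobolev.toL2 f) s * weakDeriv j (Sobolev.toL2 g) s
      * W.weight m s) := by
  refine ((f.spec hj).2.add (g.spec hj).2).mono' ?_ ?_
  · exact (((Lp.aestronglyMeasurable _).mul (Lp.aestronglyMeasurable _)).mul
      (W.continuous_weight m).aestronglyMeasurable)
  · refine Filter.Eventually.of_forall fun s => ?_
    have hw := W.weight_pos m s
    set a := weakDeriv j (Sobolev.toL2 f) s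
    set b := weakDeriv j (Sobolev.toL2 g) s
    simp only [Pi.add_apply]
    rw [Real.norm_eq_abs, abs_mul, abs_of_pos hw, abs_mul]
    have : |a| * |b| ≤ a ^ 2 + b ^ 2 := by
      nlinarith [sq_nonneg (|a| - |b|), sq_abs a, sq_abs b, sq_nonneg a, sq_nonneg b]
    nlinarith

/-- The inner product `⟨f, g⟩_m = ∑_{j ≤ m} ∫ Dʲf Dʲg exp (δ_m s β(s)) ds` on `W^{m,δ_m}(ℝ)`. -/
@[reducible] def Sobolev.innerCore (W : WeightData) (m : ℕ) : InnerProductSpace.Core ℝ (W.Sobolev m) where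
  inner f g := ∑ j ∈ Finset.range (m + 1),
    ∫ s, weakDeriv j (Sobolev.toL2 f) s * weakDeriv j (Sobolev.toL2 g) s * W.weight m s
  conj_inner_symm f g := by
    simp only [conj_trivial]
    refine Finset.sum_congr rfl fun j _ => ?_
    congr 1; ext s; ring
  re_inner_nonneg f := by
    simp only [RCLike.re_to_real]
    refine Finset.sum_nonneg fun j _ => integral_nonneg fun s => ?_
    exact mul_nonneg (mul_self_nonneg _) (W.weight_pos m s).le
  add_left f g h := by
    rw [← Finset.sum_add_distrib]
    refine Finset.sum_congr rfl fun j hj => ?_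
    have hj' : j ≤ m := Nat.lt_succ_iff.1 (Finset.mem_range.1 hj)
    rw [← integral_add (Sobolev.integrable_mul f h hj') (Sobolev.integrable_mul g h hj')]
    have e : weakDeriv j (Sobolev.toL2 (f + g))
        = weakDeriv j (Sobolev.toL2 f) + weakDeriv j (Sobolev.toL2 g) := by
      rw [map_add]
      exact ((f.spec hj').1.add (g.spec hj').1).eq_weakDeriv
    rw [e]
    apply integral_congr_ae
    filter_upwards [Lp.coeFn_add (weakDeriv j (Sobolev.toL2 f)) (weakDeriv j (Sobolev.toL2 g))]
      with s hs
    rw [hs]; simp; ring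
  smul_left f g c := by
    simp only [conj_trivial]
    rw [Finset.mul_sum]
    refine Finset.sum_congr rfl fun j hj => ?_
    have hj' : j ≤ m := Nat.lt_succ_iff.1 (Finset.mem_range.1 hj)
    have e : weakDeriv j (Sobolev.toL2 (c • f)) = c • weakDeriv j (Sobolev.toL2 f) := by
      rw [map_smul]
      exact ((f.spec hj').1.smul c).eq_weakDeriv
    rw [e, ← integral_const_mul]
    apply integral_congr_ae
    filter_upwards [Lp.coeFn_smul c (weakDeriv j (Sobolev.toL2 f))] with s hs
    rw [hs]; simp; ring
  definite f hf := by
    have nn : ∀ j ∈ Finset.range (m + 1),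
        0 ≤ ∫ s, weakDeriv j (Sobolev.toL2 f) s * weakDeriv j (Sobolev.toL2 f) s
          * W.weight m s := fun j _ => integral_nonneg fun s =>
      mul_nonneg (mul_self_nonneg _) (W.weight_pos m s).le
    have h0 := (Finset.sum_eq_zero_iff_of_nonneg nn).1 hf 0 (Finset.mem_range.2 (Nat.succ_pos m))
    rw [(IsWeakDeriv.zero_self (Sobolev.toL2 f)).eq_weakDeriv] at h0
    have hi := Sobolev.integrable_mul f f (Nat.zero_le m)
    rw [(IsWeakDeriv.zero_self (Sobolev.toL2 f)).eq_weakDeriv] at hi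
    rw [integral_eq_zero_iff_of_nonneg (fun s =>
      mul_nonneg (mul_self_nonneg _) (W.weight_pos m s).le) hi] at h0
    apply Sobolev.toL2_injective
    rw [map_zero]
    apply (Lp.eq_zero_iff_ae_eq_zero).2
    filter_upwards [h0] with s hs
    have hs' : (Sobolev.toL2 f) s * (Sobolev.toL2 f) s * W.weight m s = 0 := hs
    have := (W.weight_pos m s).ne'
    simpa [this] using hs'

instance (m : ℕ) : NormedAddCommGroup (W.Sobolev m) :=
  (Sobolev.innerCore W m).toNormedAddCommGroup

instance (m : ℕ) : InnerProductSpace ℝ (W.Sobolev m) :=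
  InnerProductSpace.ofCore (Sobolev.innerCore W m).toCore

theorem Sobolev.norm_sq_eq (f : W.Sobolev m) :
    ‖f‖ ^ 2 = ∑ j ∈ Finset.range (m + 1),
      ∫ s, weakDeriv j (Sobolev.toL2 f) s ^ 2 * W.weight m s := by
  rw [← real_inner_self_eq_norm_sq]
  refine Finset.sum_congr rfl fun j _ => ?_
  congr 1; ext s; ring

theorem sobolevSubmodule_succ_le (W : WeightData) (m : ℕ) :
    W.sobolevSubmodule (m + 1) ≤ W.sobolevSubmodule m := by
  intro f hf j hj
  obtain ⟨g, hg, ig⟩ := hf j (hj.trans (Nat.le_succ m))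
  refine ⟨g, hg, (ig.const_mul (Real.exp (W.δ (m + 1) - W.δ m))).mono' ?_ ?_⟩
  · exact (((Lp.aestronglyMeasurable _).pow 2).mul
      (W.continuous_weight m).aestronglyMeasurable)
  · refine Filter.Eventually.of_forall fun s => ?_
    rw [Real.norm_of_nonneg (mul_nonneg (sq_nonneg _) (W.weight_pos m s).le)]
    nlinarith [mul_le_mul_of_nonneg_left (W.weight_le m s) (sq_nonneg (g s))]

/-- The inclusion `W^{m+1,δ_{m+1}}(ℝ) ⊆ W^{m,δ_m}(ℝ)`. -/
def Sobolev.incl (W : WeightData) (m : ℕ) : W.Sobolev (m + 1) →L[ℝ] W.Sobolev m :=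
  LinearMap.mkContinuous
    (Submodule.inclusion (W.sobolevSubmodule_succ_le m) : W.Sobolev (m + 1) →ₗ[ℝ] W.Sobolev m)
    (Real.sqrt (Real.exp (W.δ (m + 1) - W.δ m))) (by
      intro f
      set i : W.Sobolev (m + 1) →ₗ[ℝ] W.Sobolev m :=
        Submodule.inclusion (W.sobolevSubmodule_succ_le m)
      have hi : Sobolev.toL2 (i f) = Sobolev.toL2 f := rfl
      set C := Real.exp (W.δ (m + 1) - W.δ m) with hC
      have hC0 : 0 ≤ C := (Real.exp_pos _).le
      apply le_of_sq_le_sq _ (by positivity)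
      rw [mul_pow, Real.sq_sqrt hC0, Sobolev.norm_sq_eq, Sobolev.norm_sq_eq, hi, Finset.mul_sum,
        Finset.sum_range_succ _ (m + 1)]
      have h1 : ∑ j ∈ Finset.range (m + 1),
            ∫ s, weakDeriv j (Sobolev.toL2 f) s ^ 2 * W.weight m s
          ≤ ∑ j ∈ Finset.range (m + 1),
            C * ∫ s, weakDeriv j (Sobolev.toL2 f) s ^ 2 * W.weight (m + 1) s := by
        refine Finset.sum_le_sum fun j hj => ?_
        have hj' : j ≤ m := Nat.lt_succ_iff.1 (Finset.mem_range.1 hj)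
        rw [← integral_const_mul]
        have k1 := ((i f).spec hj').2
        rw [hi] at k1
        refine integral_mono k1 ((f.spec (hj'.trans (Nat.le_succ m))).2.const_mul C) fun s => ?_
        have := mul_le_mul_of_nonneg_left (W.weight_le m s)
          (sq_nonneg (weakDeriv j (Sobolev.toL2 f) s))
        simp only
        nlinarith
      have h2 : 0 ≤ C * ∫ s, weakDeriv (m + 1) (Sobolev.toL2 f) s ^ 2 * W.weight (m + 1) s :=
        mul_nonneg hC0 (integral_nonneg fun s => mul_nonneg (sq_nonneg _) (W.weight_pos _ s).le)
      linarith)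

variable (W)

/-- The scale `E_m = W^{m,δ_m}(ℝ)` on `E₀ = L²(ℝ)`. -/
def sobolevScale : ScScale where
  level m := W.Sobolev m
  incl m := Sobolev.incl W m
  incl_injective m := fun _ _ h => Sobolev.toL2_injective
    (congrArg (fun u : W.Sobolev m => Sobolev.toL2 u) h :)

/-- The identification `L²(ℝ) = E₀`. -/
def ofL2 : L2 →ₗ[ℝ] W.Sobolev 0 :=
  LinearMap.codRestrict (W.sobolevSubmodule 0) LinearMap.id (by
    intro f j hj
    obtain rfl : j = 0 := Nat.le_zero.1 hj
    refine ⟨f, IsWeakDeriv.zero_self f, ?_⟩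
    simp only [W.weight_zero, mul_one]
    exact (Lp.memLp f).integrable_sq)

/-- The sc-space `ℝⁿ ⊕ ℝ ⊕ L²(ℝ)`. -/
def ambient (n : ℕ) : ScScale :=
  (ScScale.const (EuclideanSpace ℝ (Fin n))).prod ((ScScale.const ℝ).prod W.sobolevScale)

end WeightData

/-! ## The M-polyfolds `Γ_n^k` -/

/-- Smooth, compactly supported, `L²`-orthonormal functions `γ₁, …, γ_k` on `ℝ`. -/
structure BumpData (k : ℕ) where
  γ : Fin k → ℝ → ℝ
  smooth : ∀ j, ContDiff ℝ ∞ (γ j)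
  compact : ∀ j, HasCompactSupport (γ j)
  orthonormal : ∀ i j, ∫ s, γ i s * γ j s = if i = j then 1 else 0

namespace BumpData

variable {k : ℕ} (B : BumpData k)

theorem memLp_shift {g : ℝ → ℝ} (hg : Continuous g) (hc : HasCompactSupport g) (a : ℝ) :
    MemLp (fun s => g (s + a)) 2 (volume : Measure ℝ) :=
  (hg.comp (continuous_add_const a)).memLp_of_hasCompactSupport
    (hc.comp_homeomorph (Homeomorph.addRight a))

/-- The function `γ_j(· + e^{1/t})` in `L²(ℝ)`. -/
def shifted (j : Fin k) (t : ℝ) : L2 :=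
  (memLp_shift (B.smooth j).continuous (B.compact j) (Real.exp (1 / t))).toLp _

theorem memLp_rho (j : Fin k) {t : ℝ} (ht : 0 < t) :
    MemLp (fun s => deriv (fun u => B.γ j (s + Real.exp (1 / u))) t) 2
      (volume : Measure ℝ) := by
  have hd : ∀ s, deriv (fun u => B.γ j (s + Real.exp (1 / u))) t
      = (deriv (fun u => Real.exp (1 / u)) t) * deriv (B.γ j) (s + Real.exp (1 / t)) := by
    intro s
    have h1 : DifferentiableAt ℝ (fun u : ℝ => Real.exp (1 / u)) t := by
      have := ht.ne'
      fun_prop (disch := assumption)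
    have h2 : DifferentiableAt ℝ (B.γ j) (s + Real.exp (1 / t)) :=
      (B.smooth j).differentiable (by simp) _
    have h3 : HasDerivAt (fun u : ℝ => s + Real.exp (1 / u))
      (deriv (fun u => Real.exp (1 / u)) t) t := h1.hasDerivAt.const_add s
    rw [mul_comm]
    exact (h2.hasDerivAt.comp t h3).deriv
  simp only [hd]
  exact (memLp_shift ((B.smooth j).continuous_deriv (by simp))
    (B.compact j).deriv _).const_mul _

/-- The function `ρ_{j,t} = d/dt γ_j(· + e^{1/t})` in `L²(ℝ)`, for `t > 0`. -/
def rho (j : Fin k) (t : ℝ) : L2 :=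
  if ht : 0 < t then (B.memLp_rho j ht).toLp _ else 0

/-- The projection `π_t` of `L²(ℝ)`: zero for `t ≤ 0`, and the orthogonal projection to the span
of the functions `γ_j(· + e^{1/t})` for `t > 0`. -/
def proj (t : ℝ) (f : L2) : L2 :=
  if 0 < t then ∑ j, inner ℝ f (B.shifted j t) • B.shifted j t else 0

end BumpData

/-- The retraction `r (x, t, f) = (x, t, π_t f)` of `ℝⁿ ⊕ ℝ ⊕ L²(ℝ)`. Its image is `Γ_n^k`. -/
def gammaRetraction (W : WeightData) {k : ℕ} (B : BumpData k) (n : ℕ) :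
    (W.ambient n).level 0 → (W.ambient n).level 0 :=
  fun p : EuclideanSpace ℝ (Fin n) × ℝ × W.Sobolev 0 =>
    (⟨p.1, p.2.1, W.ofL2 (B.proj p.2.1 (WeightData.Sobolev.toL2 p.2.2))⟩ :
      EuclideanSpace ℝ (Fin n) × ℝ × W.Sobolev 0)

/-! ## The explicit almost complex structure -/

/-- For even `N`, the map `(a₁, …, a_N) ↦ (-a₂, a₁, -a₄, a₃, …, -a_N, a_{N-1})`; the indices in
the code start at zero. -/
def quarterTurn {N : ℕ} (a : Fin N → ℝ) : Fin N → ℝ := fun i =>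
  if Even i.1 then (if h : i.1 + 1 < N then -a ⟨i.1 + 1, h⟩ else 0)
  else a ⟨i.1 - 1, lt_of_le_of_lt (Nat.sub_le _ _) i.2⟩

/-- A vector of the zeroth level of `ℝⁿ ⊕ ℝ ⊕ L²(ℝ)`, with `ℝⁿ ⊕ ℝ` written as `ℝ^{n+1}`. -/
def ambientVec (W : WeightData) {n : ℕ} (a : Fin (n + 1) → ℝ) (f : L2) : (W.ambient n).level 0 :=
  (⟨WithLp.toLp 2 (fun i => a i.castSucc), a (Fin.last n), W.ofL2 f⟩ :
    EuclideanSpace ℝ (Fin n) × ℝ × W.Sobolev 0)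

/-- The point `(x, t, f)` of the first level of `ℝⁿ ⊕ ℝ ⊕ L²(ℝ)`. -/
def ambientPt (W : WeightData) {n : ℕ} (x : EuclideanSpace ℝ (Fin n)) (t : ℝ)
    (f : W.Sobolev 1) : (W.ambient n).level 1 :=
  (⟨x, t, f⟩ : EuclideanSpace ℝ (Fin n) × ℝ × W.Sobolev 1)

/-- `ξ_t = ∑ⱼ ⟨f, γ_j(· + e^{1/t})⟩ ρ_{j,t}`. -/
def BumpData.xi {k : ℕ} (B : BumpData k) (t : ℝ) (f : L2) : L2 :=
  ∑ j, inner ℝ f (B.shifted j t) • B.rho j t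

/-- `J` is given by the explicit formulas. Write a vector tangent to `Γ_n^k` at `p = (x, t, f)` as
`(a, h)` with `a = (δx₁, …, δxₙ, δt)`. If `t ≤ 0` then `h = 0` and `J_p (a, 0) = (a', 0)` with
`a' = (-δx₂, δx₁, …, -δx_{n-1}, δx_{n-2}, -δt, δxₙ)`. If `t > 0` then
`h = ∑ⱼ bⱼ γ_j(· + e^{1/t}) + δt ξ_t`, and
`J_p (a, h) = (a', ∑ⱼ b'ⱼ γ_j(· + e^{1/t}) + δxₙ ξ_t)` with `b' = (-b₂, b₁, …, -b_k, b_{k-1})`;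
note that `δxₙ` is the last entry of `a'`. -/
structure IsExplicitStructure (W : WeightData) {k : ℕ} (B : BumpData k) (n : ℕ)
    (J : tangentBundle (gammaRetraction W B n) → tangentBundle (gammaRetraction W B n)) :
    Prop where
  nonpos : ∀ (x : EuclideanSpace ℝ (Fin n)) (t : ℝ) (f : W.Sobolev 1) (a : Fin (n + 1) → ℝ)
    (h : L2) (w : tangentBundle (gammaRetraction W B n)), t ≤ 0 →
    w.1 = (ambientPt W x t f, ambientVec W a h) →
    h = 0 ∧ (J w).1 = (ambientPt W x t f, ambientVec W (quarterTurn a) 0)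
  pos : ∀ (x : EuclideanSpace ℝ (Fin n)) (t : ℝ) (f : W.Sobolev 1) (a : Fin (n + 1) → ℝ)
    (h : L2) (w : tangentBundle (gammaRetraction W B n)), 0 < t →
    w.1 = (ambientPt W x t f, ambientVec W a h) →
    ∃ b : Fin k → ℝ,
      h = ∑ j, b j • B.shifted j t + a (Fin.last n) • B.xi t (WeightData.Sobolev.toL2 f) ∧
      (J w).1 = (ambientPt W x t f, ambientVec W (quarterTurn a)
        (∑ j, quarterTurn b j • B.shifted j t
          + quarterTurn a (Fin.last n) • B.xi t (WeightData.Sobolev.toL2 f)))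

end

noncomputable section

/-! Everything rests on one competition of exponentials. Translating a test function by a ≥ 0 makes
its norm in W^{m,δ_m} grow at most like e^{δ_m a/2}, while pairing with the translate is a
functional on W^{b,δ_b} of norm at most of order e^{-δ_b a/2} (`norm_ofTest_shift_le`,
`abs_inner_shift_le`). With a = e^{1/t}, the rank-one operator t^{-p} e^{q/t} ⟨·, u_t⟩ v_t from
W^{b,δ_b} to W^{m,δ_m} is therefore bounded by a constant times t^{-p} e^{q/t} exp(-(δ_b - δ_m)
e^{1/t}/2). If b > m, the double exponential wins and the bound is O(t²) for all p and q; so the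
extension by zero to t ≤ 0 is differentiable, also at t = 0 (`hasFDerivAt_transOp`). If b = m and p
= q = 0, the operators are only uniformly bounded, and density of test functions gives continuity at
t = 0 (`continuous_transOp_self`).

Differentiating such an operator in t produces operators of the same kind with larger p, q and with
u or v differentiated. They need b > m, and the base point of a tangent vector supplies the extra
level. Hence the class of maps generated by these operators and by sc-operators contains a tangent
map of each of its members (`scGen_transTangent`, `hasScTangent_transMap`), and induction on k makes
all of them sc-smooth (`ScGen.scSmooth`). The retraction is in the class, with p = q = 0.

That E is a reflexive sc-space is Hilbert space theory plus two approximation arguments. The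
weighted derivatives embed W^{m,δ_m} isometrically, with closed range, in a finite power of L²(ℝ).
Cut-off and mollification make test functions dense (`denseRange_ofTest`). The inclusions are
compact because tails are uniformly small by δ_m < δ_{m+1}, and on a bounded interval one more
derivative allows uniform approximation by step functions (`isCompactOperator_wderivL_incl`).

For the almost complex structure, differentiate r: a tangent vector at (x, t, f) with t > 0 is (a, ∑
b_j γ_{j,t} + δt ξ_t), so the dimension is n + 1 + k for t > 0 and n + 1 for t ≤ 0, which gives the
parity criterion. The derivative of the orthonormality relations yields b_j = ⟨h, γ_{j,t}⟩ + δt ⟨f,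
ρ_{j,t}⟩ (`coeff_tangentL2`). Thus J, which turns a and b by quarter turns in consecutive pairs of
coordinates, extends to TE by an explicit formula (`turnMap`). In it the singular factor t^{-2}
e^{1/t} only multiplies expressions in the base point f, which has a level to spare, so the formula
belongs to the class and J is sc-smooth across t = 0. -/

/-! ## sc-operators and classes of maps that are closed under the tangent functor -/

/-- An sc-operator `E → F`: a family of bounded operators `E_m → F_m` compatible with the
inclusions. -/
structure ScLin (E F : ScScale) where
  map : ∀ m, E.level m →L[ℝ] F.level m
  comm : ∀ m x, F.incl m (map (m + 1) x) = map m (E.incl m x)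

namespace ScLin

variable {E F H : ScScale}

theorem emb_map (L : ScLin E F) : ∀ m x, F.emb m (L.map m x) = L.map 0 (E.emb m x)
  | 0, _ => rfl
  | m + 1, x => by
    change F.emb m (F.incl m (L.map (m + 1) x)) = L.map 0 (E.emb m (E.incl m x))
    rw [L.comm, emb_map L m]

/-- Composition of sc-operators. -/
def comp (A : ScLin F H) (L : ScLin E F) : ScLin E H where
  map m := (A.map m).comp (L.map m)
  comm m x := by simp [A.comm, L.comm]

/-- The tangent of an sc-operator. -/
def tangent (L : ScLin E F) : ScLin E.tangent F.tangent where
  map m := (L.map (m + 1)).prodMap (L.map m)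
  comm m x := Prod.ext (L.comm (m + 1) x.1) (L.comm m x.2)

/-- The projection `TE → E` to the base. -/
def base (E : ScScale) : ScLin E.tangent E where
  map m := (E.incl m).comp (ContinuousLinearMap.fst ℝ (E.level (m + 1)) (E.level m))
  comm _ _ := rfl

/-- The projection `TE → E`, `(x, h) ↦ h`. -/
def vec (E : ScScale) : ScLin E.tangent E where
  map m := ContinuousLinearMap.snd ℝ (E.level (m + 1)) (E.level m)
  comm _ _ := rfl

/-- The inclusion `E → TE`, `h ↦ (0, h)`. -/
def vert (E : ScScale) : ScLin E E.tangent where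
  map m := ContinuousLinearMap.inr ℝ (E.level (m + 1)) (E.level m)
  comm m _ := Prod.ext (map_zero (E.incl (m + 1))) rfl

/-- First projection. -/
def fst (E F : ScScale) : ScLin (E.prod F) E where
  map m := ContinuousLinearMap.fst ℝ (E.level m) (F.level m)
  comm _ _ := rfl

/-- Second projection. -/
def snd (E F : ScScale) : ScLin (E.prod F) F where
  map m := ContinuousLinearMap.snd ℝ (E.level m) (F.level m)
  comm _ _ := rfl

/-- A scalar multiple of the identity. -/
def smulId (E : ScScale) (c : ℝ) : ScLin E E where
  map m := c • ContinuousLinearMap.id ℝ (E.level m)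
  comm m x := by simp

end ScLin

/-- All inclusions `E_{m+1} ⊆ E_m` have dense range. -/
def ScScale.DenseIncl (E : ScScale) : Prop := ∀ m, DenseRange (E.incl m)

theorem ScScale.DenseIncl.tangent {E : ScScale} (h : E.DenseIncl) : E.tangent.DenseIncl :=
  fun m => (h (m + 1)).prodMap (h m)

/-- `T` is the tangent map of the sc-continuous and sc-differentiable map `f`. -/
def HasScTangent {E F : ScScale} (f : E.level 0 → F.level 0)
    (T : E.level 1 × E.level 0 → F.level 1 × F.level 0) : Prop :=
  ScContinuous f ∧ (∀ w, F.incl 0 (T w).1 = f (E.incl 0 w.1)) ∧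
    ∀ x, ∃ A, HasScDerivAt f A x ∧ ∀ h, (T (x, h)).2 = A h

/-- Uniqueness of Fréchet derivatives only compares the two operators on E₁; density of E₁ in E₀ and
continuity do the rest. -/
theorem HasScDerivAt.unique {E F : ScScale} (hE : DenseRange (E.incl 0))
    {f : E.level 0 → F.level 0} {A B : E.level 0 →L[ℝ] F.level 0} {x : E.level 1}
    (hA : HasScDerivAt f A x) (hB : HasScDerivAt f B x) : A = B := by
  have h := HasFDerivAt.unique hA hB
  have h' : ⇑A = ⇑B := hE.equalizer A.continuous B.continuous
    (by ext y; exact congrArg (fun T => T y) h)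
  exact DFunLike.coe_injective h'

theorem HasScDerivAt.scDeriv_eq {E F : ScScale} (hE : DenseRange (E.incl 0))
    {f : E.level 0 → F.level 0} {A : E.level 0 →L[ℝ] F.level 0} {x : E.level 1}
    (hA : HasScDerivAt f A x) : scDeriv f x = A := by
  have hex : ∃ A, HasScDerivAt f A x := ⟨A, hA⟩
  rw [scDeriv, dif_pos hex]
  exact hex.choose_spec.unique hE hA

/-- `scTangentMap` is built from choices (`choose` and `invFun`). Uniqueness of the derivative and
injectivity of F₁ → F₀ remove them, so that an explicit formula can be differentiated again. -/
theorem HasScTangent.scTangentMap_eq {E F : ScScale} (hE : DenseRange (E.incl 0))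
    {f : E.level 0 → F.level 0} {T : E.level 1 × E.level 0 → F.level 1 × F.level 0}
    (h : HasScTangent f T) : (scTangentMap f : E.level 1 × E.level 0 → _) = T := by
  funext w
  obtain ⟨A, hA, hT⟩ := h.2.2 w.1
  refine Prod.ext ?_ ?_
  · change invFun (F.incl 0) (f (E.incl 0 w.1)) = (T w).1
    rw [← h.2.1 w]
    exact leftInverse_invFun (F.incl_injective 0) _
  · change scDeriv f w.1 w.2 = (T w).2
    rw [hA.scDeriv_eq hE]
    exact (hT w.2).symm

/-- The maps generated from the class `G` and the sc-operators by sums, multiplication with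
linear functionals, and composition with sc-operators. -/
inductive ScGen (G : ∀ E F : ScScale, (E.level 0 → F.level 0) → Prop) :
    ∀ E F : ScScale, (E.level 0 → F.level 0) → Prop
  | gen {E F f} : G E F f → ScGen G E F f
  | lin {E F} (L : ScLin E F) : ScGen G E F (L.map 0)
  | add {E F f g} : ScGen G E F f → ScGen G E F g → ScGen G E F (fun x => f x + g x)
  | smul {E F f} (l : ScLin E (ScScale.const ℝ)) : ScGen G E F f →
      ScGen G E F (fun x => (show ℝ from l.map 0 x) • f x)
  | postcomp {E F H f} (A : ScLin F H) : ScGen G E F f → ScGen G E H (fun x => A.map 0 (f x))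
  | precomp {E F H f} (L : ScLin H E) : ScGen G E F f → ScGen G H F (fun x => f (L.map 0 x))

theorem ScLin.hasScTangent {E F : ScScale} (L : ScLin E F) :
    HasScTangent (L.map 0) (L.tangent.map 0) := by
  refine ⟨fun m => ⟨L.map m, (L.map m).continuous, L.emb_map m⟩, fun w => L.comm 0 w.1,
    fun x => ⟨L.map 0, ?_, fun h => rfl⟩⟩
  exact ((L.map 0).comp (E.incl 0)).hasFDerivAt

theorem HasScTangent.add {E F : ScScale} {f g : E.level 0 → F.level 0}
    {T S : E.level 1 × E.level 0 → F.level 1 × F.level 0} (hf : HasScTangent f T)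
    (hg : HasScTangent g S) : HasScTangent (fun x => f x + g x) (fun w => T w + S w) := by
  refine ⟨fun m => ?_, fun w => ?_, fun x => ?_⟩
  · obtain ⟨a, ha, ha'⟩ := hf.1 m
    obtain ⟨b, hb, hb'⟩ := hg.1 m
    exact ⟨fun x => a x + b x, ha.add hb, fun x => by rw [map_add, ha', hb']⟩
  · change F.incl 0 ((T w).1 + (S w).1) = _
    rw [map_add, hf.2.1, hg.2.1]
  · obtain ⟨A, hA, hA'⟩ := hf.2.2 x
    obtain ⟨B, hB, hB'⟩ := hg.2.2 x
    refine ⟨A + B, ?_, fun h => ?_⟩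
    · exact HasFDerivAt.add hA hB
    · change (T (x, h)).2 + (S (x, h)).2 = _
      rw [hA', hB']; rfl

/-- Product rule D(l f)(x) h = l(x) Df(x) h + l(h) f(x). The second term is a vertical vector, and
f(x) is recovered as the base point of T, so the result is expressed through T and sc-operators
alone. -/
theorem HasScTangent.smul {E F : ScScale} {f : E.level 0 → F.level 0}
    {T : E.level 1 × E.level 0 → F.level 1 × F.level 0} (hf : HasScTangent f T)
    (l : ScLin E (ScScale.const ℝ)) :
    HasScTangent (fun x => (show ℝ from l.map 0 x) • f x)
      (fun w => show F.tangent.level 0 from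
        (show ℝ from (l.comp (ScLin.base E)).map 0 w) • (show F.tangent.level 0 from T w) +
        (show ℝ from (l.comp (ScLin.vec E)).map 0 w) •
          ((ScLin.vert F).comp (ScLin.base F)).map 0 (T w)) := by
  refine ⟨fun m => ?_, fun w => ?_, fun x => ?_⟩
  · obtain ⟨a, ha, ha'⟩ := hf.1 m
    refine ⟨fun x => (show ℝ from l.map m x) • a x, ?_, fun x => ?_⟩
    · have hl : Continuous (fun x => (show ℝ from l.map m x)) := (l.map m).continuous
      exact hl.smul ha
    · rw [map_smul, ha']
      congr 1
      have := l.emb_map m x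
      have h2 : ∀ m (c : ℝ), (ScScale.const ℝ).emb m c = c := by
        intro m
        induction m with
        | zero => intro c; rfl
        | succ m ih => intro c; exact ih c
      rw [← this]; exact (h2 m _).symm
  · change F.incl 0 ((show ℝ from l.map 0 (E.incl 0 w.1)) • (T w).1 +
      (show ℝ from l.map 0 w.2) • (0 : F.level 1)) = _
    rw [smul_zero, add_zero, map_smul, hf.2.1]
  · obtain ⟨A, hA, hA'⟩ := hf.2.2 x
    let l0 : E.level 0 →L[ℝ] ℝ := l.map 0
    refine ⟨l0 (E.incl 0 x) • A + l0.smulRight (f (E.incl 0 x)), ?_, fun h => ?_⟩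
    · exact HasFDerivAt.smul (c := fun y : E.level 1 => l0 (E.incl 0 y))
        (c' := l0.comp (E.incl 0)) ((l0.comp (E.incl 0)).hasFDerivAt) hA
    · change (show ℝ from l.map 0 (E.incl 0 x)) • (T (x, h)).2 +
        (show ℝ from l.map 0 h) • F.incl 0 (T (x, h)).1 = _
      rw [hA', hf.2.1]; rfl

theorem HasScTangent.postcomp {E F H : ScScale} {f : E.level 0 → F.level 0}
    {T : E.level 1 × E.level 0 → F.level 1 × F.level 0} (hf : HasScTangent f T)
    (A : ScLin F H) : HasScTangent (fun x => A.map 0 (f x)) (fun w => A.tangent.map 0 (T w)) := by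
  refine ⟨fun m => ?_, fun w => ?_, fun x => ?_⟩
  · obtain ⟨a, ha, ha'⟩ := hf.1 m
    exact ⟨fun x => A.map m (a x), (A.map m).continuous.comp ha, fun x => by
      rw [A.emb_map, ha']⟩
  · change H.incl 0 (A.map 1 (T w).1) = _
    rw [A.comm, hf.2.1]
  · obtain ⟨B, hB, hB'⟩ := hf.2.2 x
    refine ⟨(A.map 0).comp B, ?_, fun h => ?_⟩
    · exact HasFDerivAt.comp (g := A.map 0) x (A.map 0).hasFDerivAt hB
    · change A.map 0 (T (x, h)).2 = _
      rw [hB']; rfl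

/-- For a linear inner map the chain rule is elementary, because the operator already maps H₁ to E₁
continuously. The general sc-chain rule, which depends on compactness, is not needed. -/
theorem HasScTangent.precomp {E F H : ScScale} {f : E.level 0 → F.level 0}
    {T : E.level 1 × E.level 0 → F.level 1 × F.level 0} (hf : HasScTangent f T)
    (L : ScLin H E) : HasScTangent (fun x => f (L.map 0 x)) (fun w => T (L.tangent.map 0 w)) := by
  refine ⟨fun m => ?_, fun w => ?_, fun x => ?_⟩
  · obtain ⟨a, ha, ha'⟩ := hf.1 m
    exact ⟨fun x => a (L.map m x), ha.comp (L.map m).continuous, fun x => by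
      rw [ha', L.emb_map]⟩
  · exact (hf.2.1 (L.tangent.map 0 w)).trans (congrArg f (L.comm 0 w.1))
  · obtain ⟨B, hB, hB'⟩ := hf.2.2 (L.map 1 x)
    refine ⟨B.comp (L.map 0), ?_, fun h => ?_⟩
    · have h1 := HasFDerivAt.comp (f := L.map 1) x hB (L.map 1).hasFDerivAt
      have e1 : (fun y : H.level 1 => f (L.map 0 (H.incl 0 y)))
          = (fun y : E.level 1 => f (E.incl 0 y)) ∘ (L.map 1) := by
        funext y; exact congrArg f (L.comm 0 y).symm
      have e2 : (B.comp (L.map 0)).comp (H.incl 0) = (B.comp (E.incl 0)).comp (L.map 1) := by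
        ext y; exact congrArg B (L.comm 0 y).symm
      unfold HasScDerivAt
      rw [e1, e2]
      exact h1
    · exact hB' (L.map 0 h)

/-- If every generator has a tangent map in the generated class, so has every map of the class. -/
theorem ScGen.exists_tangent {G : ∀ E F : ScScale, (E.level 0 → F.level 0) → Prop}
    (hG : ∀ E F f, G E F f → ∃ T, HasScTangent f T ∧ ScGen G E.tangent F.tangent T)
    {E F : ScScale} {f : E.level 0 → F.level 0} (hf : ScGen G E F f) :
    ∃ T, HasScTangent f T ∧ ScGen G E.tangent F.tangent T := by
  induction hf with
  | gen h => exact hG _ _ _ h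
  | lin L => exact ⟨_, L.hasScTangent, .lin L.tangent⟩
  | add _ _ h1 h2 =>
    obtain ⟨T, hT, gT⟩ := h1
    obtain ⟨S, hS, gS⟩ := h2
    exact ⟨_, hT.add hS, gT.add gS⟩
  | smul l _ h =>
    obtain ⟨T, hT, gT⟩ := h
    exact ⟨_, hT.smul l, (gT.smul _).add ((gT.postcomp _).smul _)⟩
  | postcomp A _ h =>
    obtain ⟨T, hT, gT⟩ := h
    exact ⟨_, hT.postcomp A, gT.postcomp _⟩
  | precomp L _ h =>
    obtain ⟨T, hT, gT⟩ := h
    exact ⟨_, hT.precomp L, gT.precomp _⟩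

/-- Closure under tangents lets the induction on k run, with both scales generalized since the step
passes to TE and TF. Density of the inclusions is inherited by TE and identifies the abstract
tangent map at every stage. -/
theorem ScGen.scSmooth {G : ∀ E F : ScScale, (E.level 0 → F.level 0) → Prop}
    (hG : ∀ E F f, G E F f → ∃ T, HasScTangent f T ∧ ScGen G E.tangent F.tangent T)
    {E F : ScScale} {f : E.level 0 → F.level 0} (hE : E.DenseIncl) (hf : ScGen G E F f) :
    ScSmooth f := by
  intro k
  induction k generalizing E F with
  | zero =>
    obtain ⟨T, hT, -⟩ := hf.exists_tangent hG
    exact hT.1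
  | succ k ih =>
    obtain ⟨T, hT, gT⟩ := hf.exists_tangent hG
    refine ⟨hT.1, fun x => ?_, ?_⟩
    · obtain ⟨A, hA, -⟩ := hT.2.2 x
      exact ⟨A, hA⟩
    · have e : scTangentMap f = T := hT.scTangentMap_eq (hE 0)
      rw [e]
      exact ih hE.tangent gT

theorem ScGen.sum {G : ∀ E F : ScScale, (E.level 0 → F.level 0) → Prop} {E F : ScScale}
    {ι : Type*} (s : Finset ι) {f : ι → E.level 0 → F.level 0}
    (hf : ∀ i ∈ s, ScGen G E F (f i)) : ScGen G E F (fun x => ∑ i ∈ s, f i x) := by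
  classical
  induction s using Finset.induction_on with
  | empty =>
    have h : ScGen G E F (fun x => (0 : F.level 0)) := by
      have := ScGen.lin (G := G) (⟨fun _ => 0, fun m x => by simp⟩ : ScLin E F)
      exact this
    simpa using h
  | insert a s ha ih =>
    simp only [Finset.sum_insert ha]
    exact (hf a (Finset.mem_insert_self a s)).add
      (ih fun i hi => hf i (Finset.mem_insert_of_mem hi))

theorem ScGen.const_smul {G : ∀ E F : ScScale, (E.level 0 → F.level 0) → Prop} {E F : ScScale}
    {f : E.level 0 → F.level 0} (c : ℝ) (hf : ScGen G E F f) :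
    ScGen G E F (fun x => c • f x) := by
  have := hf.postcomp (ScLin.smulId F c)
  exact this

/-! ## Test functions and weak derivatives -/

/-- A smooth compactly supported function on `ℝ`. -/
structure TestFun where
  toFun : ℝ → ℝ
  smooth : ContDiff ℝ ∞ toFun
  compact : HasCompactSupport toFun

namespace TestFun

instance : CoeFun TestFun fun _ => ℝ → ℝ := ⟨toFun⟩

@[ext] theorem ext {u v : TestFun} (h : ∀ s, u s = v s) : u = v := by
  cases u; cases v; congr; exact funext h

theorem continuous (u : TestFun) : Continuous u := u.smooth.continuous

/-- The derivative of a test function. -/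
def deriv (u : TestFun) : TestFun where
  toFun := _root_.deriv u
  smooth := (contDiff_infty_iff_deriv.1 u.smooth).2
  compact := u.compact.deriv

/-- The iterated derivative of a test function. -/
def iterDeriv (j : ℕ) (u : TestFun) : TestFun where
  toFun := iteratedDeriv j u
  smooth := by
    rw [iteratedDeriv_eq_iterate]
    exact ContDiff.iterate_deriv j u.smooth
  compact := hasCompactSupport_iteratedDeriv u.compact j

theorem memLp (u : TestFun) : MemLp u 2 (volume : Measure ℝ) :=
  u.continuous.memLp_of_hasCompactSupport u.compact

/-- A test function as an element of `L²(ℝ)`. -/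
def toL2 (u : TestFun) : L2 := u.memLp.toLp _

theorem coeFn_toL2 (u : TestFun) : u.toL2 =ᵐ[volume] u := u.memLp.coeFn_toLp

theorem hasDerivAt (u : TestFun) (s : ℝ) : HasDerivAt u (u.deriv s) s :=
  (u.smooth.differentiable (by simp) s).hasDerivAt (f := u.toFun)

theorem integral_mul (u : TestFun) (f : L2) : ∫ s, f s * u s = inner ℝ f u.toL2 := by
  rw [L2.inner_def]
  apply integral_congr_ae
  filter_upwards [u.coeFn_toL2] with s hs
  rw [hs]; simp [mul_comm]

theorem integrable (u : TestFun) : Integrable u :=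
  u.continuous.integrable_of_hasCompactSupport u.compact

/-- Multiplication of a test function by a smooth function. -/
def mul (a : ℝ → ℝ) (ha : ContDiff ℝ ∞ a) (u : TestFun) : TestFun where
  toFun s := a s * u s
  smooth := ha.mul u.smooth
  compact := u.compact.mul_left

theorem integral_deriv_mul (a : ℝ → ℝ) (ha : ContDiff ℝ ∞ a) (u : TestFun) :
    ∫ s, a s * u.deriv s = -∫ s, _root_.deriv a s * u s := by
  have ha' : Continuous (_root_.deriv a) := ha.continuous_deriv (by simp)
  refine integral_mul_deriv_eq_deriv_mul_of_integrable
    (fun x _ => (ha.differentiable (by simp) x).hasDerivAt) (fun x _ => u.hasDerivAt x) ?_ ?_ ?_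
  · exact (ha.continuous.mul u.deriv.continuous).integrable_of_hasCompactSupport
      u.deriv.compact.mul_left
  · exact (ha'.mul u.continuous).integrable_of_hasCompactSupport u.compact.mul_left
  · exact (ha.continuous.mul u.continuous).integrable_of_hasCompactSupport u.compact.mul_left

end TestFun

theorem IsWeakDeriv.succ {j : ℕ} {f g h : ℝ → ℝ} (h1 : IsWeakDeriv j f g)
    (h2 : IsWeakDeriv 1 g h) : IsWeakDeriv (j + 1) f h := by
  intro φ hφ hc
  rw [iteratedDeriv_succ', h1 _ (contDiff_infty_iff_deriv.1 hφ).2 hc.deriv]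
  have := h2 φ hφ hc
  rw [iteratedDeriv_one] at this
  rw [this]; ring

theorem IsWeakDeriv.of_succ {j : ℕ} {f g h : ℝ → ℝ} (h1 : IsWeakDeriv j f g)
    (h2 : IsWeakDeriv (j + 1) f h) : IsWeakDeriv 1 g h := by
  intro φ hφ hc
  have e1 := h1 _ (contDiff_infty_iff_deriv.1 hφ).2 hc.deriv
  have e2 := h2 φ hφ hc
  rw [iteratedDeriv_succ', e1] at e2
  rw [iteratedDeriv_one]
  have : ((-1 : ℝ) ^ j) ≠ 0 := pow_ne_zero _ (by norm_num)
  apply mul_left_cancel₀ this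
  rw [e2]; ring

theorem IsWeakDeriv.congr {j : ℕ} {f g f' g' : ℝ → ℝ} (h : IsWeakDeriv j f g)
    (hf : f =ᵐ[volume] f') (hg : g =ᵐ[volume] g') : IsWeakDeriv j f' g' := by
  intro φ hφ hc
  have e1 : ∫ s, f' s * iteratedDeriv j φ s = ∫ s, f s * iteratedDeriv j φ s := by
    apply integral_congr_ae
    filter_upwards [hf] with s hs
    rw [hs]
  have e2 : ∫ s, g' s * φ s = ∫ s, g s * φ s := by
    apply integral_congr_ae
    filter_upwards [hg] with s hs
    rw [hs]
  rw [e1, e2]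
  exact h φ hφ hc

theorem isWeakDeriv_iff_inner {j : ℕ} {f g : L2} : IsWeakDeriv j f g ↔
    ∀ φ : TestFun, inner ℝ f (φ.iterDeriv j).toL2 = (-1) ^ j * inner ℝ g φ.toL2 := by
  constructor
  · intro h φ
    rw [← TestFun.integral_mul, ← TestFun.integral_mul]
    exact h φ φ.smooth φ.compact
  · intro h φ h1 h2
    have := h ⟨φ, h1, h2⟩
    rw [← TestFun.integral_mul, ← TestFun.integral_mul] at this
    exact this

/-- Tested against a fixed φ, the relation is an equation between continuous functions of f and g in
L²(ℝ), hence closed. -/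
theorem IsWeakDeriv.of_tendsto {ι : Type*} {l : Filter ι} [l.NeBot] {j : ℕ} {f g : ι → L2}
    {f₀ g₀ : L2} (h : ∀ i, IsWeakDeriv j (f i) (g i)) (hf : Filter.Tendsto f l (nhds f₀))
    (hg : Filter.Tendsto g l (nhds g₀)) : IsWeakDeriv j f₀ g₀ := by
  rw [isWeakDeriv_iff_inner]
  intro φ
  refine tendsto_nhds_unique (hf.inner tendsto_const_nhds) ?_
  have := (hg.inner (𝕜 := ℝ) (tendsto_const_nhds (x := φ.toL2))).const_mul ((-1 : ℝ) ^ j)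
  refine this.congr fun i => ?_
  exact ((isWeakDeriv_iff_inner.1 (h i)) φ).symm

theorem TestFun.isWeakDeriv (u : TestFun) (j : ℕ) : IsWeakDeriv j u (u.iterDeriv j) := by
  induction j with
  | zero => intro φ _ _; simp [TestFun.iterDeriv]
  | succ j ih =>
    refine ih.succ fun φ h1 h2 => ?_
    rw [iteratedDeriv_one, pow_one, neg_one_mul]
    have := TestFun.integral_deriv_mul (u.iterDeriv j) (u.iterDeriv j).smooth ⟨φ, h1, h2⟩
    refine Eq.trans this ?_
    have e : _root_.deriv (u.iterDeriv j) = u.iterDeriv (j + 1) := by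
      simp only [TestFun.iterDeriv, iteratedDeriv_succ]
    rw [e]

theorem TestFun.weakDeriv_toL2 (u : TestFun) (j : ℕ) :
    weakDeriv j u.toL2 = (u.iterDeriv j).toL2 :=
  ((u.isWeakDeriv j).congr u.coeFn_toL2.symm (u.iterDeriv j).coeFn_toL2.symm).eq_weakDeriv

/-! ### Multiplication operators on L²(ℝ). -/

theorem memLp_mulL2 {a : ℝ → ℝ} (ha : Continuous a) {C : ℝ} (hC : ∀ s, |a s| ≤ C) (f : L2) :
    MemLp (fun s => a s * f s) 2 (volume : Measure ℝ) :=
  (Lp.memLp f).of_le_mul (c := C) (ha.aestronglyMeasurable.mul (Lp.aestronglyMeasurable f))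
    (Filter.Eventually.of_forall fun s => by
      rw [norm_mul]; exact mul_le_mul_of_nonneg_right (hC s) (norm_nonneg _))

/-- Multiplication with a bounded continuous function on `L²(ℝ)`. -/
def mulL2 (a : ℝ → ℝ) (ha : Continuous a) (C : ℝ) (hC : ∀ s, |a s| ≤ C) : L2 →L[ℝ] L2 :=
  have hm := memLp_mulL2 ha hC
  LinearMap.mkContinuous
    { toFun := fun f => (hm f).toLp _
      map_add' := fun f g => by
        apply Lp.ext
        filter_upwards [(hm (f + g)).coeFn_toLp, (hm f).coeFn_toLp, (hm g).coeFn_toLp,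
          Lp.coeFn_add f g, Lp.coeFn_add ((hm f).toLp _) ((hm g).toLp _)] with s h1 h2 h3 h4 h5
        rw [h1, h5, Pi.add_apply, h2, h3, h4, Pi.add_apply, mul_add]
      map_smul' := fun c f => by
        apply Lp.ext
        filter_upwards [(hm (c • f)).coeFn_toLp, (hm f).coeFn_toLp,
          Lp.coeFn_smul c f, Lp.coeFn_smul c ((hm f).toLp _)] with s h1 h2 h3 h4
        rw [h1, RingHom.id_apply, h4, Pi.smul_apply, h2, h3, Pi.smul_apply, smul_eq_mul,
          smul_eq_mul]
        ring } C fun f => by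
    apply Lp.norm_le_mul_norm_of_ae_le_mul
    filter_upwards [(hm f).coeFn_toLp] with s hs
    change ‖((hm f).toLp _ : L2) s‖ ≤ _
    rw [hs, norm_mul]
    exact mul_le_mul_of_nonneg_right (hC s) (norm_nonneg _)

theorem coeFn_mulL2 (a : ℝ → ℝ) (ha : Continuous a) (C : ℝ) (hC : ∀ s, |a s| ≤ C) (f : L2) :
    mulL2 a ha C hC f =ᵐ[volume] fun s => a s * f s :=   (memLp_mulL2 ha hC f).coeFn_toLp

/-! ### Weighted Sobolev spaces as Hilbert spaces. -/

namespace WeightData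

variable (W : WeightData)

/-- The square root of the weight. -/
def rootWeight (m : ℕ) (s : ℝ) : ℝ := Real.exp (W.δ m * s * W.β s / 2)

theorem rootWeight_pos (m : ℕ) (s : ℝ) : 0 < W.rootWeight m s := Real.exp_pos _

theorem rootWeight_sq (m : ℕ) (s : ℝ) : W.rootWeight m s ^ 2 = W.weight m s := by
  unfold rootWeight weight
  rw [← Real.exp_nat_mul]; congr 1; push_cast; ring

theorem rootWeight_contDiff (m : ℕ) : ContDiff ℝ ∞ (W.rootWeight m) := by
  have := W.β_smooth
  unfold rootWeight
  fun_prop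

theorem δ_nonneg (m : ℕ) : 0 ≤ W.δ m := by
  rw [← W.δ_zero]; exact W.δ_strictMono.monotone (Nat.zero_le m)

theorem mul_β_le_abs (s : ℝ) : s * W.β s ≤ |s| := by
  have hb := W.β_mem s
  have : |W.β s| ≤ 1 := abs_le.2 ⟨hb.1, hb.2⟩
  calc s * W.β s ≤ |s * W.β s| := le_abs_self _
    _ = |s| * |W.β s| := abs_mul _ _
    _ ≤ |s| := mul_le_of_le_one_right (abs_nonneg s) this

/-- Since β is odd, s β(s) = |s| for |s| ≥ 1, and on [-1, 1] it is at least -1. With `mul_β_le_abs`,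
the weight is e^{δ_m |s|} up to constant factors, the form used in all later estimates. -/
theorem abs_sub_two_le (s : ℝ) : |s| - 2 ≤ s * W.β s := by
  rcases le_or_gt 1 s with h | h
  · rw [W.β_one s h, abs_of_nonneg (by linarith)]; linarith
  rcases le_or_gt s (-1) with h' | h'
  · have := W.β_odd (-s)
    rw [neg_neg, W.β_one (-s) (by linarith)] at this
    rw [this, abs_of_nonpos (by linarith)]; linarith
  · have := W.neg_one_le_mul s
    have : |s| ≤ 1 := abs_le.2 ⟨h'.le, h.le⟩
    linarith

theorem weight_le_exp (m : ℕ) (s : ℝ) : W.weight m s ≤ Real.exp (W.δ m * |s|) := by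
  unfold weight
  apply Real.exp_le_exp.2
  rw [mul_assoc]
  exact mul_le_mul_of_nonneg_left (W.mul_β_le_abs s) (W.δ_nonneg m)

theorem exp_le_weight (m : ℕ) (s : ℝ) : Real.exp (W.δ m * (|s| - 2)) ≤ W.weight m s := by
  unfold weight
  apply Real.exp_le_exp.2
  rw [mul_assoc]
  exact mul_le_mul_of_nonneg_left (W.abs_sub_two_le s) (W.δ_nonneg m)

theorem inv_rootWeight_le (m : ℕ) (s : ℝ) :
    |(W.rootWeight m s)⁻¹| ≤ Real.exp (W.δ m) := by
  rw [abs_of_pos (inv_pos.2 (W.rootWeight_pos m s))]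
  unfold rootWeight
  rw [← Real.exp_neg]
  apply Real.exp_le_exp.2
  nlinarith [W.neg_one_le_mul s, W.δ_nonneg m]

theorem continuous_inv_rootWeight (m : ℕ) : Continuous fun s => (W.rootWeight m s)⁻¹ :=
  (W.rootWeight_contDiff m).continuous.inv₀ fun s => (W.rootWeight_pos m s).ne'

variable {W} {m : ℕ}

theorem Sobolev.memLp_wderiv (f : W.Sobolev m) {j : ℕ} (hj : j ≤ m) :
    MemLp (fun s => W.rootWeight m s * weakDeriv j (Sobolev.toL2 f) s) 2
      (volume : Measure ℝ) := by
  rw [memLp_two_iff_integrable_sq]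
  · apply (f.spec hj).2.congr
    refine Filter.Eventually.of_forall fun s => ?_
    simp only
    rw [mul_pow, rootWeight_sq, mul_comm]
  · exact (W.rootWeight_contDiff m).continuous.aestronglyMeasurable.mul
      (Lp.aestronglyMeasurable _)

theorem Sobolev.weakDeriv_add (f g : W.Sobolev m) {j : ℕ} (hj : j ≤ m) :
    weakDeriv j (Sobolev.toL2 (f + g))
      = weakDeriv j (Sobolev.toL2 f) + weakDeriv j (Sobolev.toL2 g) := by
  rw [map_add]
  exact ((f.spec hj).1.add (g.spec hj).1).eq_weakDeriv

theorem Sobolev.weakDeriv_smul (c : ℝ) (f : W.Sobolev m) {j : ℕ} (hj : j ≤ m) :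
    weakDeriv j (Sobolev.toL2 (c • f)) = c • weakDeriv j (Sobolev.toL2 f) := by
  rw [map_smul]
  exact ((f.spec hj).1.smul c).eq_weakDeriv

/-- The weighted derivative `f ↦ exp (δ_m s β(s) / 2) Dʲf`, as a linear map to `L²(ℝ)`. -/
def Sobolev.wderiv (W : WeightData) (m : ℕ) (j : Fin (m + 1)) : W.Sobolev m →ₗ[ℝ] L2 where
  toFun f := (f.memLp_wderiv (Nat.lt_succ_iff.1 j.2)).toLp _
  map_add' f g := by
    have hj := Nat.lt_succ_iff.1 j.2
    apply Lp.ext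
    filter_upwards [((f + g).memLp_wderiv hj).coeFn_toLp, (f.memLp_wderiv hj).coeFn_toLp,
      (g.memLp_wderiv hj).coeFn_toLp,
      Lp.coeFn_add (weakDeriv j (Sobolev.toL2 f)) (weakDeriv j (Sobolev.toL2 g)),
      Lp.coeFn_add ((f.memLp_wderiv hj).toLp _) ((g.memLp_wderiv hj).toLp _)]
      with s h1 h2 h3 h4 h5
    rw [h1, h5, Pi.add_apply, h2, h3, Sobolev.weakDeriv_add f g hj, h4, Pi.add_apply, mul_add]
  map_smul' c f := by
    have hj := Nat.lt_succ_iff.1 j.2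
    apply Lp.ext
    filter_upwards [((c • f).memLp_wderiv hj).coeFn_toLp, (f.memLp_wderiv hj).coeFn_toLp,
      Lp.coeFn_smul c (weakDeriv j (Sobolev.toL2 f)),
      Lp.coeFn_smul c ((f.memLp_wderiv hj).toLp _)] with s h1 h2 h3 h4
    rw [h1, RingHom.id_apply, h4, Pi.smul_apply, h2, Sobolev.weakDeriv_smul c f hj, h3,
      Pi.smul_apply, smul_eq_mul, smul_eq_mul]
    ring

theorem Sobolev.coeFn_wderiv (f : W.Sobolev m) (j : Fin (m + 1)) :
    Sobolev.wderiv W m j f =ᵐ[volume]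
      fun s => W.rootWeight m s * weakDeriv j (Sobolev.toL2 f) s :=
  (f.memLp_wderiv (Nat.lt_succ_iff.1 j.2)).coeFn_toLp

theorem Sobolev.norm_sq_wderiv (f : W.Sobolev m) (j : Fin (m + 1)) :
    ‖Sobolev.wderiv W m j f‖ ^ 2 = ∫ s, weakDeriv j (Sobolev.toL2 f) s ^ 2 * W.weight m s := by
  rw [← real_inner_self_eq_norm_sq, L2.inner_def]
  apply integral_congr_ae
  filter_upwards [f.coeFn_wderiv j] with s hs
  rw [hs, ← rootWeight_sq]
  simp only [RCLike.inner_apply, conj_trivial]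
  ring

theorem Sobolev.norm_sq_eq_sum (f : W.Sobolev m) :
    ‖f‖ ^ 2 = ∑ j : Fin (m + 1), ‖Sobolev.wderiv W m j f‖ ^ 2 := by
  rw [Sobolev.norm_sq_eq, Finset.sum_range]
  exact Finset.sum_congr rfl fun j _ => (f.norm_sq_wderiv j).symm

/-- The isometric embedding of `W^{m,δ_m}` into `L²(ℝ)^{m+1}` by the weighted derivatives. -/
def Sobolev.isometry (W : WeightData) (m : ℕ) :
    W.Sobolev m →ₗᵢ[ℝ] PiLp 2 (fun _ : Fin (m + 1) => L2) where
  toFun f := WithLp.toLp 2 fun j => Sobolev.wderiv W m j f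
  map_add' f g := by ext1; simp
  map_smul' c f := by ext1; simp
  norm_map' f := by
    apply (sq_eq_sq₀ (norm_nonneg _) (norm_nonneg _)).1
    rw [Sobolev.norm_sq_eq_sum, PiLp.norm_sq_eq_of_L2]
    rfl

theorem Sobolev.norm_wderiv_le (f : W.Sobolev m) (j : Fin (m + 1)) :
    ‖Sobolev.wderiv W m j f‖ ≤ ‖f‖ := by
  apply le_of_sq_le_sq _ (norm_nonneg _)
  rw [Sobolev.norm_sq_eq_sum]
  exact Finset.single_le_sum (f := fun j => ‖Sobolev.wderiv W m j f‖ ^ 2)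
    (fun _ _ => sq_nonneg _) (Finset.mem_univ j)

/-- The weighted derivative as a bounded operator. -/
def Sobolev.wderivL (W : WeightData) (m : ℕ) (j : Fin (m + 1)) : W.Sobolev m →L[ℝ] L2 :=
  (Sobolev.wderiv W m j).mkContinuous 1 fun f => by simpa using f.norm_wderiv_le j

/-- Division by the square root of the weight. -/
def unweight (W : WeightData) (m : ℕ) : L2 →L[ℝ] L2 :=
  mulL2 (fun s => (W.rootWeight m s)⁻¹) (W.continuous_inv_rootWeight m) (Real.exp (W.δ m))
    (W.inv_rootWeight_le m)

theorem Sobolev.unweight_wderiv (f : W.Sobolev m) (j : Fin (m + 1)) :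
    W.unweight m (Sobolev.wderiv W m j f) = weakDeriv j (Sobolev.toL2 f) := by
  apply Lp.ext
  filter_upwards [coeFn_mulL2 (fun s => (W.rootWeight m s)⁻¹) (W.continuous_inv_rootWeight m)
    (Real.exp (W.δ m)) (W.inv_rootWeight_le m) (Sobolev.wderiv W m j f), f.coeFn_wderiv j]
    with s h1 h2
  rw [unweight, h1, h2, inv_mul_cancel_left₀ (W.rootWeight_pos m s).ne']

/-- The weak derivative `Dʲ` as a bounded operator `W^{m,δ_m} → L²(ℝ)`. -/
def Sobolev.derivL (W : WeightData) (m : ℕ) (j : Fin (m + 1)) : W.Sobolev m →L[ℝ] L2 :=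
  (W.unweight m).comp (Sobolev.wderivL W m j)

theorem Sobolev.derivL_apply (f : W.Sobolev m) (j : Fin (m + 1)) :
    Sobolev.derivL W m j f = weakDeriv j (Sobolev.toL2 f) := f.unweight_wderiv j

/-- The inclusion `W^{m,δ_m} ⊆ L²(ℝ)` as a bounded operator. -/
def Sobolev.toL2L (W : WeightData) (m : ℕ) : W.Sobolev m →L[ℝ] L2 :=
  Sobolev.derivL W m 0

theorem Sobolev.toL2L_apply (f : W.Sobolev m) : Sobolev.toL2L W m f = Sobolev.toL2 f := by
  rw [toL2L, derivL_apply]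
  exact (IsWeakDeriv.zero_self _).eq_weakDeriv

theorem rootWeight_mul_unweight (W : WeightData) (m : ℕ) (f : L2) :
    (fun s => W.rootWeight m s * W.unweight m f s) =ᵐ[volume] f := by
  filter_upwards [coeFn_mulL2 (fun s => (W.rootWeight m s)⁻¹) (W.continuous_inv_rootWeight m)
    (Real.exp (W.δ m)) (W.inv_rootWeight_le m) f] with s h1
  rw [unweight, h1, mul_inv_cancel_left₀ (W.rootWeight_pos m s).ne']

/-- An element of `W^{m,δ_m}` with given weighted weak derivatives. -/
theorem Sobolev.exists_of_isWeakDeriv {f : L2} {G : Fin (m + 1) → L2}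
    (h : ∀ j : Fin (m + 1), IsWeakDeriv j f (W.unweight m (G j))) :
    ∃ F : W.Sobolev m, Sobolev.toL2 F = f ∧ ∀ j, Sobolev.wderiv W m j F = G j := by
  have hmem : f ∈ W.sobolevSubmodule m := by
    intro j hj
    refine ⟨_, h ⟨j, Nat.lt_succ_iff.2 hj⟩, ?_⟩
    refine (Lp.memLp (G ⟨j, Nat.lt_succ_iff.2 hj⟩)).integrable_sq.congr ?_
    filter_upwards [W.rootWeight_mul_unweight m (G ⟨j, Nat.lt_succ_iff.2 hj⟩)] with s hs
    rw [← hs, mul_pow, rootWeight_sq, mul_comm]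
  let F : W.Sobolev m := ⟨f, hmem⟩
  refine ⟨F, rfl, fun j => ?_⟩
  apply Lp.ext
  filter_upwards [F.coeFn_wderiv j, W.rootWeight_mul_unweight m (G j)] with s h1 h2
  have e : weakDeriv j (Sobolev.toL2 F) = W.unweight m (G j) := (h j).eq_weakDeriv
  rw [e] at h1
  exact h1.trans h2

/-- The isometric image in L²(ℝ)^{m+1} is closed: dividing a convergent sequence of weighted
derivatives by the root weight is continuous on L²(ℝ), and weak derivatives pass to the limit. -/
instance (W : WeightData) (m : ℕ) : CompleteSpace (W.Sobolev m) := by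
  have hu := (Sobolev.isometry W m).isometry.isUniformInducing
  refine (completeSpace_iff_isComplete_range hu).2 (IsClosed.isComplete ?_)
  refine IsSeqClosed.isClosed fun x y hx hxy => ?_
  choose f hf using hx
  have hy : ∀ j, Filter.Tendsto (fun n => Sobolev.wderiv W m j (f n)) Filter.atTop
      (nhds (y.ofLp j)) := fun j => by
    have h1 : Continuous fun z : PiLp 2 (fun _ : Fin (m + 1) => L2) => z.ofLp j := by fun_prop
    have := (h1.tendsto y).comp hxy
    refine this.congr fun n => ?_
    simp only [comp_apply]
    rw [← hf n]; rfl
  have hg : ∀ j : Fin (m + 1), Filter.Tendsto (fun n => weakDeriv j (Sobolev.toL2 (f n)))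
      Filter.atTop (nhds (W.unweight m (y.ofLp j))) := fun j => by
    refine (((W.unweight m).continuous.tendsto _).comp (hy j)).congr fun n => ?_
    exact (f n).unweight_wderiv j
  have h0 : Filter.Tendsto (fun n => Sobolev.toL2 (f n)) Filter.atTop
      (nhds (W.unweight m (y.ofLp 0))) := by
    refine (hg 0).congr fun n => ?_
    exact (IsWeakDeriv.zero_self _).eq_weakDeriv
  obtain ⟨F, -, hF⟩ := Sobolev.exists_of_isWeakDeriv (W := W) fun j : Fin (m + 1) =>
    IsWeakDeriv.of_tendsto (fun n => ((f n).spec (Nat.lt_succ_iff.1 j.2)).1) h0 (hg j)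
  refine ⟨F, ?_⟩
  ext1 j
  exact hF j

theorem Sobolev.tendsto_of_wderiv {ι : Type*} {l : Filter ι} {f : ι → W.Sobolev m}
    {f₀ : W.Sobolev m} (h : ∀ j, Filter.Tendsto (fun i => Sobolev.wderiv W m j (f i)) l
      (nhds (Sobolev.wderiv W m j f₀))) : Filter.Tendsto f l (nhds f₀) := by
  rw [tendsto_iff_norm_sub_tendsto_zero]
  have e : ∀ i, ‖f i - f₀‖
      = Real.sqrt (∑ j, ‖Sobolev.wderiv W m j (f i) - Sobolev.wderiv W m j f₀‖ ^ 2) := fun i => by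
    rw [← Real.sqrt_sq (norm_nonneg (f i - f₀)), Sobolev.norm_sq_eq_sum]
    simp only [map_sub]
  simp only [e]
  have h1 : Filter.Tendsto (fun i => ∑ j, ‖Sobolev.wderiv W m j (f i)
      - Sobolev.wderiv W m j f₀‖ ^ 2) l (nhds (∑ _j : Fin (m + 1), (0 : ℝ) ^ 2)) :=
    tendsto_finsetSum _ fun j _ => ((tendsto_iff_norm_sub_tendsto_zero.1 (h j)).pow 2)
  have h2 := (Real.continuous_sqrt.tendsto _).comp h1
  simpa [comp_def] using h2

/-- A test function as an element of `W^{m,δ_m}`. -/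
def ofTest (W : WeightData) (m : ℕ) (u : TestFun) : W.Sobolev m :=
  ⟨u.toL2, fun j _ => ⟨(u.iterDeriv j).toL2,
    (u.isWeakDeriv j).congr u.coeFn_toL2.symm (u.iterDeriv j).coeFn_toL2.symm, by
      have h : Integrable (fun s => u.iterDeriv j s ^ 2 * W.weight m s) := by
        apply Continuous.integrable_of_hasCompactSupport
        · exact ((u.iterDeriv j).continuous.pow 2).mul (W.continuous_weight m)
        · have := (u.iterDeriv j).compact
          simp only [sq, mul_assoc]
          exact this.mul_right
      refine h.congr ?_
      filter_upwards [(u.iterDeriv j).coeFn_toL2] with s hs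
      rw [hs]⟩⟩

@[simp] theorem toL2_ofTest (W : WeightData) (m : ℕ) (u : TestFun) :
    Sobolev.toL2 (W.ofTest m u) = u.toL2 := rfl

theorem norm_sq_ofTest (W : WeightData) (m : ℕ) (u : TestFun) :
    ‖W.ofTest m u‖ ^ 2
      = ∑ j ∈ Finset.range (m + 1), ∫ s, u.iterDeriv j s ^ 2 * W.weight m s := by
  rw [Sobolev.norm_sq_eq]
  refine Finset.sum_congr rfl fun j _ => ?_
  rw [toL2_ofTest, u.weakDeriv_toL2]
  apply integral_congr_ae
  filter_upwards [(u.iterDeriv j).coeFn_toL2] with s hs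
  rw [hs]

theorem Sobolev.wderiv_ofTest (u : TestFun) (j : Fin (m + 1)) :
    Sobolev.wderiv W m j (W.ofTest m u) =
      ((u.iterDeriv j).mul (W.rootWeight m) (W.rootWeight_contDiff m)).toL2 := by
  apply Lp.ext
  filter_upwards [(W.ofTest m u).coeFn_wderiv j, (u.iterDeriv j).coeFn_toL2,
    ((u.iterDeriv j).mul (W.rootWeight m) (W.rootWeight_contDiff m)).coeFn_toL2] with s h1 h2 h3
  rw [h1, h3, toL2_ofTest, u.weakDeriv_toL2, h2]
  rfl

end WeightData

/-! ## Mollification in `L²(ℝ)` -/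

theorem L2.norm_sq_eq_integral (f : L2) : ‖f‖ ^ 2 = ∫ s, f s ^ 2 := by
  rw [← real_inner_self_eq_norm_sq, L2.inner_def]
  congr 1; ext s; simp [sq]

theorem L2.tendsto_of_integral_sq {ι : Type*} {l : Filter ι} {F : ι → L2} {F₀ : L2}
    (h : Filter.Tendsto (fun i => ∫ s, (F i s - F₀ s) ^ 2) l (nhds 0)) :
    Filter.Tendsto F l (nhds F₀) := by
  rw [tendsto_iff_norm_sub_tendsto_zero]
  have e : ∀ i, ‖F i - F₀‖ = Real.sqrt (∫ s, (F i s - F₀ s) ^ 2) := fun i => by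
    rw [← Real.sqrt_sq (norm_nonneg (F i - F₀)), L2.norm_sq_eq_integral]
    congr 1
    apply integral_congr_ae
    filter_upwards [Lp.coeFn_sub (F i) F₀] with s hs
    rw [hs]; rfl
  simp only [e]
  have h' := (Real.continuous_sqrt.tendsto 0).comp h
  rw [Real.sqrt_zero] at h'
  exact h'

theorem L2.locallyIntegrable (f : L2) : LocallyIntegrable f :=
  (Lp.memLp f).locallyIntegrable (by norm_num)

theorem L2.integrable_sq (f : L2) : Integrable fun s => f s ^ 2 := (Lp.memLp f).integrable_sq

namespace TestFun

/-- The convolution of a test function with a function in `L²(ℝ)`. -/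
def conv (ρ : TestFun) (f : L2) (x : ℝ) : ℝ := ∫ t, ρ (x - t) * f t

theorem convolution_eq (ρ : ℝ → ℝ) (f : ℝ → ℝ) (x : ℝ) :
    convolution ρ f (ContinuousLinearMap.lsmul ℝ ℝ) volume x = ∫ t, ρ (x - t) * f t := by
  rw [convolution_lsmul_swap]; rfl

theorem conv_eq (ρ : TestFun) (f : L2) :
    ρ.conv f = convolution ρ f (ContinuousLinearMap.lsmul ℝ ℝ) volume := by
  funext x; rw [convolution_eq]; rfl

theorem conv_contDiff (ρ : TestFun) (f : L2) : ContDiff ℝ ∞ (ρ.conv f) := by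
  rw [conv_eq]
  exact ρ.compact.contDiff_convolution_left _ ρ.smooth f.locallyIntegrable

/-- The reflected translate `t ↦ ρ (x - t)`. -/
def reflect (ρ : TestFun) (x : ℝ) : TestFun where
  toFun t := ρ (x - t)
  smooth := ρ.smooth.comp (contDiff_const.sub contDiff_id)
  compact := ρ.compact.comp_homeomorph (Homeomorph.subLeft x)

/-- The derivative falls on the kernel. As t ↦ ρ (x - t) is itself a test function, the weak
derivative moves it to f, and the two signs cancel. -/
theorem deriv_conv (ρ : TestFun) {f g : L2} (h : IsWeakDeriv 1 f g) :
    _root_.deriv (ρ.conv f) = ρ.conv g := by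
  funext x
  have h1 := ρ.compact.hasDerivAt_convolution_left (ContinuousLinearMap.lsmul ℝ ℝ)
    (ρ.smooth.of_le (by exact_mod_cast le_top)) f.locallyIntegrable x
  rw [← conv_eq] at h1
  rw [h1.deriv, convolution_eq]
  have h2 := h (ρ.reflect x) (ρ.reflect x).smooth (ρ.reflect x).compact
  rw [iteratedDeriv_one] at h2
  have h3 : ∀ t, _root_.deriv (ρ.reflect x) t = -_root_.deriv ρ (x - t) := fun t => by
    have := (ρ.hasDerivAt (x - t)).comp t ((hasDerivAt_id t).const_sub x)
    have e : _root_.deriv (ρ.reflect x) t = ρ.deriv (x - t) * -1 := HasDerivAt.deriv this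
    rw [e, mul_neg_one]; rfl
  simp only [h3] at h2
  have h4 : ∫ t, f t * -_root_.deriv ρ (x - t) = -∫ t, _root_.deriv ρ (x - t) * f t := by
    rw [← integral_neg]; congr 1; ext t; ring
  rw [h4] at h2
  have h5 : ∫ t, g t * (ρ.reflect x) t = ρ.conv g x := by
    unfold conv; congr 1; ext t; exact mul_comm _ _
  rw [h5] at h2
  linarith

theorem iteratedDeriv_conv (ρ : TestFun) {f : ℕ → L2} {j : ℕ}
    (h : ∀ i < j, IsWeakDeriv 1 (f i) (f (i + 1))) :
    iteratedDeriv j (ρ.conv (f 0)) = ρ.conv (f j) := by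
  induction j with
  | zero => simp
  | succ j ih =>
    rw [iteratedDeriv_succ, ih fun i hi => h i (hi.trans (Nat.lt_succ_self j)),
      ρ.deriv_conv (h j (Nat.lt_succ_self j))]

theorem conv_eq_zero (ρ : TestFun) {f : L2} {M r x : ℝ} (hf : ∀ᵐ s, M < |s| → f s = 0)
    (hρ : ∀ s, r < |s| → ρ s = 0) (hx : M + r < |x|) : ρ.conv f x = 0 := by
  unfold conv
  rw [← integral_zero ℝ ℝ]
  apply integral_congr_ae
  filter_upwards [hf] with t ht
  by_cases h : M < |t|
  · rw [ht h, mul_zero]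
  · rw [hρ, zero_mul]
    have : |x| ≤ |x - t| + |t| := by simpa using abs_add_le (x - t) t
    linarith [not_lt.1 h]

end TestFun

/-- A standard mollifier, supported in the ball of radius `2 / (n + 1)`. -/
def bumpSeq (n : ℕ) : ContDiffBump (0 : ℝ) where
  rIn := 1 / (n + 1 : ℝ)
  rOut := 2 / (n + 1 : ℝ)
  rIn_pos := by positivity
  rIn_lt_rOut := by gcongr; norm_num

/-- The normalized mollifier as a test function. -/
def mollifier (n : ℕ) : TestFun where
  toFun := (bumpSeq n).normed volume
  smooth := (bumpSeq n).contDiff_normed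
  compact := (bumpSeq n).hasCompactSupport_normed

theorem mollifier_nonneg (n : ℕ) (s : ℝ) : 0 ≤ mollifier n s := (bumpSeq n).nonneg_normed s

theorem integral_mollifier (n : ℕ) : ∫ s, mollifier n s = 1 := (bumpSeq n).integral_normed

theorem mollifier_eq_zero (n : ℕ) (s : ℝ) (hs : 2 < |s|) : mollifier n s = 0 := by
  by_contra h
  have h1 : s ∈ Function.support ((bumpSeq n).normed volume) := h
  rw [ContDiffBump.support_normed_eq, Metric.mem_ball, dist_zero_right, Real.norm_eq_abs] at h1
  have h2 : (bumpSeq n).rOut ≤ 2 := by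
    change 2 / (n + 1 : ℝ) ≤ 2
    apply div_le_self (by norm_num)
    have : (0 : ℝ) ≤ n := Nat.cast_nonneg n
    linarith
  linarith

theorem tendsto_rOut_bumpSeq :
    Filter.Tendsto (fun n => (bumpSeq n).rOut) Filter.atTop (nhds 0) := by
  have := tendsto_one_div_add_atTop_nhds_zero_nat (𝕜 := ℝ)
  have h := this.const_mul 2
  rw [mul_zero] at h
  refine h.congr fun n => ?_
  change 2 * (1 / (n + 1 : ℝ)) = 2 / (n + 1 : ℝ)
  ring

theorem ae_tendsto_mollifier {g : ℝ → ℝ} (hg : LocallyIntegrable g) :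
    ∀ᵐ x, Filter.Tendsto (fun n => ∫ t, mollifier n (x - t) * g t) Filter.atTop (nhds (g x)) := by
  have h := ContDiffBump.ae_convolution_tendsto_right_of_locallyIntegrable (K := 2)
    (φ := bumpSeq) tendsto_rOut_bumpSeq (Filter.Eventually.of_forall fun n => by
      -- Convergence at almost every point requires a bounded ratio of outer to inner radius; here
      -- the ratio is exactly 2.
      change 2 / (n + 1 : ℝ) ≤ 2 * (1 / (n + 1 : ℝ))
      apply le_of_eq; ring) hg
  filter_upwards [h] with x hx
  refine hx.congr fun n => ?_
  rw [TestFun.convolution_eq]; rfl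

/-- Jensen's inequality for the probability density t ↦ ρ (x - t), obtained from the fact that the
variance of f under it is nonnegative. -/
theorem sq_conv_mollifier_le (n : ℕ) (f : L2) (x : ℝ) :
    (mollifier n).conv f x ^ 2 ≤ ∫ t, mollifier n (x - t) * f t ^ 2 := by
  set ρ := (mollifier n).reflect x with hρ
  have hi0 : Integrable ρ := ρ.integrable
  have h0 : ∫ t, ρ t = 1 := by
    rw [← integral_mollifier n]
    exact integral_sub_left_eq_self (mollifier n) volume x
  have hi1 : Integrable fun t => ρ t * f t := by
    simpa only [mul_comm] using L2.integrable_mul_test f ρ.continuous ρ.compact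
  have hi2 : Integrable fun t => ρ t * f t ^ 2 := by
    obtain ⟨C, hC⟩ := ρ.compact.exists_bound_of_continuous ρ.continuous
    exact f.integrable_sq.bdd_mul ρ.continuous.aestronglyMeasurable
      (Filter.Eventually.of_forall hC)
  set a := (mollifier n).conv f x with ha
  have h1 : ∫ t, ρ t * f t = a := rfl
  have key : 0 ≤ ∫ t, ρ t * (f t - a) ^ 2 :=
    integral_nonneg fun t => mul_nonneg (mollifier_nonneg n _) (sq_nonneg _)
  have e : ∫ t, ρ t * (f t - a) ^ 2 = (∫ t, ρ t * f t ^ 2) - 2 * a * a + a ^ 2 * 1 := by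
    have h2 : ∫ t, ρ t * (f t - a) ^ 2
        = ∫ t, (ρ t * f t ^ 2 - 2 * a * (ρ t * f t)) + a ^ 2 * ρ t := by
      congr 1; ext t; ring
    have h3 : Integrable fun t => ρ t * f t ^ 2 - 2 * a * (ρ t * f t) :=
      hi2.sub (hi1.const_mul _)
    rw [h2, integral_add h3 (hi0.const_mul _), integral_sub hi2 (hi1.const_mul _),
      integral_const_mul, integral_const_mul, h0, h1]
  change a ^ 2 ≤ ∫ t, ρ t * f t ^ 2
  nlinarith

theorem memLp_conv_mollifier (n : ℕ) (f : L2) :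
    MemLp ((mollifier n).conv f) 2 (volume : Measure ℝ) ∧
      Integrable (fun x => ∫ t, mollifier n (x - t) * f t ^ 2) ∧
      ∫ x, (∫ t, mollifier n (x - t) * f t ^ 2) = ∫ s, f s ^ 2 := by
  have hi : Integrable (fun x => ∫ t, mollifier n (x - t) * f t ^ 2) := by
    have := (mollifier n).integrable.integrable_convolution (ContinuousLinearMap.lsmul ℝ ℝ)
      f.integrable_sq
    refine this.congr (Filter.Eventually.of_forall fun x => ?_)
    exact TestFun.convolution_eq _ _ x
  have hc : Continuous ((mollifier n).conv f) := ((mollifier n).conv_contDiff f).continuous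
  refine ⟨?_, hi, ?_⟩
  · rw [memLp_two_iff_integrable_sq hc.aestronglyMeasurable]
    refine hi.mono' (hc.pow 2).aestronglyMeasurable (Filter.Eventually.of_forall fun x => ?_)
    rw [Real.norm_of_nonneg (sq_nonneg _)]
    exact sq_conv_mollifier_le n f x
  · have := integral_convolution (ContinuousLinearMap.lsmul ℝ ℝ) (μ := volume) (ν := volume)
      (mollifier n).integrable f.integrable_sq
    rw [integral_mollifier] at this
    simp only [TestFun.convolution_eq] at this
    rw [this]; simp

/-- With a_n = ρ_n * f and p_n = ρ_n * f², Jensen gives a_n² ≤ p_n, so h_n = 2 p_n + 2 f² - (a_n -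
f)² is nonnegative. It tends to 4 f² almost everywhere and has integral 4 ∫ f² - ∫ (a_n - f)²,
because ∫ p_n = ∫ f². Fatou's lemma then forces ∫ (a_n - f)² → 0. -/
theorem tendsto_integral_sq_conv_mollifier (f : L2) :
    Filter.Tendsto (fun n => ∫ x, ((mollifier n).conv f x - f x) ^ 2) Filter.atTop (nhds 0) := by
  set p : ℕ → ℝ → ℝ := fun n x => ∫ t, mollifier n (x - t) * f t ^ 2 with hp
  set a : ℕ → ℝ → ℝ := fun n x => (mollifier n).conv f x with ha
  set I := ∫ s, f s ^ 2 with hI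
  set h : ℕ → ℝ → ℝ := fun n x => 2 * p n x + 2 * f x ^ 2 - (a n x - f x) ^ 2 with hh
  have hle : ∀ n x, a n x ^ 2 ≤ p n x := fun n x => sq_conv_mollifier_le n f x
  have hnn : ∀ n x, 0 ≤ h n x := fun n x => by
    have := hle n x
    simp only [hh]
    nlinarith [sq_nonneg (a n x + f x)]
  have hai : ∀ n, Integrable fun x => (a n x - f x) ^ 2 := fun n =>
    ((memLp_conv_mollifier n f).1.sub (Lp.memLp f)).integrable_sq
  have hpi : ∀ n, Integrable (p n) := fun n => (memLp_conv_mollifier n f).2.1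
  have hint : ∀ n, Integrable (h n) := fun n =>
    (((hpi n).const_mul 2).add (f.integrable_sq.const_mul 2)).sub (hai n)
  have hval : ∀ n, ∫ x, h n x = 4 * I - ∫ x, (a n x - f x) ^ 2 := fun n => by
    simp only [hh]
    have h3 : Integrable fun x => 2 * p n x + 2 * f x ^ 2 :=
      ((hpi n).const_mul 2).add (f.integrable_sq.const_mul 2)
    rw [integral_sub h3 (hai n),
      integral_add ((hpi n).const_mul 2) (f.integrable_sq.const_mul 2), integral_const_mul,
      integral_const_mul, (memLp_conv_mollifier n f).2.2]
    ring
  have hlim : ∀ᵐ x, Filter.Tendsto (fun n => h n x) Filter.atTop (nhds (4 * f x ^ 2)) := by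
    filter_upwards [ae_tendsto_mollifier f.locallyIntegrable,
      ae_tendsto_mollifier f.integrable_sq.locallyIntegrable] with x h1 h2
    have := ((h2.const_mul 2).add_const (2 * f x ^ 2)).sub ((h1.sub_const (f x)).pow 2)
    refine (this.congr fun n => rfl).trans (le_of_eq ?_)
    congr 1; ring
  have fatou := lintegral_liminf_le' (μ := volume) (u := Filter.atTop)
    (f := fun n x => ENNReal.ofReal (h n x))
    fun n => (hint n).aestronglyMeasurable.aemeasurable.ennreal_ofReal
  have hl : ∫⁻ x, Filter.liminf (fun n => ENNReal.ofReal (h n x)) Filter.atTop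
      = ENNReal.ofReal (4 * I) := by
    rw [hI, ← integral_const_mul, ofReal_integral_eq_lintegral_ofReal
      (f.integrable_sq.const_mul 4) (Filter.Eventually.of_forall fun x => by positivity)]
    apply lintegral_congr_ae
    filter_upwards [hlim] with x hx
    exact (((ENNReal.continuous_ofReal).tendsto _).comp hx).liminf_eq
  have hr : ∀ n, ∫⁻ x, ENNReal.ofReal (h n x)
      = ENNReal.ofReal (4 * I - ∫ x, (a n x - f x) ^ 2) := fun n => by
    rw [← hval, ofReal_integral_eq_lintegral_ofReal (hint n)
      (Filter.Eventually.of_forall (hnn n))]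
  rw [hl] at fatou
  simp only [hr] at fatou
  rw [Metric.tendsto_atTop]
  intro ε hε
  have hIn : 0 ≤ I := integral_nonneg fun s => sq_nonneg _
  have hev : ∀ᶠ n in Filter.atTop, 4 * I - ε < 4 * I - ∫ x, (a n x - f x) ^ 2 := by
    -- `ENNReal.ofReal` identifies all negative numbers with zero, so Fatou only gives information
    -- about nonnegative thresholds; below zero the bound follows from 0 ≤ ∫ h_n.
    by_cases hcase : 4 * I - ε < 0
    · refine Filter.Eventually.of_forall fun n => ?_
      have : 0 ≤ ∫ x, h n x := integral_nonneg (hnn n)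
      rw [hval] at this
      linarith
    · have hlt : ENNReal.ofReal (4 * I - ε) < ENNReal.ofReal (4 * I) :=
        (ENNReal.ofReal_lt_ofReal_iff_of_nonneg (not_lt.1 hcase)).2 (by linarith)
      filter_upwards [Filter.eventually_lt_of_lt_liminf (hlt.trans_le fatou)] with n hn
      exact (ENNReal.ofReal_lt_ofReal_iff_of_nonneg (not_lt.1 hcase)).1 hn
  obtain ⟨N, hN⟩ := Filter.eventually_atTop.1 hev
  refine ⟨N, fun n hn => ?_⟩
  rw [Real.dist_eq, sub_zero, abs_of_nonneg (integral_nonneg fun x => sq_nonneg _)]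
  have := hN n hn
  linarith

/-! ## Density of test functions in the weighted Sobolev spaces -/

namespace TestFun

theorem exists_bound (u : TestFun) : ∃ C, ∀ s, |u s| ≤ C :=
  u.compact.exists_bound_of_continuous u.continuous

/-- Multiplication with a test function on `L²(ℝ)`. -/
def mulL (u : TestFun) : L2 →L[ℝ] L2 :=
  mulL2 u u.continuous u.exists_bound.choose u.exists_bound.choose_spec

theorem coeFn_mulL (u : TestFun) (f : L2) : u.mulL f =ᵐ[volume] fun s => u s * f s :=
  coeFn_mulL2 _ _ _ _ f

/-- The rescaled function `s ↦ u (s / (n + 1))`. -/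
def scale (u : TestFun) (n : ℕ) : TestFun where
  toFun s := u ((n + 1 : ℝ)⁻¹ * s)
  smooth := u.smooth.comp (contDiff_const.mul contDiff_id)
  compact := u.compact.comp_homeomorph
    (Homeomorph.mulLeft₀ ((n + 1 : ℝ)⁻¹) (inv_ne_zero (Nat.cast_add_one_ne_zero n)))

theorem deriv_scale (u : TestFun) (n : ℕ) (s : ℝ) :
    (u.scale n).deriv s = (n + 1 : ℝ)⁻¹ * u.deriv.scale n s := by
  have h := (u.hasDerivAt ((n + 1 : ℝ)⁻¹ * s)).comp s
    ((hasDerivAt_id s).const_mul ((n + 1 : ℝ)⁻¹))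
  have e : (u.scale n).deriv s = u.deriv ((n + 1 : ℝ)⁻¹ * s) * ((n + 1 : ℝ)⁻¹ * 1) :=
    HasDerivAt.deriv h
  rw [e, mul_one, mul_comm]; rfl

theorem deriv_eq_zero (u : TestFun) {M : ℝ} (h : ∀ s, M < |s| → u s = 0) (s : ℝ)
    (hs : M < |s|) : u.deriv s = 0 := by
  have h1 : u.toFun =ᶠ[nhds s] fun _ => (0 : ℝ) := by
    filter_upwards [(isOpen_lt continuous_const continuous_abs).mem_nhds hs] with t ht
    exact h t ht
  change _root_.deriv u s = 0
  rw [h1.deriv_eq]; simp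

/-- Dominated convergence: u(s/(n+1)) → u(0) pointwise, and with |u| ≤ C the squared error is at
most (2C)² f². -/
theorem tendsto_scale_mulL (u : TestFun) (f : L2) :
    Filter.Tendsto (fun n => (u.scale n).mulL f) Filter.atTop (nhds (u 0 • f)) := by
  apply L2.tendsto_of_integral_sq
  obtain ⟨C, hC⟩ := u.exists_bound
  have e : ∀ n, ∫ s, ((u.scale n).mulL f s - (u 0 • f : L2) s) ^ 2
      = ∫ s, (u.scale n s * f s - u 0 * f s) ^ 2 := fun n => by
    apply integral_congr_ae
    filter_upwards [(u.scale n).coeFn_mulL f, Lp.coeFn_smul (u 0) f] with s h1 h2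
    rw [h1, h2]; rfl
  simp only [e]
  have hz : (0 : ℝ) = ∫ _s : ℝ, (0 : ℝ) := by simp
  conv => rhs; rw [hz]
  refine tendsto_integral_of_dominated_convergence (fun s => (2 * C) ^ 2 * f s ^ 2)
    (fun n => ?_) (f.integrable_sq.const_mul _) (fun n => ?_) ?_
  · exact ((((u.scale n).continuous.aestronglyMeasurable).mul (Lp.aestronglyMeasurable f)).sub
      ((Lp.aestronglyMeasurable f).const_mul _)).pow 2
  · refine Filter.Eventually.of_forall fun s => ?_
    rw [Real.norm_of_nonneg (sq_nonneg _), ← sub_mul, mul_pow]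
    apply mul_le_mul_of_nonneg_right _ (sq_nonneg _)
    rw [← sq_abs]
    have h1 := hC ((n + 1 : ℝ)⁻¹ * s)
    have h2 := hC 0
    have h3 : |u.scale n s - u 0| ≤ 2 * C := by
      have := abs_sub (u ((n + 1 : ℝ)⁻¹ * s)) (u 0)
      change |u ((n + 1 : ℝ)⁻¹ * s) - u 0| ≤ _
      linarith
    exact pow_le_pow_left₀ (abs_nonneg _) h3 2
  · refine Filter.Eventually.of_forall fun s => ?_
    have h1 : Filter.Tendsto (fun n : ℕ => ((n + 1 : ℝ)⁻¹ * s)) Filter.atTop (nhds 0) := by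
      have := (tendsto_one_div_add_atTop_nhds_zero_nat (𝕜 := ℝ)).mul_const s
      simpa using this
    have h2 : Filter.Tendsto (fun n => u.scale n s) Filter.atTop (nhds (u 0)) :=
      (u.continuous.tendsto 0).comp h1
    have := ((h2.mul_const (f s)).sub_const (u 0 * f s)).pow 2
    simpa using this

/-- Leibniz rule, obtained by using u φ as a test function for f. -/
theorem isWeakDeriv_mulL (u : TestFun) {f g : L2} (h : IsWeakDeriv 1 f g) :
    IsWeakDeriv 1 (u.mulL f) (u.deriv.mulL f + u.mulL g : L2) := by
  intro φ h1 h2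
  have hi : ∀ (w : L2) {a b : ℝ → ℝ}, Continuous a → Continuous b → HasCompactSupport b →
      Integrable fun s => w s * (a s * b s) := fun w a b ha hb hc =>
    L2.integrable_mul_test w (ha.mul hb) hc.mul_left
  have hφ' : Continuous (_root_.deriv φ) := h1.continuous_deriv (by simp)
  have key := h (fun s => u s * φ s) (u.smooth.mul h1) h2.mul_left
  have hd : ∀ s, _root_.deriv (fun s => u s * φ s) s
      = u.deriv s * φ s + u s * _root_.deriv φ s := fun s =>
    ((u.hasDerivAt s).mul (h1.differentiable (by simp) s).hasDerivAt).deriv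
  rw [iteratedDeriv_one] at key ⊢
  have e1 : ∫ s, f s * _root_.deriv (fun s => u s * φ s) s
      = (∫ s, f s * (u.deriv s * φ s)) + ∫ s, f s * (u s * _root_.deriv φ s) := by
    rw [← integral_add (hi f u.deriv.continuous h1.continuous h2)
      (hi f u.continuous hφ' h2.deriv)]
    congr 1; ext s; rw [hd]; ring
  have e2 : ∫ s, u.mulL f s * _root_.deriv φ s = ∫ s, f s * (u s * _root_.deriv φ s) := by
    apply integral_congr_ae
    filter_upwards [u.coeFn_mulL f] with s hs
    rw [hs]; ring
  have e3 : ∫ s, (u.deriv.mulL f + u.mulL g : L2) s * φ s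
      = (∫ s, f s * (u.deriv s * φ s)) + ∫ s, g s * (u s * φ s) := by
    rw [← integral_add (hi f u.deriv.continuous h1.continuous h2)
      (hi g u.continuous h1.continuous h2)]
    apply integral_congr_ae
    filter_upwards [u.deriv.coeFn_mulL f, u.coeFn_mulL g,
      Lp.coeFn_add (u.deriv.mulL f) (u.mulL g)] with s k1 k2 k3
    rw [k3, Pi.add_apply, k1, k2]; ring
  rw [e1] at key
  rw [e2, e3]
  linarith

end TestFun

/-- Unlike in `IsWeakDeriv.succ`, the first-order derivative comes first; its test function is the
j-th derivative of φ. The cut-off induction peels derivatives off in this order. -/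
theorem IsWeakDeriv.succ' {j : ℕ} {f g h : L2} (h1 : IsWeakDeriv 1 f g)
    (h2 : IsWeakDeriv j g h) : IsWeakDeriv (j + 1) f h := by
  intro φ hφ hc
  let ψ := TestFun.iterDeriv j ⟨φ, hφ, hc⟩
  have e1 := h1 ψ ψ.smooth ψ.compact
  have e2 := h2 φ hφ hc
  rw [iteratedDeriv_one] at e1
  rw [iteratedDeriv_succ]
  change ∫ s, f s * deriv ψ s = _
  rw [e1]
  change (-1) ^ 1 * ∫ s, g s * iteratedDeriv j φ s = _
  rw [e2]; ring

namespace WeightData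

variable {W : WeightData} {m : ℕ}

theorem unweight_mulL (u : TestFun) (f : L2) :
    W.unweight m (u.mulL f) = u.mulL (W.unweight m f) := by
  have hu := coeFn_mulL2 (fun s => (W.rootWeight m s)⁻¹) (W.continuous_inv_rootWeight m)
    (Real.exp (W.δ m)) (W.inv_rootWeight_le m)
  apply Lp.ext
  filter_upwards [hu (u.mulL f), hu f, u.coeFn_mulL f, u.coeFn_mulL (W.unweight m f)]
    with s h1 h2 h3 h4
  rw [unweight] at h4 ⊢
  rw [h1, h3, h4, h2]; ring

/-- Cutting off: if `χ_n(s) = χ(s / (n + 1))`, then the `j`-th weak derivative of `χ_n f` exists and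
converges to `χ(0) Dʲf` in the weighted norm. -/
theorem exists_cutoff (j : ℕ) : ∀ (χ : TestFun) (F : ℕ → L2),
    (∀ i < j, IsWeakDeriv 1 (W.unweight m (F i)) (W.unweight m (F (i + 1)))) →
    ∃ G : ℕ → L2, (∀ n, IsWeakDeriv j (W.unweight m ((χ.scale n).mulL (F 0)))
        (W.unweight m (G n))) ∧
      Filter.Tendsto G Filter.atTop (nhds (χ 0 • F j)) ∧
      ∀ M, (∀ s, M < |s| → χ s = 0) → ∀ n : ℕ, ∀ᵐ s, M * (n + 1) < |s| → G n s = 0 := by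
  induction j with
  | zero =>
    intro χ F _
    refine ⟨fun n => (χ.scale n).mulL (F 0), fun n => IsWeakDeriv.zero_self _,
      χ.tendsto_scale_mulL (F 0), fun M hM n => ?_⟩
    filter_upwards [(χ.scale n).coeFn_mulL (F 0)] with s hs hs'
    rw [hs]
    have hn : (0 : ℝ) < n + 1 := by positivity
    have : χ.scale n s = 0 := by
      apply hM
      rw [abs_mul, abs_of_pos (inv_pos.2 hn), inv_mul_eq_div, lt_div_iff₀ hn]
      exact hs'
    rw [this, zero_mul]
  | succ j ih =>
    intro χ F hF
    -- By Leibniz, D(χ_n f) = (n+1)⁻¹ (χ')_n f + χ_n Df. The induction hypothesis is applied to χ'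
    -- with the same F and to χ with F shifted, which is why it quantifies over both; the factor
    -- (n+1)⁻¹ removes the first term in the limit.
    obtain ⟨G₁, hG₁, hG₁', hG₁''⟩ := ih χ.deriv F fun i hi => hF i (hi.trans (Nat.lt_succ_self j))
    obtain ⟨G₂, hG₂, hG₂', hG₂''⟩ := ih χ (fun i => F (i + 1)) fun i hi =>
      hF (i + 1) (Nat.succ_lt_succ hi)
    refine ⟨fun n => (n + 1 : ℝ)⁻¹ • G₁ n + G₂ n, fun n => ?_, ?_, fun M hM n => ?_⟩
    · have h1 := (χ.scale n).isWeakDeriv_mulL (hF 0 (Nat.succ_pos j))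
      rw [← unweight_mulL] at h1
      have h2 : IsWeakDeriv j ((χ.scale n).deriv.mulL (W.unweight m (F 0))
          + (χ.scale n).mulL (W.unweight m (F (0 + 1))) : L2)
          (W.unweight m ((n + 1 : ℝ)⁻¹ • G₁ n + G₂ n)) := by
        rw [map_add, map_smul, ← unweight_mulL (u := χ.scale n)]
        refine IsWeakDeriv.add ?_ (hG₂ n)
        have e : (χ.scale n).deriv.mulL (W.unweight m (F 0))
            = (n + 1 : ℝ)⁻¹ • W.unweight m ((χ.deriv.scale n).mulL (F 0)) := by
          rw [unweight_mulL]
          apply Lp.ext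
          filter_upwards [(χ.scale n).deriv.coeFn_mulL (W.unweight m (F 0)),
            (χ.deriv.scale n).coeFn_mulL (W.unweight m (F 0)),
            Lp.coeFn_smul ((n + 1 : ℝ)⁻¹) ((χ.deriv.scale n).mulL (W.unweight m (F 0)))]
            with s k1 k2 k3
          rw [k1, k3, Pi.smul_apply, k2, TestFun.deriv_scale, smul_eq_mul, mul_assoc]
        rw [e]
        exact (hG₁ n).smul _
      exact h1.succ' h2
    · have h1 : Filter.Tendsto (fun n : ℕ => (n + 1 : ℝ)⁻¹) Filter.atTop (nhds 0) := by
        simpa using tendsto_one_div_add_atTop_nhds_zero_nat (𝕜 := ℝ)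
      simpa using (h1.smul hG₁').add hG₂'
    · filter_upwards [hG₁'' M (χ.deriv_eq_zero hM) n, hG₂'' M hM n,
        Lp.coeFn_add ((n + 1 : ℝ)⁻¹ • G₁ n) (G₂ n), Lp.coeFn_smul ((n + 1 : ℝ)⁻¹) (G₁ n)]
        with s h1 h2 h3 h4 hs
      rw [h3, Pi.add_apply, h4, Pi.smul_apply, h1 hs, h2 hs, smul_zero, add_zero]

theorem Sobolev.isWeakDeriv_succ (f : W.Sobolev m) {i : ℕ} (hi : i < m) :
    IsWeakDeriv 1 (weakDeriv i (Sobolev.toL2 f)) (weakDeriv (i + 1) (Sobolev.toL2 f)) :=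
  (f.spec hi.le).1.of_succ (f.spec hi).1

/-- Mollification commutes with weak derivatives and enlarges supports by at most 2. On the ball of
radius M + 2 the root weight is bounded by some C, so the squared weighted error is at most C² times
the L²-error, which tends to zero. -/
theorem Sobolev.mem_closure_of_compact (f : W.Sobolev m) (M : ℝ)
    (hf : ∀ j ≤ m, ∀ᵐ s, M < |s| → weakDeriv j (Sobolev.toL2 f) s = 0) :
    f ∈ closure (range (W.ofTest m)) := by
  let g : ℕ → L2 := fun j => weakDeriv j (Sobolev.toL2 f)
  have hg0 : g 0 = Sobolev.toL2 f := (IsWeakDeriv.zero_self _).eq_weakDeriv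
  let u : ℕ → TestFun := fun n =>
    { toFun := (mollifier n).conv (g 0)
      smooth := (mollifier n).conv_contDiff _
      compact := by
        refine HasCompactSupport.intro (K := Metric.closedBall 0 (M + 2))
          (isCompact_closedBall _ _) fun x hx => ?_
        refine (mollifier n).conv_eq_zero (hf 0 (Nat.zero_le m)) (mollifier_eq_zero n) ?_
        simpa using hx }
  have hu : ∀ n, ∀ j ≤ m, ∀ s, (u n).iterDeriv j s = (mollifier n).conv (g j) s :=
    fun n j hj s => by
      have := (mollifier n).iteratedDeriv_conv (f := g) (j := j) fun i hi =>
        f.isWeakDeriv_succ (hi.trans_le hj)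
      exact congrFun this s
  refine mem_closure_of_tendsto (f := fun n => W.ofTest m (u n)) (b := Filter.atTop) ?_
    (Filter.Eventually.of_forall fun n => mem_range_self _)
  refine Sobolev.tendsto_of_wderiv fun j => ?_
  have hj := Nat.lt_succ_iff.1 j.2
  apply L2.tendsto_of_integral_sq
  obtain ⟨C, hC⟩ := (isCompact_closedBall (0 : ℝ) (M + 2)).exists_bound_of_continuousOn
    (W.rootWeight_contDiff m).continuous.continuousOn
  have hlim := (tendsto_integral_sq_conv_mollifier (g j)).const_mul (C ^ 2)
  rw [mul_zero] at hlim
  refine squeeze_zero (fun n => integral_nonneg fun s => sq_nonneg _) (fun n => ?_) hlim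
  rw [← integral_const_mul]
  have hi : Integrable fun x => ((mollifier n).conv (g j) x - g j x) ^ 2 :=
    ((memLp_conv_mollifier n (g j)).1.sub (Lp.memLp (g j))).integrable_sq
  refine integral_mono_of_nonneg (Filter.Eventually.of_forall fun s => sq_nonneg _)
    (hi.const_mul _) ?_
  filter_upwards [(W.ofTest m (u n)).coeFn_wderiv j, f.coeFn_wderiv j, hf j hj,
    ((u n).iterDeriv j).coeFn_toL2] with s h1 h2 h3 h4
  rw [toL2_ofTest, TestFun.weakDeriv_toL2, h4, hu n j hj s] at h1
  rw [h1, h2, ← mul_sub, mul_pow]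
  by_cases hs : M + 2 < |s|
  · have e1 : (mollifier n).conv (g j) s = 0 :=
      (mollifier n).conv_eq_zero (hf j hj) (mollifier_eq_zero n) hs
    have e2 : g j s = 0 := h3 (by linarith)
    change _ * ((mollifier n).conv (g j) s - g j s) ^ 2 ≤ _
    rw [e1, e2]; simp
  · refine mul_le_mul_of_nonneg_right ?_ (sq_nonneg _)
    have := hC s (by simpa using not_lt.1 hs)
    rw [← sq_abs]
    exact pow_le_pow_left₀ (abs_nonneg _) this 2

/-- Test functions are dense in `W^{m,δ_m}`. -/
theorem denseRange_ofTest (W : WeightData) (m : ℕ) : DenseRange (W.ofTest m) := by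
  intro f
  let χ : TestFun := ⟨bumpSeq 0, (bumpSeq 0).contDiff, (bumpSeq 0).hasCompactSupport⟩
  have hχ0 : χ 0 = 1 := (bumpSeq 0).one_of_mem_closedBall
    (Metric.mem_closedBall_self (bumpSeq 0).rIn_pos.le)
  have hχ : ∀ s, (2 : ℝ) < |s| → χ s = 0 := fun s hs =>
    (bumpSeq 0).zero_of_le_dist (by
      rw [dist_zero_right, Real.norm_eq_abs]
      change 2 / ((0 : ℕ) + 1 : ℝ) ≤ _
      norm_num; exact hs.le)
  let F : ℕ → L2 := fun j => if h : j < m + 1 then Sobolev.wderiv W m ⟨j, h⟩ f else 0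
  have hF : ∀ j : Fin (m + 1), F j = Sobolev.wderiv W m j f := fun j => dif_pos j.2
  have hUF : ∀ j ≤ m, W.unweight m (F j) = weakDeriv j (Sobolev.toL2 f) := fun j hj => by
    have := hF ⟨j, Nat.lt_succ_iff.2 hj⟩
    rw [this, Sobolev.unweight_wderiv]
  have hchain : ∀ i < m, IsWeakDeriv 1 (W.unweight m (F i)) (W.unweight m (F (i + 1))) :=
    fun i hi => by
      rw [hUF i hi.le, hUF (i + 1) hi]
      exact f.isWeakDeriv_succ hi
  have hex := fun j : Fin (m + 1) => exists_cutoff (W := W) (m := m) j χ F fun i hi =>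
    hchain i (hi.trans_le (Nat.lt_succ_iff.1 j.2))
  choose G hG hG' hG'' using hex
  choose fn hfn hfn' using fun n => Sobolev.exists_of_isWeakDeriv (W := W) (fun j => hG j n)
  have hlim : Filter.Tendsto fn Filter.atTop (nhds f) := by
    refine Sobolev.tendsto_of_wderiv fun j => ?_
    have := hG' j
    rw [hχ0, one_smul, hF] at this
    exact this.congr fun n => (hfn' n j).symm
  -- Two-stage approximation: the cut-offs converge to f, and each cut-off is a limit of test
  -- functions.
  rw [← closure_closure]
  refine mem_closure_of_tendsto hlim (Filter.Eventually.of_forall fun n => ?_)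
  refine (fn n).mem_closure_of_compact (2 * (n + 1)) fun j hj => ?_
  let j' : Fin (m + 1) := ⟨j, Nat.lt_succ_iff.2 hj⟩
  filter_upwards [hG'' j' 2 hχ n, (fn n).coeFn_wderiv j'] with s h1 h2 hs
  rw [hfn' n j', h1 hs] at h2
  exact (mul_eq_zero.1 h2.symm).resolve_left (W.rootWeight_pos m s).ne'

end WeightData

/-! ## Compactness of the inclusions -/

/-- An operator into a Hilbert space that is uniformly approximated, on a dense set of vectors, by
finite-dimensional subspaces is compact. -/
theorem isCompactOperator_of_forall_exists_finiteDimensional {X Y ι : Type*}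
    [NormedAddCommGroup X] [NormedSpace ℝ X] [NormedAddCommGroup Y] [InnerProductSpace ℝ Y]
    [CompleteSpace Y] (T : X →L[ℝ] Y) {e : ι → X} (he : DenseRange e)
    (h : ∀ ε > 0, ∃ V : Submodule ℝ Y, FiniteDimensional ℝ V ∧
      ∀ i, ∃ v ∈ V, ‖T (e i) - v‖ ≤ ε * ‖e i‖) : IsCompactOperator T := by
  choose V hV hVe using fun n : ℕ => h (1 / (n + 1 : ℝ)) (by positivity)
  have := hV
  -- Orthogonal projection to V_n is the best approximation in V_n, so the finite-rank operator F_n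
  -- is within 1/(n+1) of T on the dense set, and then in operator norm.
  let F : ℕ → X →L[ℝ] Y := fun n => (V n).starProjection.comp T
  have hF : ∀ n, IsCompactOperator (F n) := fun n => by
    have h1 : IsCompactOperator ((V n).orthogonalProjectionOnto.comp T) :=
      isCompactOperator_of_locallyCompactSpace_dom _
    exact h1.clm_comp (V n).subtypeL
  refine isCompactOperator_of_tendsto (l := Filter.atTop) (F := F) ?_
    (Filter.Eventually.of_forall hF)
  rw [tendsto_iff_norm_sub_tendsto_zero]
  refine squeeze_zero (fun n => norm_nonneg _) (fun n => ?_)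
    (tendsto_one_div_add_atTop_nhds_zero_nat (𝕜 := ℝ))
  refine ContinuousLinearMap.opNorm_le_bound _ (by positivity) fun x => ?_
  refine he.induction_on (p := fun x => ‖(F n - T) x‖ ≤ 1 / (n + 1 : ℝ) * ‖x‖) x
    (isClosed_le (by fun_prop) (by fun_prop)) fun i => ?_
  obtain ⟨v, hv, hvi⟩ := hVe n i
  refine le_trans ?_ hvi
  rw [sub_apply, norm_sub_rev]
  change ‖T (e i) - (V n).starProjection (T (e i))‖ ≤ _
  rw [Submodule.starProjection_minimal]
  exact ciInf_le ⟨0, by rintro _ ⟨y, rfl⟩; exact norm_nonneg _⟩ (⟨v, hv⟩ : V n)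

/-- Cauchy–Schwarz for g(b) - g(a) = ∫ g', derived from the nonnegativity of ∫ (g' - d/L)², where
d/L is the mean of g' on [a, b]. -/
theorem TestFun.sq_sub_le (g : TestFun) {a b N : ℝ} (ha : -N ≤ a) (hab : a ≤ b) (hb : b ≤ N) :
    (g b - g a) ^ 2 ≤ (b - a) * ∫ s in Icc (-N) N, g.deriv s ^ 2 := by
  rcases hab.eq_or_lt with rfl | hlt
  · simp
  set L := b - a with hL
  have hL0 : 0 < L := sub_pos.2 hlt
  set d := g b - g a with hd
  have hc : Continuous g.deriv := g.deriv.continuous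
  have e1 : ∫ s in a..b, g.deriv s = d :=
    intervalIntegral.integral_eq_sub_of_hasDerivAt (fun x _ => g.hasDerivAt x)
      (hc.intervalIntegrable _ _)
  have i2 : IntervalIntegrable (fun s => g.deriv s ^ 2) volume a b :=
    (hc.pow 2).intervalIntegrable _ _
  have i1 : IntervalIntegrable (fun s => 2 * (d / L) * g.deriv s) volume a b :=
    (hc.const_mul _).intervalIntegrable _ _
  have e2 : ∫ s in a..b, (g.deriv s - d / L) ^ 2
      = (∫ s in a..b, g.deriv s ^ 2) - 2 * (d / L) * d + (b - a) * (d / L) ^ 2 := by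
    have : ∀ s, (g.deriv s - d / L) ^ 2
        = (g.deriv s ^ 2 - 2 * (d / L) * g.deriv s) + (d / L) ^ 2 := fun s => by ring
    simp only [this]
    rw [intervalIntegral.integral_add (i2.sub i1) (by simp),
      intervalIntegral.integral_sub i2 i1, intervalIntegral.integral_const_mul, e1,
      intervalIntegral.integral_const, smul_eq_mul]
  have h0 : 0 ≤ ∫ s in a..b, (g.deriv s - d / L) ^ 2 :=
    intervalIntegral.integral_nonneg hab fun s _ => sq_nonneg _
  have h1 : d ^ 2 ≤ L * ∫ s in a..b, g.deriv s ^ 2 := by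
    rw [e2, ← hL] at h0
    have : L * ((∫ s in a..b, g.deriv s ^ 2) - 2 * (d / L) * d + L * (d / L) ^ 2)
        = L * (∫ s in a..b, g.deriv s ^ 2) - d ^ 2 := by
      field_simp; ring
    nlinarith [mul_nonneg hL0.le h0]
  refine h1.trans (mul_le_mul_of_nonneg_left ?_ hL0.le)
  rw [intervalIntegral.integral_of_le hab]
  refine setIntegral_mono_set ((hc.pow 2).continuousOn.integrableOn_compact isCompact_Icc)
    (Filter.Eventually.of_forall fun s => sq_nonneg _) (LE.le.eventuallyLE ?_)
  exact fun s hs => ⟨ha.trans hs.1.le, hs.2.trans hb⟩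

/-- The indicator function of `[i/K, (i+1)/K)` in `L²(ℝ)`. -/
def stepL2 (K : ℕ) (i : ℤ) : L2 :=
  indicatorConstLp 2 (measurableSet_Ico (a := (i : ℝ) / K) (b := (i + 1 : ℝ) / K)) (by simp) (1 : ℝ)

theorem coeFn_sum_smul {ι : Type*} (s : Finset ι) (c : ι → ℝ) (e : ι → L2) :
    (∑ i ∈ s, c i • e i : L2) =ᵐ[volume] fun x => ∑ i ∈ s, c i * e i x := by
  classical
  induction s using Finset.induction_on with
  | empty =>
    simp only [Finset.sum_empty]
    exact Lp.coeFn_zero ℝ 2 volume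
  | insert a s ha ih =>
    rw [Finset.sum_insert ha]
    filter_upwards [Lp.coeFn_add (c a • e a) (∑ i ∈ s, c i • e i), Lp.coeFn_smul (c a) (e a), ih]
      with x h1 h2 h3
    rw [h1, Pi.add_apply, h2, h3, Finset.sum_insert ha]; rfl

/-- The step function on `[-N, N)` with step `1/K` that interpolates `g`. -/
theorem TestFun.exists_step (g : TestFun) (N K : ℕ) (hK : 0 < K) :
    ∃ v ∈ Submodule.span ℝ (stepL2 K '' (Finset.Ico (-(N * K : ℤ)) (N * K))),
      ∀ᵐ s, (s ∈ Ico (-N : ℝ) N → (g s - v s) ^ 2 ≤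
        1 / K * ∫ s in Icc (-N : ℝ) N, g.deriv s ^ 2) ∧ (s ∉ Ico (-N : ℝ) N → v s = 0) := by
  have hK' : (0 : ℝ) < K := Nat.cast_pos.2 hK
  set I := Finset.Ico (-(N * K : ℤ)) (N * K)
  refine ⟨∑ i ∈ I, g (i / K) • stepL2 K i, Submodule.sum_mem _ fun i hi =>
    Submodule.smul_mem _ _ (Submodule.subset_span ⟨i, hi, rfl⟩), ?_⟩
  -- In terms of ⌊sK⌋ exactly one step is active at s, so the sum collapses to the value of g at the
  -- left grid point ⌊sK⌋/K.
  have hst : ∀ᵐ s, ∀ i : ℤ, stepL2 K i s = if ⌊s * K⌋ = i then 1 else 0 := by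
    rw [ae_all_iff]
    intro i
    filter_upwards [indicatorConstLp_coeFn (p := 2) (μ := (volume : Measure ℝ))
      (hs := measurableSet_Ico (a := (i : ℝ) / K) (b := (i + 1 : ℝ) / K)) (hμs := by simp)
      (c := (1 : ℝ))] with s hs
    rw [stepL2, hs, indicator_apply]
    congr 1
    rw [Int.floor_eq_iff, mem_Ico, div_le_iff₀ hK', lt_div_iff₀ hK']
  filter_upwards [hst, coeFn_sum_smul I (fun i => g (i / K)) (stepL2 K)] with s h1 h2
  have hmem : s ∈ Ico (-N : ℝ) N ↔ ⌊s * K⌋ ∈ I := by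
    rw [Finset.mem_Ico, Int.le_floor, Int.floor_lt, mem_Ico]
    push_cast
    rw [← neg_mul, mul_le_mul_iff_left₀ hK', mul_lt_mul_iff_left₀ hK']
  simp only [h1, mul_ite, mul_one, mul_zero, Finset.sum_ite_eq, ← hmem] at h2
  rw [h2]
  refine ⟨fun hs => ?_, fun hs => if_neg hs⟩
  rw [if_pos hs]
  have hfl : (⌊s * K⌋ : ℝ) / K ≤ s := by rw [div_le_iff₀ hK']; exact Int.floor_le _
  have hfl' : s - (⌊s * K⌋ : ℝ) / K ≤ 1 / K := by
    rw [sub_le_iff_le_add, ← add_div, le_div_iff₀ hK', add_comm]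
    exact (Int.lt_floor_add_one _).le
  have hN : -(N : ℝ) ≤ (⌊s * K⌋ : ℝ) / K := by
    rw [le_div_iff₀ hK']
    have := (Finset.mem_Ico.1 (hmem.1 hs)).1
    have : ((-(N * K : ℤ) : ℤ) : ℝ) ≤ (⌊s * K⌋ : ℝ) := by exact_mod_cast this
    push_cast at this; linarith
  refine (g.sq_sub_le hN hfl hs.2.le).trans (mul_le_mul_of_nonneg_right hfl' ?_)
  exact integral_nonneg fun s => sq_nonneg _

/-! ### Interior and tail estimates for the compactness of the inclusions. -/

namespace WeightData

variable (W : WeightData) (m : ℕ)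

theorem integral_sq_iterDeriv_mul_weight_le (u : TestFun) {j : ℕ} (hj : j ≤ m) :
    ∫ s, u.iterDeriv j s ^ 2 * W.weight m s ≤ ‖W.ofTest m u‖ ^ 2 := by
  rw [norm_sq_ofTest]
  exact Finset.single_le_sum (f := fun j => ∫ s, u.iterDeriv j s ^ 2 * W.weight m s)
    (fun j _ => integral_nonneg fun s => mul_nonneg (sq_nonneg _) (W.weight_pos m s).le)
    (Finset.mem_range.2 (Nat.lt_succ_iff.2 hj))

theorem integrable_sq_mul_weight (u : TestFun) : Integrable fun s => u s ^ 2 * W.weight m s := by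
  apply Continuous.integrable_of_hasCompactSupport
  · exact (u.continuous.pow 2).mul (W.continuous_weight m)
  · simp only [sq, mul_assoc]
    exact u.compact.mul_right

theorem exp_neg_le_weight (s : ℝ) : Real.exp (-W.δ m) ≤ W.weight m s := by
  unfold weight
  apply Real.exp_le_exp.2
  nlinarith [W.neg_one_le_mul s, W.δ_nonneg m]

theorem integral_sq_iterDeriv_le (u : TestFun) {j : ℕ} (hj : j ≤ m) :
    ∫ s, u.iterDeriv j s ^ 2 ≤ Real.exp (W.δ m) * ‖W.ofTest m u‖ ^ 2 := by
  refine le_trans ?_ (mul_le_mul_of_nonneg_left (W.integral_sq_iterDeriv_mul_weight_le m u hj)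
    (Real.exp_pos _).le)
  rw [← integral_const_mul]
  refine integral_mono ((u.iterDeriv j).memLp.integrable_sq)
    ((W.integrable_sq_mul_weight m (u.iterDeriv j)).const_mul _) fun s => ?_
  have h1 := mul_le_mul_of_nonneg_left (W.exp_neg_le_weight m s) (Real.exp_pos (W.δ m)).le
  rw [← Real.exp_add, add_neg_cancel, Real.exp_zero] at h1
  have := mul_le_mul_of_nonneg_left h1 (sq_nonneg (u.iterDeriv j s))
  dsimp only
  linarith

/-- The strict increase of δ makes the tails of a W^{m+1}-bounded family uniformly small in the
weight of level m, which prevents mass from escaping to infinity; the shift by 2 is that of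
`abs_sub_two_le`. -/
theorem weight_le_of_le_abs {N s : ℝ} (hs : N ≤ |s|) :
    W.weight m s ≤ Real.exp (-(W.δ (m + 1) - W.δ m) * (N - 2)) * W.weight (m + 1) s := by
  unfold weight
  rw [← Real.exp_add]
  apply Real.exp_le_exp.2
  have h1 := W.abs_sub_two_le s
  have h2 : W.δ m < W.δ (m + 1) := W.δ_strictMono (Nat.lt_succ_self m)
  nlinarith

/-- On [-N, N] the root weight and its derivative are bounded by constants A and B, so the product
rule costs only D^j u and D^{j+1} u, both controlled by the norm of level m + 1. The constant does
not depend on u. -/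
theorem exists_sq_deriv_le (N : ℝ) : ∃ C : ℝ, 0 ≤ C ∧ ∀ (u : TestFun) (j : ℕ), j ≤ m →
    ∫ s in Icc (-N) N, ((u.iterDeriv j).mul (W.rootWeight m) (W.rootWeight_contDiff m)).deriv s ^ 2
      ≤ C * ‖W.ofTest (m + 1) u‖ ^ 2 := by
  have hw := W.rootWeight_contDiff m
  obtain ⟨A, hA⟩ := (isCompact_Icc (a := -N) (b := N)).exists_bound_of_continuousOn
    hw.continuous.continuousOn
  obtain ⟨B, hB⟩ := (isCompact_Icc (a := -N) (b := N)).exists_bound_of_continuousOn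
    (hw.continuous_deriv (by simp)).continuousOn
  set E := Real.exp (W.δ (m + 1))
  refine ⟨2 * B ^ 2 * E + 2 * A ^ 2 * E, by positivity, fun u j hj => ?_⟩
  set v := u.iterDeriv j with hv
  set v' := u.iterDeriv (j + 1) with hv'
  have hd : ∀ s, (v.mul (W.rootWeight m) hw).deriv s
      = deriv (W.rootWeight m) s * v s + W.rootWeight m s * v' s := fun s => by
    have h1 := ((hw.differentiable (by simp) s).hasDerivAt).mul (v.hasDerivAt s)
    have h2 : v.deriv s = v' s := by
      simp only [hv', hv, TestFun.iterDeriv, TestFun.deriv, iteratedDeriv_succ]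
    rw [h2] at h1
    exact h1.deriv
  have i1 : Integrable fun s => 2 * B ^ 2 * v s ^ 2 + 2 * A ^ 2 * v' s ^ 2 :=
    (v.memLp.integrable_sq.const_mul _).add (v'.memLp.integrable_sq.const_mul _)
  calc ∫ s in Icc (-N) N, (v.mul (W.rootWeight m) hw).deriv s ^ 2
      ≤ ∫ s in Icc (-N) N, (2 * B ^ 2 * v s ^ 2 + 2 * A ^ 2 * v' s ^ 2) := by
        refine setIntegral_mono_on
          (((v.mul _ hw).deriv.continuous.pow 2).continuousOn.integrableOn_compact isCompact_Icc)
          i1.integrableOn measurableSet_Icc fun s hs => ?_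
        rw [hd]
        have h1 : W.rootWeight m s ^ 2 ≤ A ^ 2 := by
          rw [← sq_abs]; exact pow_le_pow_left₀ (abs_nonneg _) (hA s hs) 2
        have h2 : deriv (W.rootWeight m) s ^ 2 ≤ B ^ 2 := by
          rw [← sq_abs]; exact pow_le_pow_left₀ (abs_nonneg _) (hB s hs) 2
        have h3 := mul_le_mul_of_nonneg_right h1 (sq_nonneg (v' s))
        have h4 := mul_le_mul_of_nonneg_right h2 (sq_nonneg (v s))
        nlinarith [sq_nonneg (deriv (W.rootWeight m) s * v s - W.rootWeight m s * v' s)]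
    _ ≤ ∫ s, (2 * B ^ 2 * v s ^ 2 + 2 * A ^ 2 * v' s ^ 2) :=
        setIntegral_le_integral i1 (Filter.Eventually.of_forall fun s => by positivity)
    _ = 2 * B ^ 2 * (∫ s, v s ^ 2) + 2 * A ^ 2 * ∫ s, v' s ^ 2 := by
        rw [integral_add (v.memLp.integrable_sq.const_mul _)
          (v'.memLp.integrable_sq.const_mul _), integral_const_mul, integral_const_mul]
    _ ≤ _ := by
        have h1 := W.integral_sq_iterDeriv_le (m + 1) u (hj.trans (Nat.le_succ m))
        have h2 := W.integral_sq_iterDeriv_le (m + 1) u (Nat.succ_le_succ hj)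
        have h3 := mul_le_mul_of_nonneg_left h1 (by positivity : 0 ≤ 2 * B ^ 2)
        have h4 := mul_le_mul_of_nonneg_left h2 (by positivity : 0 ≤ 2 * A ^ 2)
        linarith

/-- Weighted Rellich theorem. Replace the weighted derivative by zero outside [-N, N) and by a step
function of mesh 1/K inside; tail and interior each contribute at most ε²/2 times the squared norm,
so the step functions provide the required finite-dimensional spaces. -/
theorem isCompactOperator_wderivL_incl (j : Fin (m + 1)) :
    IsCompactOperator ((Sobolev.wderivL W m j).comp (Sobolev.incl W m)) := by
  have hj := Nat.lt_succ_iff.1 j.2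
  refine isCompactOperator_of_forall_exists_finiteDimensional _ (W.denseRange_ofTest (m + 1))
    fun ε hε => ?_
  have hδ : 0 < W.δ (m + 1) - W.δ m := sub_pos.2 (W.δ_strictMono (Nat.lt_succ_self m))
  obtain ⟨N, hN⟩ : ∃ N : ℕ, Real.exp (-(W.δ (m + 1) - W.δ m) * ((N : ℝ) - 2)) < ε ^ 2 / 2 := by
    have h1 : Filter.Tendsto (fun N : ℕ => -(W.δ (m + 1) - W.δ m) * ((N : ℝ) - 2)) Filter.atTop
        Filter.atBot :=
      Filter.Tendsto.const_mul_atTop_of_neg (neg_lt_zero.2 hδ)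
        (Filter.tendsto_atTop_add_const_right _ (-2) tendsto_natCast_atTop_atTop)
    exact ((Real.tendsto_exp_atBot.comp h1).eventually (gt_mem_nhds (by positivity))).exists
  obtain ⟨C, hC0, hC⟩ := W.exists_sq_deriv_le m N
  -- The pointwise squared error inside is at most C‖u‖²/K, on an interval of length 2N.
  obtain ⟨K, hK⟩ := exists_nat_gt (2 * N * C / (ε ^ 2 / 2))
  have hK0 : 0 < K := by
    have : (0 : ℝ) < K := lt_of_le_of_lt (by positivity) hK
    exact_mod_cast this
  have hK' : (0 : ℝ) < K := Nat.cast_pos.2 hK0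
  rw [div_lt_iff₀ (by positivity)] at hK
  refine ⟨Submodule.span ℝ (stepL2 K '' (Finset.Ico (-(N * K : ℤ)) (N * K))), ?_, fun u => ?_⟩
  · exact FiniteDimensional.span_of_finite ℝ ((Finset.finite_toSet _).image _)
  set g := (u.iterDeriv j).mul (W.rootWeight m) (W.rootWeight_contDiff m) with hg
  obtain ⟨v, hv, hvae⟩ := g.exists_step N K hK0
  refine ⟨v, hv, ?_⟩
  set U := ‖W.ofTest (m + 1) u‖ with hU
  have hT : ((Sobolev.wderivL W m j).comp (Sobolev.incl W m)) (W.ofTest (m + 1) u) = g.toL2 :=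
    Sobolev.wderiv_ofTest u j
  rw [hT]
  apply le_of_sq_le_sq _ (by positivity)
  set D := ∫ s in Icc (-N : ℝ) N, g.deriv s ^ 2 with hD
  have hDC : D ≤ C * U ^ 2 := hC u j hj
  set q := Real.exp (-(W.δ (m + 1) - W.δ m) * ((N : ℝ) - 2)) with hq
  have hint1 := (W.integrable_sq_mul_weight (m + 1) (u.iterDeriv j)).const_mul q
  have hint2 : Integrable ((Ico (-N : ℝ) N).indicator fun _ => 1 / K * D) :=
    (integrable_indicator_iff measurableSet_Ico).2 (integrableOn_const (by simp))
  calc ‖g.toL2 - v‖ ^ 2 = ∫ s, (g s - v s) ^ 2 := by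
        rw [L2.norm_sq_eq_integral]
        apply integral_congr_ae
        filter_upwards [Lp.coeFn_sub g.toL2 v, g.coeFn_toL2] with s h1 h2
        rw [h1, Pi.sub_apply, h2]
    _ ≤ ∫ s, (q * (u.iterDeriv j s ^ 2 * W.weight (m + 1) s)
          + (Ico (-N : ℝ) N).indicator (fun _ => 1 / K * D) s) := by
        refine integral_mono_of_nonneg (Filter.Eventually.of_forall fun s => sq_nonneg _)
          (hint1.add hint2) ?_
        filter_upwards [hvae] with s hs
        have hp : 0 ≤ q * (u.iterDeriv j s ^ 2 * W.weight (m + 1) s) :=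
          mul_nonneg (Real.exp_pos _).le (mul_nonneg (sq_nonneg _) (W.weight_pos _ s).le)
        by_cases h : s ∈ Ico (-N : ℝ) N
        · rw [indicator_of_mem h]
          have := hs.1 h
          linarith
        · rw [indicator_of_notMem h, hs.2 h, sub_zero, add_zero]
          have h1 : (N : ℝ) ≤ |s| := by
            by_contra hlt
            exact h ⟨(abs_lt.1 (not_le.1 hlt)).1.le, (abs_lt.1 (not_le.1 hlt)).2⟩
          have h2 := W.weight_le_of_le_abs m h1
          have h3 : g s ^ 2 = u.iterDeriv j s ^ 2 * W.weight m s := by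
            change (W.rootWeight m s * u.iterDeriv j s) ^ 2 = _
            rw [mul_pow, rootWeight_sq, mul_comm]
          rw [h3]
          have := mul_le_mul_of_nonneg_left h2 (sq_nonneg (u.iterDeriv j s))
          linarith
    _ = q * (∫ s, u.iterDeriv j s ^ 2 * W.weight (m + 1) s) + 2 * N * (1 / K * D) := by
        rw [integral_add hint1 hint2, integral_const_mul, integral_indicator measurableSet_Ico,
          setIntegral_const, measureReal_def, Real.volume_Ico, smul_eq_mul,
          ENNReal.toReal_ofReal (by linarith [(Nat.cast_nonneg N : (0 : ℝ) ≤ N)])]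
        ring
    _ ≤ ε ^ 2 / 2 * U ^ 2 + ε ^ 2 / 2 * U ^ 2 := by
        refine add_le_add ?_ ?_
        · exact mul_le_mul hN.le (W.integral_sq_iterDeriv_mul_weight_le (m + 1) u
            (hj.trans (Nat.le_succ m))) (integral_nonneg fun s =>
              mul_nonneg (sq_nonneg _) (W.weight_pos _ s).le) (by positivity)
        · have h1 : 2 * N * (1 / K * D) ≤ 2 * N * (1 / K * (C * U ^ 2)) := by gcongr
          refine h1.trans ?_
          have h2 : 2 * N * (1 / K * (C * U ^ 2)) = 2 * N * C / K * U ^ 2 := by ring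
          rw [h2]
          apply mul_le_mul_of_nonneg_right _ (sq_nonneg _)
          rw [div_le_iff₀ hK']; linarith
    _ = (ε * U) ^ 2 := by ring

/-- An isometry with complete domain is a closed embedding, so the preimage of a product of compact
sets, one for each weighted derivative, is compact in W^{m,δ_m}. -/
theorem isCompactOperator_incl : IsCompactOperator (Sobolev.incl W m) := by
  choose K hK hK' using W.isCompactOperator_wderivL_incl m
  have hemb : Topology.IsClosedEmbedding
      (fun f : W.Sobolev m => fun j => Sobolev.wderiv W m j f) :=
    (PiLp.continuousLinearEquiv 2 ℝ (fun _ : Fin (m + 1) => L2)).toHomeomorph.isClosedEmbedding.comp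
      (Sobolev.isometry W m).isometry.isClosedEmbedding
  refine ⟨_, hemb.isCompact_preimage (isCompact_univ_pi hK), ?_⟩
  have : ∀ᶠ f in nhds (0 : W.Sobolev (m + 1)), ∀ j, Sobolev.wderiv W m j (Sobolev.incl W m f) ∈ K j :=
    Filter.eventually_all.2 fun j => hK' j
  filter_upwards [this] with f hf j _
  exact hf j

end WeightData

/-! ## The ambient sc-space -/

namespace ScScale

theorem emb_const (V : Type) [NormedAddCommGroup V] [NormedSpace ℝ V] (m : ℕ) (v : V) :
    (ScScale.const V).emb m v = v := by
  induction m with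
  | zero => rfl
  | succ m ih => exact ih

theorem emb_prod (E F : ScScale) (m : ℕ) (x : E.level m) (y : F.level m) :
    (E.prod F).emb m ((x, y) : E.level m × F.level m) = (E.emb m x, F.emb m y) := by
  induction m with
  | zero => rfl
  | succ m ih => exact ih (E.incl m x) (F.incl m y)

theorem IsScBanach.const (V : Type) [NormedAddCommGroup V] [NormedSpace ℝ V]
    [FiniteDimensional ℝ V] : (ScScale.const V).IsScBanach where
  complete _ := FiniteDimensional.complete ℝ V
  compact _ := by
    have : ProperSpace V := FiniteDimensional.proper ℝ V
    exact isCompactOperator_of_locallyCompactSpace_dom (ContinuousLinearMap.id ℝ V)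
  dense m := by
    have h : (ScScale.const V).smoothPoints m = univ := by
      refine eq_univ_of_forall fun x i => ⟨x, ?_⟩
      exact (emb_const V i x).trans (emb_const V m x).symm
    rw [h]; exact dense_univ

theorem _root_.IsCompactOperator.prodMap_clm {X Y X' Y' : Type*} [NormedAddCommGroup X]
    [NormedSpace ℝ X] [NormedAddCommGroup Y] [NormedSpace ℝ Y] [NormedAddCommGroup X']
    [NormedSpace ℝ X'] [NormedAddCommGroup Y'] [NormedSpace ℝ Y'] {A : X →L[ℝ] Y}
    {B : X' →L[ℝ] Y'} (hA : IsCompactOperator A) (hB : IsCompactOperator B) :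
    IsCompactOperator (A.prodMap B) := by
  obtain ⟨K, hK, hK'⟩ := hA
  obtain ⟨L, hL, hL'⟩ := hB
  refine ⟨K ×ˢ L, hK.prod hL, ?_⟩
  exact prod_mem_nhds hK' hL'

theorem IsScBanach.prod {E F : ScScale} (hE : E.IsScBanach) (hF : F.IsScBanach) :
    (E.prod F).IsScBanach where
  complete m := by
    have := hE.complete m
    have := hF.complete m
    exact inferInstanceAs (CompleteSpace (E.level m × F.level m))
  compact m := (hE.compact m).prodMap_clm (hF.compact m)
  dense m := by
    refine ((hE.dense m).prod (hF.dense m)).mono ?_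
    rintro ⟨x, y⟩ ⟨hx, hy⟩ i
    obtain ⟨a, ha⟩ := hx i
    obtain ⟨b, hb⟩ := hy i
    refine ⟨((a, b) : E.level i × F.level i), ?_⟩
    rw [emb_prod E F i, ha, hb]
    exact (emb_prod E F m x y).symm

theorem IsScBanach.denseIncl {E : ScScale} (hE : E.IsScBanach) : E.DenseIncl := fun m => by
  refine (hE.dense m).mono fun x hx => ?_
  obtain ⟨y, hy⟩ := hx (m + 1)
  exact ⟨y, E.emb_injective m hy⟩

end ScScale

/-! ### Reflexivity. -/

/-- Reflexivity of a normed space. -/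
def IsReflexiveSpace (V : Type*) [NormedAddCommGroup V] [NormedSpace ℝ V] : Prop :=
  Surjective (NormedSpace.inclusionInDoubleDual ℝ V)

/-- Riesz twice: composed with the Riesz isomorphism, an element of the double dual becomes a
functional on H, and its representing vector is the preimage. -/
theorem IsReflexiveSpace.of_hilbert (H : Type*) [NormedAddCommGroup H] [InnerProductSpace ℝ H]
    [CompleteSpace H] : IsReflexiveSpace H := by
  intro φ
  let D := InnerProductSpace.toDual ℝ H
  let ψ : StrongDual ℝ H := LinearMap.mkContinuous
    { toFun := fun x => φ (D x)
      map_add' := fun x y => by rw [map_add, map_add]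
      map_smul' := fun c x => by rw [map_smulₛₗ, map_smulₛₗ]; rfl } ‖φ‖ fun x => by
      simpa using φ.le_opNorm (D x)
  refine ⟨D.symm ψ, ?_⟩
  ext l
  rw [NormedSpace.dual_def]
  obtain ⟨x, rfl⟩ := D.surjective l
  change inner ℝ x (D.symm ψ) = φ (D x)
  rw [real_inner_comm, InnerProductSpace.toDual_symm_apply]
  rfl

theorem IsReflexiveSpace.prod {V U : Type*} [NormedAddCommGroup V] [NormedSpace ℝ V]
    [NormedAddCommGroup U] [NormedSpace ℝ U] (hV : IsReflexiveSpace V)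
    (hU : IsReflexiveSpace U) : IsReflexiveSpace (V × U) := by
  intro φ
  obtain ⟨x, hx⟩ := hV (φ.comp ((ContinuousLinearMap.compL ℝ (V × U) V ℝ).flip
    (ContinuousLinearMap.fst ℝ V U)))
  obtain ⟨y, hy⟩ := hU (φ.comp ((ContinuousLinearMap.compL ℝ (V × U) U ℝ).flip
    (ContinuousLinearMap.snd ℝ V U)))
  refine ⟨(x, y), ?_⟩
  ext l
  rw [NormedSpace.dual_def]
  have h1 := congrArg (fun T => T (l.comp (ContinuousLinearMap.inl ℝ V U))) hx
  have h2 := congrArg (fun T => T (l.comp (ContinuousLinearMap.inr ℝ V U))) hy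
  simp only [NormedSpace.dual_def, ContinuousLinearMap.comp_apply,
    ContinuousLinearMap.flip_apply, ContinuousLinearMap.compL_apply] at h1 h2
  have e : l = (l.comp (ContinuousLinearMap.inl ℝ V U)).comp (ContinuousLinearMap.fst ℝ V U)
      + (l.comp (ContinuousLinearMap.inr ℝ V U)).comp (ContinuousLinearMap.snd ℝ V U) := by
    ext z <;> simp <;> exact map_zero l
  conv_rhs => rw [e, map_add, ← h1, ← h2]
  change l (x, y) = l (x, 0) + l (0, y)
  rw [← map_add]; simp

namespace WeightData

variable (W : WeightData) (m : ℕ)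

theorem toL2_emb (x : W.Sobolev m) :
    Sobolev.toL2 (m := 0) (W.sobolevScale.emb m x) = Sobolev.toL2 x := by
  induction m with
  | zero => rfl
  | succ m ih => exact ih (Sobolev.incl W m x)

theorem ofTest_mem_smoothPoints (u : TestFun) : W.ofTest m u ∈ W.sobolevScale.smoothPoints m := by
  intro i
  refine ⟨W.ofTest i u, Sobolev.toL2_injective (m := 0) ?_⟩
  rw [toL2_emb, toL2_emb]; rfl

theorem isScBanach_sobolevScale : W.sobolevScale.IsScBanach where
  complete m := inferInstanceAs (CompleteSpace (W.Sobolev m))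
  compact m := W.isCompactOperator_incl m
  dense m := (W.denseRange_ofTest m).mono
    (by rintro _ ⟨u, rfl⟩; exact W.ofTest_mem_smoothPoints m u)

theorem isScBanach_ambient (n : ℕ) : (W.ambient n).IsScBanach :=
  (ScScale.IsScBanach.const _).prod ((ScScale.IsScBanach.const ℝ).prod W.isScBanach_sobolevScale)

theorem isReflexive_ambient (n : ℕ) : (W.ambient n).IsReflexive := fun m =>
  IsReflexiveSpace.prod (IsReflexiveSpace.of_hilbert (EuclideanSpace ℝ (Fin n)))
    (IsReflexiveSpace.prod (IsReflexiveSpace.of_hilbert ℝ)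
      (IsReflexiveSpace.of_hilbert (W.Sobolev m)))

end WeightData

/-! ## Translates of test functions in the weighted Sobolev spaces -/

namespace TestFun

/-- The translate `u(· + a)`. -/
def shift (u : TestFun) (a : ℝ) : TestFun where
  toFun s := u (s + a)
  smooth := u.smooth.comp (contDiff_id.add contDiff_const)
  compact := u.compact.comp_homeomorph (Homeomorph.addRight a)

theorem iterDeriv_shift (u : TestFun) (j : ℕ) (a : ℝ) :
    (u.shift a).iterDeriv j = (u.iterDeriv j).shift a := by
  ext s
  exact congrFun (iteratedDeriv_comp_add_const j u a) s

theorem iterDeriv_deriv (u : TestFun) (j : ℕ) : u.deriv.iterDeriv j = (u.iterDeriv j).deriv := by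
  ext s
  simp only [iterDeriv, deriv]
  rw [← iteratedDeriv_succ', iteratedDeriv_succ]

theorem exists_radius (u : TestFun) : ∃ R, ∀ s, R < |s| → u s = 0 := by
  obtain ⟨R, hR⟩ := (Metric.isBounded_iff_subset_closedBall (0 : ℝ)).1 u.compact.isBounded
  refine ⟨R, fun s hs => image_eq_zero_of_notMem_tsupport fun h => ?_⟩
  have := hR h
  rw [Metric.mem_closedBall, dist_zero_right, Real.norm_eq_abs] at this
  linarith

/-- The mean value inequality, applied first to g' and then to x ↦ g(x) - x g'(y), with M a bound
for |g''|; hence the estimate is uniform in y. -/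
theorem abs_taylor_le (g : TestFun) : ∃ M, 0 ≤ M ∧ ∀ y h,
    |g (y + h) - g y - h * g.deriv y| ≤ M * h ^ 2 := by
  obtain ⟨M, hM⟩ := g.deriv.deriv.exists_bound
  have hM0 : 0 ≤ M := (abs_nonneg _).trans (hM 0)
  refine ⟨M, hM0, fun y h => ?_⟩
  have h1 : ∀ x, |g.deriv x - g.deriv y| ≤ M * |x - y| := fun x => by
    have := Convex.norm_image_sub_le_of_norm_hasDerivWithin_le (f := g.deriv) (s := univ)
      (fun x _ => (g.deriv.hasDerivAt x).hasDerivWithinAt) (fun x _ => hM x) convex_univ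
      (mem_univ y) (mem_univ x)
    exact this
  have h2 := Convex.norm_image_sub_le_of_norm_hasDerivWithin_le
    (f := fun x => g x - x * g.deriv y) (f' := fun x => g.deriv x - 1 * g.deriv y)
    (s := Metric.closedBall y |h|) (C := M * |h|)
    (fun x _ => ((g.hasDerivAt x).sub ((hasDerivAt_id x).mul_const _)).hasDerivWithinAt)
    (fun x hx => by
      rw [one_mul]
      refine (h1 x).trans (mul_le_mul_of_nonneg_left ?_ hM0)
      simpa [Real.dist_eq] using hx) (convex_closedBall y |h|)
    (Metric.mem_closedBall_self (abs_nonneg h)) (y := y + h) (by simp)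
  have e : g (y + h) - (y + h) * g.deriv y - (g y - y * g.deriv y)
      = g (y + h) - g y - h * g.deriv y := by ring
  simp only [e, Real.norm_eq_abs, add_sub_cancel_left] at h2
  calc _ ≤ M * |h| * |h| := h2
    _ = M * h ^ 2 := by rw [mul_assoc, ← sq, sq_abs]

end TestFun

namespace WeightData

variable {W : WeightData}

theorem exp_mul_test_integrable (c : ℝ) (u : TestFun) :
    Integrable fun s => u s ^ 2 * Real.exp (c * |s|) := by
  apply Continuous.integrable_of_hasCompactSupport
  · have := u.continuous
    fun_prop
  · simp only [sq, mul_assoc]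
    exact u.compact.mul_right

/-- A substitution moves the translation into the weight, which at s - a is at most e^{δ_m(|s| +
a)}. The exponent is halved because this bounds the squared norm. -/
theorem norm_ofTest_shift_le (W : WeightData) (m : ℕ) (v : TestFun) : ∃ C, 0 ≤ C ∧ ∀ a, 0 ≤ a →
    ‖W.ofTest m (v.shift a)‖ ≤ C * Real.exp (W.δ m * a / 2) := by
  set S := ∑ j ∈ Finset.range (m + 1), ∫ s, v.iterDeriv j s ^ 2 * Real.exp (W.δ m * |s|) with hS
  have hS0 : 0 ≤ S := Finset.sum_nonneg fun j _ => integral_nonneg fun s => by positivity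
  refine ⟨Real.sqrt S, Real.sqrt_nonneg _, fun a ha => ?_⟩
  apply le_of_sq_le_sq _ (by positivity)
  rw [mul_pow, Real.sq_sqrt hS0, ← Real.exp_nat_mul, norm_sq_ofTest, hS, Finset.sum_mul]
  refine Finset.sum_le_sum fun j _ => ?_
  rw [TestFun.iterDeriv_shift]
  have e : ∫ s, (v.iterDeriv j).shift a s ^ 2 * W.weight m s
      = ∫ s, v.iterDeriv j s ^ 2 * W.weight m (s - a) := by
    rw [← integral_add_right_eq_self (fun s => v.iterDeriv j s ^ 2 * W.weight m (s - a)) a]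
    congr 1; ext s
    rw [add_sub_cancel_right]; rfl
  rw [e, ← integral_mul_const]
  refine integral_mono_of_nonneg (Filter.Eventually.of_forall fun s =>
    mul_nonneg (sq_nonneg _) (W.weight_pos _ _).le)
    ((exp_mul_test_integrable (W.δ m) (v.iterDeriv j)).mul_const _)
    (Filter.Eventually.of_forall fun s => ?_)
  dsimp only
  rw [mul_assoc, ← Real.exp_add]
  apply mul_le_mul_of_nonneg_left _ (sq_nonneg _)
  refine (W.weight_le_exp m _).trans (Real.exp_le_exp.2 ?_)
  have h1 : |s - a| ≤ |s| + a := by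
    have := abs_sub s a
    rwa [abs_of_nonneg ha] at this
  have := mul_le_mul_of_nonneg_left h1 (W.δ_nonneg m)
  push_cast
  linarith

/-- Dual estimate: put the root weight on f and its inverse on the translate, then apply
Cauchy–Schwarz. The weight at s - a is at least e^{δ_m(a - |s| - 2)}, so the decay rate matches the
growth rate in `norm_ofTest_shift_le`. -/
theorem abs_inner_shift_le (W : WeightData) (m : ℕ) (u : TestFun) : ∃ C, 0 ≤ C ∧ ∀ a, 0 ≤ a →
    ∀ f : W.Sobolev m, |inner ℝ (Sobolev.toL2 f) (u.shift a).toL2|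
      ≤ C * Real.exp (-(W.δ m * a / 2)) * ‖f‖ := by
  set S := Real.exp (2 * W.δ m) * ∫ s, u s ^ 2 * Real.exp (W.δ m * |s|) with hS
  have hS0 : 0 ≤ S := mul_nonneg (Real.exp_pos _).le (integral_nonneg fun s => by positivity)
  refine ⟨Real.sqrt S, Real.sqrt_nonneg _, fun a ha f => ?_⟩
  have hsm : ContDiff ℝ ∞ fun s => (W.rootWeight m s)⁻¹ :=
    (W.rootWeight_contDiff m).inv fun s => (W.rootWeight_pos m s).ne'
  let g := (u.shift a).mul (fun s => (W.rootWeight m s)⁻¹) hsm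
  have h1 : inner ℝ (Sobolev.toL2 f) (u.shift a).toL2
      = inner ℝ (Sobolev.wderiv W m 0 f) g.toL2 := by
    rw [← TestFun.integral_mul, ← TestFun.integral_mul]
    apply integral_congr_ae
    filter_upwards [f.coeFn_wderiv 0] with s hs
    rw [hs]
    have e : weakDeriv ((0 : Fin (m + 1)) : ℕ) (Sobolev.toL2 f) = Sobolev.toL2 f :=
      (IsWeakDeriv.zero_self _).eq_weakDeriv
    rw [e]
    change _ = _ * ((W.rootWeight m s)⁻¹ * u.shift a s)
    have := (W.rootWeight_pos m s).ne'
    field_simp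
  have h2 : ‖g.toL2‖ ≤ Real.sqrt S * Real.exp (-(W.δ m * a / 2)) := by
    apply le_of_sq_le_sq _ (by positivity)
    rw [mul_pow, Real.sq_sqrt hS0, ← Real.exp_nat_mul, L2.norm_sq_eq_integral]
    have e : ∫ s, g.toL2 s ^ 2 = ∫ s, u s ^ 2 * (W.weight m (s - a))⁻¹ := by
      rw [← integral_add_right_eq_self (fun s => u s ^ 2 * (W.weight m (s - a))⁻¹) a]
      apply integral_congr_ae
      filter_upwards [g.coeFn_toL2] with s hs
      rw [hs, add_sub_cancel_right, ← rootWeight_sq]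
      change ((W.rootWeight m s)⁻¹ * u (s + a)) ^ 2 = _
      rw [mul_pow, inv_pow, mul_comm]
    rw [e, hS, mul_comm (Real.exp _), ← integral_mul_const, ← integral_mul_const]
    refine integral_mono_of_nonneg (Filter.Eventually.of_forall fun s =>
      mul_nonneg (sq_nonneg _) (inv_pos.2 (W.weight_pos _ _)).le)
      (((exp_mul_test_integrable (W.δ m) u).mul_const _).mul_const _)
      (Filter.Eventually.of_forall fun s => ?_)
    dsimp only
    rw [mul_assoc, mul_assoc, ← Real.exp_add, ← Real.exp_add]
    apply mul_le_mul_of_nonneg_left _ (sq_nonneg _)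
    refine (inv_anti₀ (Real.exp_pos _) (W.exp_le_weight m (s - a))).trans ?_
    rw [← Real.exp_neg]
    apply Real.exp_le_exp.2
    have h1 : a - |s| ≤ |s - a| := by
      have := abs_sub_abs_le_abs_sub a s
      rwa [abs_of_nonneg ha, abs_sub_comm] at this
    have := mul_le_mul_of_nonneg_left h1 (W.δ_nonneg m)
    push_cast
    linarith
  rw [h1]
  calc _ ≤ ‖Sobolev.wderiv W m 0 f‖ * ‖g.toL2‖ := abs_real_inner_le_norm _ _
    _ ≤ ‖f‖ * (Real.sqrt S * Real.exp (-(W.δ m * a / 2))) :=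
      mul_le_mul (f.norm_wderiv_le 0) h2 (norm_nonneg _) (norm_nonneg _)
    _ = _ := by ring

/-- The remainder is pointwise at most M h², and for |h| ≤ 1 it vanishes outside a ball that does
not depend on h, on which the weight is integrable. -/
theorem norm_taylor_shift_le (W : WeightData) (m : ℕ) (g : TestFun) (a : ℝ) :
    ∃ C, 0 ≤ C ∧ ∀ h, |h| ≤ 1 →
      ∫ s, (W.rootWeight m s * (g.shift (a + h) s - g.shift a s - h * g.deriv.shift a s)) ^ 2
        ≤ C * (h ^ 2) ^ 2 := by
  obtain ⟨M, hM0, hM⟩ := g.abs_taylor_le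
  obtain ⟨R, hR⟩ := g.exists_radius
  set K := Metric.closedBall (0 : ℝ) (R + |a| + 1)
  have hKi : IntegrableOn (fun s => W.weight m s) K :=
    (W.continuous_weight m).continuousOn.integrableOn_compact (isCompact_closedBall _ _)
  refine ⟨M ^ 2 * ∫ s in K, W.weight m s, mul_nonneg (sq_nonneg _)
    (integral_nonneg fun s => (W.weight_pos m s).le), fun h hh => ?_⟩
  rw [← integral_indicator measurableSet_closedBall, mul_comm, ← mul_assoc, ← integral_const_mul]
  refine integral_mono_of_nonneg (Filter.Eventually.of_forall fun s => sq_nonneg _)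
    (((integrable_indicator_iff measurableSet_closedBall).2 hKi).const_mul _)
    (Filter.Eventually.of_forall fun s => ?_)
  dsimp only
  rw [mul_pow, rootWeight_sq]
  by_cases hs : s ∈ K
  · rw [indicator_of_mem hs, mul_comm]
    apply mul_le_mul_of_nonneg_right _ (W.weight_pos m s).le
    have := hM (s + a) h
    rw [← sq_abs, ← mul_pow, mul_comm (h ^ 2)]
    refine pow_le_pow_left₀ (abs_nonneg _) ?_ 2
    change |g (s + (a + h)) - g (s + a) - h * g.deriv (s + a)| ≤ _
    rwa [← add_assoc]
  · rw [indicator_of_notMem hs, mul_zero]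
    have hs' : R + |a| + 1 < |s| := by simpa [K] using hs
    have k1 : |s| ≤ |s + a| + |a| := by simpa using abs_sub (s + a) a
    have k2 : |s| ≤ |s + (a + h)| + (|a| + |h|) := by
      have := abs_sub (s + (a + h)) (a + h)
      rw [add_sub_cancel_right] at this
      linarith [abs_add_le a h]
    have e1 : g.shift (a + h) s = 0 := hR _ (by linarith)
    have e2 : g.shift a s = 0 := hR _ (by linarith)
    have e3 : g.deriv.shift a s = 0 := g.deriv_eq_zero hR _ (by linarith)
    rw [e1, e2, e3]; simp

/-- The curve `a ↦ v(· + a)` in `W^{m,δ_m}` is differentiable. -/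
theorem hasDerivAt_ofTest_shift (W : WeightData) (m : ℕ) (v : TestFun) (a : ℝ) :
    HasDerivAt (fun a => W.ofTest m (v.shift a)) (W.ofTest m (v.deriv.shift a)) a := by
  choose C hC0 hC using fun j : Fin (m + 1) => W.norm_taylor_shift_le m (v.iterDeriv j) a
  set S := ∑ j, C j
  have hS0 : 0 ≤ S := Finset.sum_nonneg fun j _ => hC0 j
  have key : ∀ h, |h| ≤ 1 → ‖W.ofTest m (v.shift (a + h)) - W.ofTest m (v.shift a)
      - h • W.ofTest m (v.deriv.shift a)‖ ≤ Real.sqrt S * h ^ 2 := fun h hh => by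
    apply le_of_sq_le_sq _ (by positivity)
    rw [Sobolev.norm_sq_eq_sum, mul_pow, Real.sq_sqrt hS0, Finset.sum_mul]
    refine Finset.sum_le_sum fun j _ => le_trans (le_of_eq ?_) (hC j h hh)
    rw [L2.norm_sq_eq_integral]
    apply integral_congr_ae
    rw [map_sub, map_sub, map_smul, Sobolev.wderiv_ofTest, Sobolev.wderiv_ofTest,
      Sobolev.wderiv_ofTest, TestFun.iterDeriv_shift, TestFun.iterDeriv_shift,
      TestFun.iterDeriv_shift, TestFun.iterDeriv_deriv]
    set A := ((v.iterDeriv j).shift (a + h)).mul _ (W.rootWeight_contDiff m)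
    set B := ((v.iterDeriv j).shift a).mul _ (W.rootWeight_contDiff m)
    set D := ((v.iterDeriv j).deriv.shift a).mul _ (W.rootWeight_contDiff m)
    filter_upwards [Lp.coeFn_sub (A.toL2 - B.toL2) (h • D.toL2), Lp.coeFn_sub A.toL2 B.toL2,
      Lp.coeFn_smul h D.toL2, A.coeFn_toL2, B.coeFn_toL2, D.coeFn_toL2] with s h1 h2 h3 h4 h5 h6
    rw [h1, Pi.sub_apply, h2, Pi.sub_apply, h3, Pi.smul_apply, h4, h5, h6]
    change (W.rootWeight m s * (v.iterDeriv j).shift (a + h) s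
      - W.rootWeight m s * (v.iterDeriv j).shift a s
      - h * (W.rootWeight m s * (v.iterDeriv j).deriv.shift a s)) ^ 2 = _
    ring
  rw [hasDerivAt_iff_isLittleO_nhds_zero]
  have h1 : (fun h => W.ofTest m (v.shift (a + h)) - W.ofTest m (v.shift a)
      - h • W.ofTest m (v.deriv.shift a)) =O[nhds 0] fun h : ℝ => h ^ 2 := by
    refine Asymptotics.IsBigO.of_bound (Real.sqrt S) ?_
    filter_upwards [Metric.closedBall_mem_nhds (0 : ℝ) one_pos] with h hh
    rw [Real.norm_of_nonneg (sq_nonneg h)]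
    exact key h (by simpa using hh)
  refine h1.trans_isLittleO ?_
  have := Asymptotics.isLittleO_pow_id (𝕜 := ℝ) one_lt_two
  exact this

theorem hasDerivAt_toL2_shift (u : TestFun) (W : WeightData) (a : ℝ) :
    HasDerivAt (fun a => (u.shift a).toL2) (u.deriv.shift a).toL2 a := by
  have h := (Sobolev.toL2L W 0).hasFDerivAt.comp_hasDerivAt a (W.hasDerivAt_ofTest_shift 0 u a)
  refine (h.congr_deriv ?_).congr_of_eventuallyEq (Filter.Eventually.of_forall fun b => ?_)
  · exact Sobolev.toL2L_apply _
  · exact (Sobolev.toL2L_apply (W.ofTest 0 (u.shift b))).symm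

end WeightData

/-! ## Translation by `e^{1/t}` -/

/-- The function `t^{-p} e^{q/t}`. -/
def expCoeff (p q : ℕ) (t : ℝ) : ℝ := t⁻¹ ^ p * Real.exp (1 / t) ^ q

theorem expCoeff_zero (t : ℝ) : expCoeff 0 0 t = 1 := by simp [expCoeff]

theorem hasDerivAt_exp_inv {t : ℝ} (ht : t ≠ 0) :
    HasDerivAt (fun t : ℝ => Real.exp (1 / t)) (-expCoeff 2 1 t) t := by
  have h := ((hasDerivAt_inv ht).congr_deriv
    (show -(t ^ 2)⁻¹ = -(t⁻¹ ^ 2) by rw [inv_pow])).exp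
  simp only [one_div]
  refine h.congr_deriv ?_
  simp only [expCoeff, one_div, pow_one]; ring

theorem hasDerivAt_expCoeff (p q : ℕ) {t : ℝ} (ht : t ≠ 0) :
    HasDerivAt (expCoeff p q) (-p * expCoeff (p + 1) q t - q * expCoeff (p + 2) q t) t := by
  have h1 := (hasDerivAt_inv ht).fun_pow p
  have h2 := (hasDerivAt_exp_inv ht).fun_pow q
  refine (h1.fun_mul h2).congr_deriv ?_
  have e1 : (p : ℝ) * t⁻¹ ^ (p - 1) * -(t ^ 2)⁻¹ = -p * t⁻¹ ^ (p + 1) := by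
    rcases p with _ | p
    · simp
    · rw [Nat.add_sub_cancel, ← inv_pow]; ring
  have e2 : (q : ℝ) * Real.exp (1 / t) ^ (q - 1) * -expCoeff 2 1 t
      = -q * t⁻¹ ^ 2 * Real.exp (1 / t) ^ q := by
    rcases q with _ | q
    · simp
    · rw [Nat.add_sub_cancel]; simp only [expCoeff]; ring
  rw [e1, e2]
  simp only [expCoeff]; ring

/-- By the exponential series, t^{-(p+2)} ≤ (p+2)! e^{1/t}; the resulting power (e^{1/t})^{q+1} is
absorbed by exp(-ε e^{1/t}). The two extra powers of t give the quadratic vanishing used for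
differentiability at t = 0. -/
theorem expCoeff_mul_exp_le (p q : ℕ) {ε : ℝ} (hε : 0 < ε) : ∃ C, 0 ≤ C ∧ ∀ t, 0 < t →
    expCoeff p q t * Real.exp (-(ε * Real.exp (1 / t))) ≤ C * t ^ 2 := by
  refine ⟨(p + 2).factorial * ((q + 1).factorial / ε ^ (q + 1)), by positivity, fun t ht => ?_⟩
  set a := Real.exp (1 / t) with ha
  have ha0 : 0 < a := Real.exp_pos _
  have h1 : t⁻¹ ^ (p + 2) ≤ (p + 2).factorial * a := by
    have := Real.pow_div_factorial_le_exp (1 / t) (by positivity) (p + 2)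
    rw [div_le_iff₀ (by positivity), one_div] at this
    rw [ha, one_div]; linarith
  have h2 : a ^ (q + 1) * Real.exp (-(ε * a)) ≤ (q + 1).factorial / ε ^ (q + 1) := by
    have := Real.pow_div_factorial_le_exp (ε * a) (by positivity) (q + 1)
    rw [div_le_iff₀ (by positivity), mul_pow] at this
    rw [Real.exp_neg, ← div_eq_mul_inv, div_le_div_iff₀ (Real.exp_pos _) (by positivity)]
    linarith
  have h3 : expCoeff p q t = t⁻¹ ^ (p + 2) * a ^ q * t ^ 2 := by
    have : t⁻¹ ^ (p + 2) * t ^ 2 = t⁻¹ ^ p := by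
      rw [pow_add, mul_assoc, ← mul_pow, inv_mul_cancel₀ ht.ne', one_pow, mul_one]
    rw [expCoeff, ← this]; ring
  rw [h3]
  calc t⁻¹ ^ (p + 2) * a ^ q * t ^ 2 * Real.exp (-(ε * a))
      ≤ ((p + 2).factorial * a) * a ^ q * t ^ 2 * Real.exp (-(ε * a)) := by gcongr
    _ = (p + 2).factorial * (a ^ (q + 1) * Real.exp (-(ε * a))) * t ^ 2 := by ring
    _ ≤ _ := by gcongr

theorem expCoeff_pos (p q : ℕ) {t : ℝ} (ht : 0 < t) : 0 < expCoeff p q t := by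
  unfold expCoeff; positivity

/-! ### The rank-one operators along escaping translates. -/

namespace WeightData

variable (W : WeightData)

/-- The operator `f ↦ t^{-p} e^{q/t} ⟨f, u(· + e^{1/t})⟩ v(· + e^{1/t})` for `t > 0`, and `0` for
`t ≤ 0`, from `L²(ℝ)` to `W^{m,δ_m}`. -/
def transOp (m p q : ℕ) (u v : TestFun) (t : ℝ) : L2 →L[ℝ] W.Sobolev m :=
  if 0 < t then expCoeff p q t • (innerSL ℝ (u.shift (Real.exp (1 / t))).toL2).smulRight
    (W.ofTest m (v.shift (Real.exp (1 / t)))) else 0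

theorem transOp_of_pos (m p q : ℕ) (u v : TestFun) {t : ℝ} (ht : 0 < t) (f : L2) :
    W.transOp m p q u v t f = (expCoeff p q t * inner ℝ f (u.shift (Real.exp (1 / t))).toL2) •
      W.ofTest m (v.shift (Real.exp (1 / t))) := by
  rw [transOp, if_pos ht, smul_apply, ContinuousLinearMap.smulRight_apply,
    innerSL_apply_apply, real_inner_comm, mul_smul]

theorem transOp_of_nonpos (m p q : ℕ) (u v : TestFun) {t : ℝ} (ht : t ≤ 0) :
    W.transOp m p q u v t = 0 := by
  rw [transOp, if_neg ht.not_gt]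

theorem toL2_transOp (m m' p q : ℕ) (u v : TestFun) (t : ℝ) (f : L2) :
    Sobolev.toL2 (W.transOp m p q u v t f) = Sobolev.toL2 (W.transOp m' p q u v t f) := by
  by_cases ht : 0 < t
  · rw [transOp_of_pos _ _ _ _ _ _ ht, transOp_of_pos _ _ _ _ _ _ ht, map_smul, map_smul,
      toL2_ofTest, toL2_ofTest]
  · rw [transOp_of_nonpos _ _ _ _ _ _ (not_lt.1 ht), transOp_of_nonpos _ _ _ _ _ _ (not_lt.1 ht)]
    simp

theorem norm_transOp_le (m b p q : ℕ) (u v : TestFun) : ∃ C, 0 ≤ C ∧ ∀ t, 0 < t →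
    ∀ f : W.Sobolev b, ‖W.transOp m p q u v t (Sobolev.toL2 f)‖
      ≤ C * (expCoeff p q t * Real.exp (-((W.δ b - W.δ m) / 2 * Real.exp (1 / t)))) * ‖f‖ := by
  obtain ⟨A, hA0, hA⟩ := W.norm_ofTest_shift_le m v
  obtain ⟨B, hB0, hB⟩ := W.abs_inner_shift_le b u
  refine ⟨A * B, mul_nonneg hA0 hB0, fun t ht f => ?_⟩
  have ha : 0 ≤ Real.exp (1 / t) := (Real.exp_pos _).le
  set a := Real.exp (1 / t)
  rw [transOp_of_pos _ _ _ _ _ _ ht, norm_smul, norm_mul, Real.norm_eq_abs, Real.norm_eq_abs,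
    abs_of_pos (expCoeff_pos p q ht)]
  have e : Real.exp (-((W.δ b - W.δ m) / 2 * a))
      = Real.exp (-(W.δ b * a / 2)) * Real.exp (W.δ m * a / 2) := by
    rw [← Real.exp_add]; congr 1; ring
  rw [e]
  have hc := (expCoeff_pos p q ht).le
  calc _ ≤ expCoeff p q t * (B * Real.exp (-(W.δ b * a / 2)) * ‖f‖)
        * (A * Real.exp (W.δ m * a / 2)) :=
        mul_le_mul (mul_le_mul_of_nonneg_left (hB a ha f) hc) (hA a ha) (norm_nonneg _)
          (by positivity)
    _ = _ := by ring

/-- As δ_b > δ_m, the growth of v_t does not use up the decay of ⟨f, u_t⟩; the double exponential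
that remains defeats every coefficient t^{-p} e^{q/t}. -/
theorem norm_transOp_le_sq {m b : ℕ} (hb : m < b) (p q : ℕ) (u v : TestFun) : ∃ C, 0 ≤ C ∧
    ∀ t, ∀ f : W.Sobolev b, ‖W.transOp m p q u v t (Sobolev.toL2 f)‖ ≤ C * t ^ 2 * ‖f‖ := by
  obtain ⟨A, hA0, hA⟩ := W.norm_transOp_le m b p q u v
  obtain ⟨B, hB0, hB⟩ := expCoeff_mul_exp_le p q
    (half_pos (sub_pos.2 (W.δ_strictMono hb)))
  refine ⟨A * B, mul_nonneg hA0 hB0, fun t f => ?_⟩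
  by_cases ht : 0 < t
  · refine (hA t ht f).trans (mul_le_mul_of_nonneg_right ?_ (norm_nonneg f))
    rw [mul_assoc]
    exact mul_le_mul_of_nonneg_left (hB t ht) hA0
  · rw [transOp_of_nonpos _ _ _ _ _ _ (not_lt.1 ht)]
    simp only [zero_apply, norm_zero]
    positivity

/-- On a single level growth and decay cancel exactly. This leaves a bound uniform in t when p = q =
0, but no smallness. -/
theorem norm_transOp_zero_le (m : ℕ) (u v : TestFun) : ∃ C, 0 ≤ C ∧
    ∀ t, ∀ f : W.Sobolev m, ‖W.transOp m 0 0 u v t (Sobolev.toL2 f)‖ ≤ C * ‖f‖ := by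
  obtain ⟨A, hA0, hA⟩ := W.norm_transOp_le m m 0 0 u v
  refine ⟨A, hA0, fun t f => ?_⟩
  by_cases ht : 0 < t
  · simpa [expCoeff_zero] using hA t ht f
  · rw [transOp_of_nonpos _ _ _ _ _ _ (not_lt.1 ht)]
    simp only [zero_apply, norm_zero]
    positivity

/-- The derivative of `t ↦ transOp m p q u v t`. -/
def transOpDeriv (m p q : ℕ) (u v : TestFun) (t : ℝ) : L2 →L[ℝ] W.Sobolev m :=
  (-p : ℝ) • W.transOp m (p + 1) q u v t + (-q : ℝ) • W.transOp m (p + 2) q u v t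
    + (-1 : ℝ) • W.transOp m (p + 2) (q + 1) u.deriv v t
    + (-1 : ℝ) • W.transOp m (p + 2) (q + 1) u v.deriv t

theorem transOpDeriv_of_nonpos (m p q : ℕ) (u v : TestFun) {t : ℝ} (ht : t ≤ 0) :
    W.transOpDeriv m p q u v t = 0 := by
  apply ContinuousLinearMap.ext
  intro f
  simp only [transOpDeriv, transOp_of_nonpos _ _ _ _ _ _ ht, add_apply, smul_apply, zero_apply,
    smul_zero, add_zero]

theorem transOpDeriv_of_pos (m p q : ℕ) (u v : TestFun) {t : ℝ} (ht : 0 < t) (f : L2) :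
    W.transOpDeriv m p q u v t f =
      ((-p * expCoeff (p + 1) q t - q * expCoeff (p + 2) q t)
        * inner ℝ f (u.shift (Real.exp (1 / t))).toL2) • W.ofTest m (v.shift (Real.exp (1 / t)))
      - (expCoeff (p + 2) (q + 1) t * inner ℝ f (u.deriv.shift (Real.exp (1 / t))).toL2) •
        W.ofTest m (v.shift (Real.exp (1 / t)))
      - (expCoeff (p + 2) (q + 1) t * inner ℝ f (u.shift (Real.exp (1 / t))).toL2) •
        W.ofTest m (v.deriv.shift (Real.exp (1 / t))) := by
  simp only [transOpDeriv, add_apply, smul_apply,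
    transOp_of_pos _ _ _ _ _ _ ht]
  module

/-- The derivative at `(t, f)` of `(t, f) ↦ transOp m p q u v t f`, composed with `λ`. -/
def transOpFDeriv {X : Type*} [NormedAddCommGroup X] [NormedSpace ℝ X] (m p q : ℕ)
    (u v : TestFun) (t : ℝ) (f : L2) (τ : X →L[ℝ] ℝ) (l : X →L[ℝ] L2) : X →L[ℝ] W.Sobolev m :=
  τ.smulRight (W.transOpDeriv m p q u v t f) + (W.transOp m p q u v t).comp l

/-- Product rule for coefficient, pairing and translate. The coefficient accounts for two terms of
`transOpDeriv`; moving u and moving v account for one each, with the factor -t^{-2} e^{1/t} from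
differentiating the translation length. -/
theorem hasFDerivAt_transOp_of_pos (m p q : ℕ) (u v : TestFun) {t : ℝ} (ht : 0 < t) (f : L2) :
    HasFDerivAt (fun z : ℝ × L2 => W.transOp m p q u v z.1 z.2)
      (W.transOpFDeriv m p q u v t f (ContinuousLinearMap.fst ℝ ℝ L2)
        (ContinuousLinearMap.snd ℝ ℝ L2)) (t, f) := by
  have hfst : HasFDerivAt (fun z : ℝ × L2 => z.1) (ContinuousLinearMap.fst ℝ ℝ L2) (t, f) :=
    hasFDerivAt_fst
  have hsnd : HasFDerivAt (fun z : ℝ × L2 => z.2) (ContinuousLinearMap.snd ℝ ℝ L2) (t, f) :=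
    hasFDerivAt_snd
  have ha := (hasDerivAt_exp_inv ht.ne')
  have hc := (hasDerivAt_expCoeff p q ht.ne').comp_hasFDerivAt (t, f) hfst
  have hu := (((hasDerivAt_toL2_shift u W (Real.exp (1 / t))).scomp t ha).hasFDerivAt).comp
    (t, f) hfst
  have hv := (((W.hasDerivAt_ofTest_shift m v (Real.exp (1 / t))).scomp t ha).hasFDerivAt).comp
    (t, f) hfst
  have hmain := (hc.mul (hsnd.inner ℝ hu)).smul hv
  refine (hmain.congr_of_eventuallyEq ?_).congr_fderiv ?_
  · have : ∀ᶠ z : ℝ × L2 in nhds (t, f), 0 < z.1 :=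
      (continuous_fst.tendsto (t, f)).eventually (lt_mem_nhds ht)
    filter_upwards [this] with z hz
    exact W.transOp_of_pos m p q u v hz z.2
  · ext z
    · simp only [transOpFDeriv, ContinuousLinearMap.comp_apply, add_apply,
        ContinuousLinearMap.smulRight_apply, transOpDeriv_of_pos _ _ _ _ _ _ ht]
      simp [real_inner_smul_right, expCoeff, fderivInnerCLM_apply]
      simp only [pow_succ, pow_zero]
      module
    · simp only [transOpFDeriv, ContinuousLinearMap.comp_apply, add_apply,
        ContinuousLinearMap.smulRight_apply]
      simp [transOp_of_pos _ _ _ _ _ _ ht, fderivInnerCLM_apply]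

/-- The map is a product of differentiable factors for t > 0 and locally zero for t < 0. At t = 0
the bound C t² ‖f‖ makes it quadratically small in the increment, so the derivative is zero; this is
where m < b enters. -/
theorem hasFDerivAt_transOp {m b : ℕ} (hb : m < b) (p q : ℕ) (u v : TestFun) (t : ℝ)
    (f : W.Sobolev b) :
    HasFDerivAt (fun z : ℝ × W.Sobolev b => W.transOp m p q u v z.1 (Sobolev.toL2 z.2))
      (W.transOpFDeriv m p q u v t (Sobolev.toL2 f) (ContinuousLinearMap.fst ℝ ℝ (W.Sobolev b))
        ((Sobolev.toL2L W b).comp (ContinuousLinearMap.snd ℝ ℝ (W.Sobolev b)))) (t, f) := by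
  by_cases ht : 0 < t
  · have h1 : HasFDerivAt (fun z : ℝ × W.Sobolev b => (z.1, Sobolev.toL2L W b z.2))
        ((ContinuousLinearMap.fst ℝ ℝ (W.Sobolev b)).prod
          ((Sobolev.toL2L W b).comp (ContinuousLinearMap.snd ℝ ℝ (W.Sobolev b)))) (t, f) :=
      ((ContinuousLinearMap.fst ℝ ℝ (W.Sobolev b)).prod
          ((Sobolev.toL2L W b).comp (ContinuousLinearMap.snd ℝ ℝ (W.Sobolev b)))).hasFDerivAt
    have h2 := (W.hasFDerivAt_transOp_of_pos m p q u v ht (Sobolev.toL2L W b f)).comp (t, f) h1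
    refine (h2.congr_of_eventuallyEq (Filter.Eventually.of_forall fun z => ?_)).congr_fderiv ?_
    · change _ = W.transOp m p q u v z.1 (Sobolev.toL2L W b z.2)
      rw [Sobolev.toL2L_apply]
    · rw [Sobolev.toL2L_apply]; ext z <;> rfl
  · have ht' := not_lt.1 ht
    have h0 : W.transOpFDeriv m p q u v t (Sobolev.toL2 f)
        (ContinuousLinearMap.fst ℝ ℝ (W.Sobolev b))
        ((Sobolev.toL2L W b).comp (ContinuousLinearMap.snd ℝ ℝ (W.Sobolev b))) = 0 := by
      rw [transOpFDeriv, transOpDeriv_of_nonpos _ _ _ _ _ _ ht',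
        transOp_of_nonpos _ _ _ _ _ _ ht']
      ext z <;> simp
    rw [h0]
    rcases ht'.lt_or_eq with hlt | rfl
    · refine (hasFDerivAt_const (0 : W.Sobolev m) (t, f)).congr_of_eventuallyEq ?_
      have : ∀ᶠ z : ℝ × W.Sobolev b in nhds (t, f), z.1 < 0 :=
        (continuous_fst.tendsto (t, f)).eventually (gt_mem_nhds hlt)
      filter_upwards [this] with z hz
      rw [transOp_of_nonpos _ _ _ _ _ _ hz.le]; rfl
    · obtain ⟨C, hC0, hC⟩ := W.norm_transOp_le_sq hb p q u v
      refine HasFDerivAt.of_isLittleO ?_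
      have h1 : (fun z : ℝ × W.Sobolev b => W.transOp m p q u v z.1 (Sobolev.toL2 z.2)
          - W.transOp m p q u v ((0 : ℝ), f).1 (Sobolev.toL2 ((0 : ℝ), f).2)
          - (0 : ℝ × W.Sobolev b →L[ℝ] W.Sobolev m) (z - (0, f)))
          =O[nhds (0, f)] fun z => ‖z - (0, f)‖ ^ 2 := by
        refine Asymptotics.IsBigO.of_bound (C * (‖f‖ + 1)) ?_
        filter_upwards [Metric.ball_mem_nhds ((0 : ℝ), f) one_pos] with z hz
        rw [transOp_of_nonpos _ _ _ _ _ _ (le_refl (0 : ℝ))]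
        simp only [zero_apply, sub_zero, norm_pow, norm_norm]
        rw [Metric.mem_ball, dist_eq_norm] at hz
        have k1 : |z.1| ≤ ‖z - (0, f)‖ := by
          have := norm_fst_le (z - (0, f))
          simpa using this
        have k2 : ‖z.2‖ ≤ ‖f‖ + 1 := by
          have := norm_snd_le (z - (0, f))
          have h3 : ‖z.2‖ ≤ ‖f‖ + ‖z.2 - f‖ := norm_le_norm_add_norm_sub' _ _
          have h4 : ‖z.2 - f‖ ≤ ‖z - (0, f)‖ := this
          linarith
        have k3 : z.1 ^ 2 ≤ ‖z - (0, f)‖ ^ 2 := by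
          rw [← sq_abs]; exact pow_le_pow_left₀ (abs_nonneg _) k1 2
        calc _ ≤ C * z.1 ^ 2 * ‖z.2‖ := hC z.1 z.2
          _ ≤ C * ‖z - (0, f)‖ ^ 2 * (‖f‖ + 1) := by gcongr
          _ = _ := by ring
      refine h1.trans_isLittleO ?_
      have h2 : Filter.Tendsto (fun z : ℝ × W.Sobolev b => z - (0, f)) (nhds (0, f)) (nhds 0) := by
        have : Continuous fun z : ℝ × W.Sobolev b => z - (0, f) := by fun_prop
        simpa using this.tendsto (0, f)
      exact ((Asymptotics.isLittleO_norm_pow_id one_lt_two).comp_tendsto h2)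

/-- At t = 0 nothing is small in operator norm, and continuity holds only strongly: approximate f by
a test function w, which also lies in W^{m+1}, where the operators are O(t²); the uniform bound
controls the difference. -/
theorem continuous_transOp_self (m : ℕ) (u v : TestFun) :
    Continuous fun z : ℝ × W.Sobolev m => W.transOp m 0 0 u v z.1 (Sobolev.toL2 z.2) := by
  rw [continuous_iff_continuousAt]
  rintro ⟨t, f⟩
  rcases lt_trichotomy t 0 with ht | rfl | ht
  · have : ∀ᶠ z : ℝ × W.Sobolev m in nhds (t, f), z.1 < 0 :=
      (continuous_fst.tendsto (t, f)).eventually (gt_mem_nhds ht)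
    refine (continuousAt_const (y := (0 : W.Sobolev m))).congr ?_
    filter_upwards [this] with z hz
    rw [transOp_of_nonpos _ _ _ _ _ _ hz.le]; rfl
  · obtain ⟨A, hA0, hA⟩ := W.norm_transOp_zero_le m u v
    obtain ⟨B, hB0, hB⟩ := W.norm_transOp_le_sq (Nat.lt_succ_self m) 0 0 u v
    rw [ContinuousAt, transOp_of_nonpos _ _ _ _ _ _ (le_refl (0 : ℝ)), zero_apply,
      Metric.tendsto_nhds]
    intro ε hε
    -- Two errors of this size, multiplied by the bound A, stay below ε/2; A + 1 avoids a division
    -- by zero.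
    obtain ⟨w, hw⟩ := (W.denseRange_ofTest m).exists_dist_lt f
      (show 0 < ε / (4 * (A + 1)) by positivity)
    rw [dist_eq_norm] at hw
    have h1 : ∀ᶠ z : ℝ × W.Sobolev m in nhds ((0 : ℝ), f),
        ‖z.2 - f‖ < ε / (4 * (A + 1)) := by
      have : Continuous fun z : ℝ × W.Sobolev m => ‖z.2 - f‖ := by fun_prop
      refine (this.tendsto ((0 : ℝ), f)).eventually (gt_mem_nhds ?_)
      simp only [sub_self, norm_zero]; positivity
    have h2 : ∀ᶠ z : ℝ × W.Sobolev m in nhds ((0 : ℝ), f),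
        B * z.1 ^ 2 * ‖W.ofTest (m + 1) w‖ < ε / 2 := by
      have : Continuous fun z : ℝ × W.Sobolev m => B * z.1 ^ 2 * ‖W.ofTest (m + 1) w‖ := by
        fun_prop
      refine (this.tendsto ((0 : ℝ), f)).eventually (gt_mem_nhds ?_)
      simp; positivity
    filter_upwards [h1, h2] with z hz1 hz2
    rw [dist_zero_right]
    have e : W.transOp m 0 0 u v z.1 (Sobolev.toL2 z.2)
        = W.transOp m 0 0 u v z.1 (Sobolev.toL2 (z.2 - W.ofTest m w))
          + W.transOp m 0 0 u v z.1 (Sobolev.toL2 (W.ofTest (m + 1) w)) := by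
      rw [← map_add]; congr 1
      rw [map_sub]; simp
    have k1 : ‖z.2 - W.ofTest m w‖ ≤ ε / (2 * (A + 1)) := by
      have h3 : ‖z.2 - W.ofTest m w‖ ≤ ‖z.2 - f‖ + ‖f - W.ofTest m w‖ := by
        have := norm_add_le (z.2 - f) (f - W.ofTest m w)
        rwa [sub_add_sub_cancel] at this
      have h4 : ε / (4 * (A + 1)) + ε / (4 * (A + 1)) = ε / (2 * (A + 1)) := by
        field_simp; ring
      linarith
    have k2 : A * ‖z.2 - W.ofTest m w‖ ≤ ε / 2 := by
      refine (mul_le_mul_of_nonneg_left k1 hA0).trans ?_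
      rw [mul_div_assoc', div_le_div_iff₀ (by positivity) (by positivity)]
      nlinarith
    rw [e]
    calc _ ≤ ‖W.transOp m 0 0 u v z.1 (Sobolev.toL2 (z.2 - W.ofTest m w))‖
          + ‖W.transOp m 0 0 u v z.1 (Sobolev.toL2 (W.ofTest (m + 1) w))‖ := norm_add_le _ _
      _ ≤ A * ‖z.2 - W.ofTest m w‖ + B * z.1 ^ 2 * ‖W.ofTest (m + 1) w‖ :=
          add_le_add (hA _ _) (hB _ _)
      _ < ε := by linarith
  · have h1 : Continuous fun z : ℝ × W.Sobolev m => (z.1, Sobolev.toL2L W m z.2) := by fun_prop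
    have h2 : ContinuousAt (fun z : ℝ × L2 => W.transOp m 0 0 u v z.1 z.2)
        ((fun z : ℝ × W.Sobolev m => (z.1, Sobolev.toL2L W m z.2)) (t, f)) :=
      (W.hasFDerivAt_transOp_of_pos m 0 0 u v ht _).continuousAt
    have h3 := ContinuousAt.comp (x := (t, f)) (f := fun z : ℝ × W.Sobolev m =>
      (z.1, Sobolev.toL2L W m z.2)) h2 h1.continuousAt
    refine h3.congr (Filter.Eventually.of_forall fun z => ?_)
    change W.transOp m 0 0 u v z.1 (Sobolev.toL2L W m z.2) = _
    rw [Sobolev.toL2L_apply]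

theorem continuous_transOp {m b p q : ℕ} (hb : m ≤ b) (hpq : b = m → p = 0 ∧ q = 0)
    (u v : TestFun) :
    Continuous fun z : ℝ × W.Sobolev b => W.transOp m p q u v z.1 (Sobolev.toL2 z.2) := by
  rcases hb.lt_or_eq with h | rfl
  · exact continuous_iff_continuousAt.2 fun z =>
      (W.hasFDerivAt_transOp h p q u v z.1 z.2).continuousAt
  · obtain ⟨rfl, rfl⟩ := hpq rfl
    exact W.continuous_transOp_self m u v

end WeightData

/-! ## The class of maps generated by the operators `transOp` -/

namespace WeightData

variable (W : WeightData)

/-- The scale `E^i` with levels `W^{i+m,δ_{i+m}}`. -/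
def shiftScale (i : ℕ) : ScScale where
  level m := W.Sobolev (i + m)
  incl m := Sobolev.incl W (i + m)
  incl_injective m := W.sobolevScale.incl_injective (i + m)

variable {W}

theorem toL2_incl (m : ℕ) (x : W.Sobolev (m + 1)) :
    Sobolev.toL2 (Sobolev.incl W m x) = Sobolev.toL2 x := rfl

theorem toL2_shiftScale_emb (i m : ℕ) (x : W.Sobolev (i + m)) :
    Sobolev.toL2 (m := i + 0) ((W.shiftScale i).emb m x) = Sobolev.toL2 x := by
  induction m with
  | zero => rfl
  | succ m ih => exact ih (Sobolev.incl W (i + m) x)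

theorem exists_inclusion {a b : ℕ} (h : b ≤ a) :
    ∃ L : W.Sobolev a →L[ℝ] W.Sobolev b, ∀ x, Sobolev.toL2 (L x) = Sobolev.toL2 x := by
  induction h with
  | refl => exact ⟨ContinuousLinearMap.id ℝ _, fun x => rfl⟩
  | step _ ih =>
    obtain ⟨L, hL⟩ := ih
    exact ⟨L.comp (Sobolev.incl W _), fun x => hL _⟩

variable (W) in
/-- The inclusion `W^{a,δ_a} ⊆ W^{b,δ_b}` for `b ≤ a`. -/
def inclusion {a b : ℕ} (h : b ≤ a) : W.Sobolev a →L[ℝ] W.Sobolev b :=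
  (exists_inclusion h).choose

theorem toL2_inclusion {a b : ℕ} (h : b ≤ a) (x : W.Sobolev a) :
    Sobolev.toL2 (W.inclusion h x) = Sobolev.toL2 x :=
  (exists_inclusion h).choose_spec x

variable (W) in
/-- The operator `E^{i+1} → T(E^i)`, `y ↦ (y, 0)`. -/
def horiz (i : ℕ) : ScLin (W.shiftScale (i + 1)) (W.shiftScale i).tangent where
  map m := (ContinuousLinearMap.inl ℝ (W.Sobolev (i + (m + 1))) (W.Sobolev (i + m))).comp
    (W.inclusion (show i + (m + 1) ≤ i + 1 + m by omega))
  comm m x := by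
    refine Prod.ext (Sobolev.toL2_injective (m := i + (m + 1)) ?_)
      (map_zero (Sobolev.incl W (i + m)))
    change Sobolev.toL2 (Sobolev.incl W (i + (m + 1)) (W.inclusion _ x))
      = Sobolev.toL2 (W.inclusion _ (Sobolev.incl W (i + 1 + m) x))
    let x' : W.Sobolev (i + 1 + (m + 1)) := x
    exact (toL2_incl _ (W.inclusion (show i + (m + 1 + 1) ≤ i + 1 + (m + 1) by omega) x')).trans
      ((toL2_inclusion _ x').trans ((toL2_inclusion (show i + (m + 1) ≤ i + 1 + m by omega)
        (Sobolev.incl W (i + 1 + m) x')).trans (toL2_incl _ x')).symm)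

/-- An operator `E → E^j` on base points, as an operator `TE → E^{j+1}`. -/
def baseLift {E : ScScale} {j : ℕ} (l : ScLin E (W.shiftScale j)) :
    ScLin E.tangent (W.shiftScale (j + 1)) where
  map m := (W.inclusion (show j + 1 + m ≤ j + (m + 1) by omega)).comp
    ((show E.level (m + 1) →L[ℝ] W.Sobolev (j + (m + 1)) from l.map (m + 1)).comp
      (ContinuousLinearMap.fst ℝ (E.level (m + 1)) (E.level m)))
  comm m x := by
    apply Sobolev.toL2_injective (m := j + 1 + m)
    change Sobolev.toL2 (Sobolev.incl W (j + 1 + m) (W.inclusion _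
        (show W.Sobolev (j + (m + 1 + 1)) from l.map (m + 1 + 1) x.1)))
      = Sobolev.toL2 (W.inclusion _
        (show W.Sobolev (j + (m + 1)) from l.map (m + 1) (E.incl (m + 1) x.1)))
    rw [toL2_incl, toL2_inclusion, toL2_inclusion, ← l.comm (m + 1) x.1]
    rfl

variable (W) in
/-- The map `x ↦ t^{-p} e^{q/t} ⟨f, u(· + e^{1/t})⟩ v(· + e^{1/t})` with `t = τ(x)`, `f = λ(x)`. -/
def transMap {E : ScScale} (i p q : ℕ) (u v : TestFun) (τ : ScLin E (ScScale.const ℝ)) {j : ℕ}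
    (l : ScLin E (W.shiftScale j)) (x : E.level 0) : (W.shiftScale i).level 0 :=
  W.transOp (i + 0) p q u v (τ.map 0 x) (Sobolev.toL2 (show W.Sobolev (j + 0) from l.map 0 x))

variable (W) in
/-- The generating maps. A loss of regularity compensates for the growing coefficient. -/
inductive IsTransMap : ∀ E F : ScScale, (E.level 0 → F.level 0) → Prop
  | mk {E : ScScale} (i j p q : ℕ) (hij : i ≤ j) (hpq : j = i → p = 0 ∧ q = 0) (u v : TestFun)
      (τ : ScLin E (ScScale.const ℝ)) (l : ScLin E (W.shiftScale j)) :
      IsTransMap E (W.shiftScale i) (W.transMap i p q u v τ l)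

/-- The tangent map of `transMap`. -/
def transTangent {E : ScScale} (i p q : ℕ) (u v : TestFun) (τ : ScLin E (ScScale.const ℝ)) {j : ℕ}
    (l : ScLin E (W.shiftScale j)) (w : E.tangent.level 0) : (W.shiftScale i).tangent.level 0 :=
  let τ' := τ.comp (ScLin.base E)
  (W.horiz i).map 0 (W.transMap (i + 1) p q u v τ' (baseLift l) w) +
  (ScLin.vert _).map 0 (W.transMap i p q u v τ' (l.comp (ScLin.vec E)) w) +
  (show ℝ from (τ.comp (ScLin.vec E)).map 0 w) • (ScLin.vert _).map 0
    ((-p : ℝ) • W.transMap i (p + 1) q u v τ' (baseLift l) w +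
      (-q : ℝ) • W.transMap i (p + 2) q u v τ' (baseLift l) w +
      (-1 : ℝ) • W.transMap i (p + 2) (q + 1) u.deriv v τ' (baseLift l) w +
      (-1 : ℝ) • W.transMap i (p + 2) (q + 1) u v.deriv τ' (baseLift l) w)

/-- The base point of a tangent vector lies one level higher, so the t-derivative terms lead from
E^{j+1} to E^i with i < j + 1 and may carry any p and q. The remaining two terms keep p, q and the
gap j - i, hence also the borderline condition. -/
theorem scGen_transTangent {E : ScScale} {i j p q : ℕ} (hij : i ≤ j)
    (hpq : j = i → p = 0 ∧ q = 0) (u v : TestFun)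
    (τ : ScLin E (ScScale.const ℝ)) (l : ScLin E (W.shiftScale j)) :
    ScGen W.IsTransMap E.tangent (W.shiftScale i).tangent (transTangent i p q u v τ l) := by
  have h : ∀ p q u v, ScGen W.IsTransMap E.tangent (W.shiftScale i)
      (W.transMap i p q u v (τ.comp (ScLin.base E)) (baseLift l)) := fun p q u v =>
    .gen (.mk i (j + 1) p q (by omega) (by omega) u v _ _)
  refine (ScGen.add (ScGen.postcomp _ (.gen ?_)) (ScGen.postcomp _ (.gen ?_))).add
    (ScGen.smul _ (ScGen.postcomp _ ?_))
  · exact .mk (i + 1) (j + 1) p q (by omega) (by omega) u v _ _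
  · exact .mk i j p q hij hpq u v _ _
  · exact ((((h _ _ _ _).const_smul _).add ((h _ _ _ _).const_smul _)).add
      ((h _ _ _ _).const_smul _)).add ((h _ _ _ _).const_smul _)

theorem toL2_baseLift {E : ScScale} {j : ℕ} (l : ScLin E (W.shiftScale j))
    (w : E.level 1 × E.level 0) :
    Sobolev.toL2 (show W.Sobolev (j + 1 + 0) from (baseLift l).map 0 w)
      = Sobolev.toL2 (show W.Sobolev (j + 0) from l.map 0 (E.incl 0 w.1)) := by
  change Sobolev.toL2 (W.inclusion _ (show W.Sobolev (j + (0 + 1)) from l.map 1 w.1)) = _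
  rw [toL2_inclusion, ← l.comm 0 w.1]; rfl

/-- The sc-derivative is a Fréchet derivative along E₁, where λ(x) lies in W^{j+1}, so
`hasFDerivAt_transOp` applies even if i = j. The derivative extends to E₀ because the operators are
defined on all of L²(ℝ). -/
theorem hasScTangent_transMap {E : ScScale} {i j p q : ℕ} (hij : i ≤ j)
    (hpq : j = i → p = 0 ∧ q = 0) (u v : TestFun)
    (τ : ScLin E (ScScale.const ℝ)) (l : ScLin E (W.shiftScale j)) :
    HasScTangent (W.transMap i p q u v τ l) (transTangent i p q u v τ l) := by
  refine ⟨fun m => ?_, fun w => ?_, fun x => ?_⟩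
  · have hc := W.continuous_transOp (m := i + m) (b := j + m) (p := p) (q := q) (by omega)
      (fun h => hpq (by omega)) u v
    have hl : Continuous fun x : E.level m => ((show ℝ from τ.map m x),
        (show W.Sobolev (j + m) from l.map m x)) :=
      Continuous.prodMk (τ.map m).continuous (l.map m).continuous
    refine ⟨_, hc.comp hl, fun x => ?_⟩
    apply Sobolev.toL2_injective (m := i + 0)
    rw [toL2_shiftScale_emb]
    change Sobolev.toL2 (W.transOp (i + m) p q u v (τ.map m x)
        (Sobolev.toL2 (show W.Sobolev (j + m) from l.map m x)))
      = Sobolev.toL2 (W.transOp (i + 0) p q u v (τ.map 0 (E.emb m x))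
        (Sobolev.toL2 (show W.Sobolev (j + 0) from l.map 0 (E.emb m x))))
    have e1 : (show ℝ from τ.map 0 (E.emb m x)) = τ.map m x := by
      rw [← τ.emb_map m x]; exact ScScale.emb_const ℝ m _
    have e2 : Sobolev.toL2 (show W.Sobolev (j + 0) from l.map 0 (E.emb m x))
        = Sobolev.toL2 (show W.Sobolev (j + m) from l.map m x) := by
      rw [← l.emb_map m x]; exact toL2_shiftScale_emb j m _
    rw [e2, ← e1]
    exact toL2_transOp _ _ _ _ _ _ _ _ _
  · apply Sobolev.toL2_injective (m := i + 0)
    have e : ∀ (A : W.Sobolev (i + 0 + 1)) (c : ℝ), A + 0 + c • 0 = A := fun A c => by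
      simp
    refine (congrArg (fun z => Sobolev.toL2 (Sobolev.incl W (i + 0) z)) (e _ _)).trans ?_
    let t : ℝ := τ.map 0 (E.incl 0 w.1)
    let g : L2 := Sobolev.toL2 (show W.Sobolev (j + 1 + 0) from (baseLift l).map 0 w)
    refine (toL2_inclusion (show i + (0 + 1) ≤ i + 1 + 0 by omega)
      (W.transOp (i + 1 + 0) p q u v t g)).trans ?_
    refine (W.toL2_transOp (i + 1 + 0) (i + 0) p q u v t g).trans ?_
    exact congrArg (fun f => Sobolev.toL2 (W.transOp (i + 0) p q u v t f)) (toL2_baseLift l w)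
  · let t : ℝ := τ.map 0 (E.incl 0 x)
    let f : L2 := Sobolev.toL2 (show W.Sobolev (j + 0) from l.map 0 (E.incl 0 x))
    let τ0 : E.level 0 →L[ℝ] ℝ := τ.map 0
    let l0 : E.level 0 →L[ℝ] W.Sobolev (j + 0) := l.map 0
    let l1 : E.level 1 →L[ℝ] W.Sobolev (j + 1) := l.map 1
    refine ⟨W.transOpFDeriv (i + 0) p q u v t f τ0 ((Sobolev.toL2L W (j + 0)).comp l0),
      ?_, fun h => ?_⟩
    · have h1 : HasFDerivAt (fun y : E.level 1 => (τ0 (E.incl 0 y), l1 y))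
          ((τ0.comp (E.incl 0)).prod l1) x := ((τ0.comp (E.incl 0)).prod l1).hasFDerivAt
      have h2 := (W.hasFDerivAt_transOp (m := i + 0) (b := j + 1) (by omega) p q u v
        (τ0 (E.incl 0 x)) (l1 x)).comp x h1
      have e : ∀ y, Sobolev.toL2 (l1 y) = Sobolev.toL2 (l0 (E.incl 0 y)) := fun y =>
        congrArg (fun z : W.Sobolev (j + 0) => Sobolev.toL2 z) (l.comm 0 y)
      refine (h2.congr_of_eventuallyEq (Filter.Eventually.of_forall fun y => ?_)).congr_fderiv ?_
      · change W.transOp (i + 0) p q u v (τ0 (E.incl 0 y)) (Sobolev.toL2 (l0 (E.incl 0 y)))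
          = W.transOp (i + 0) p q u v (τ0 (E.incl 0 y)) (Sobolev.toL2 (l1 y))
        rw [e]
      · rw [e]
        apply ContinuousLinearMap.ext
        intro y
        change τ0 (E.incl 0 y) • W.transOpDeriv (i + 0) p q u v t f
            + W.transOp (i + 0) p q u v t (Sobolev.toL2L W (j + 1) (l1 y))
          = τ0 (E.incl 0 y) • W.transOpDeriv (i + 0) p q u v t f
            + W.transOp (i + 0) p q u v t (Sobolev.toL2L W (j + 0) (l0 (E.incl 0 y)))
        rw [Sobolev.toL2L_apply, Sobolev.toL2L_apply, e]
    · have hb : Sobolev.toL2 (show W.Sobolev (j + 1 + 0) from (baseLift l).map 0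
          ((x, h) : E.level 1 × E.level 0)) = f := toL2_baseLift l (x, h)
      let g : L2 := Sobolev.toL2 (show W.Sobolev (j + 1 + 0) from (baseLift l).map 0
          ((x, h) : E.level 1 × E.level 0))
      change 0 + W.transOp (i + 0) p q u v t (Sobolev.toL2 (l0 h)) + τ0 h •
          ((-p : ℝ) • W.transOp (i + 0) (p + 1) q u v t g
            + (-q : ℝ) • W.transOp (i + 0) (p + 2) q u v t g
            + (-1 : ℝ) • W.transOp (i + 0) (p + 2) (q + 1) u.deriv v t g
            + (-1 : ℝ) • W.transOp (i + 0) (p + 2) (q + 1) u v.deriv t g)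
        = τ0 h • W.transOpDeriv (i + 0) p q u v t f
          + W.transOp (i + 0) p q u v t (Sobolev.toL2L W (j + 0) (l0 h))
      rw [show g = f from hb, Sobolev.toL2L_apply]
      exact (congrArg (fun z => z + _) (zero_add _)).trans (add_comm _ _)

theorem scSmooth_of_scGen {E F : ScScale} {f : E.level 0 → F.level 0} (hE : E.DenseIncl)
    (hf : ScGen W.IsTransMap E F f) : ScSmooth f := by
  refine ScGen.scSmooth ?_ hE hf
  rintro _ _ _ ⟨i, j, p, q, hij, hpq, u, v, τ, l⟩
  exact ⟨_, hasScTangent_transMap hij hpq u v τ l, scGen_transTangent hij hpq u v τ l⟩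

end WeightData

/-! ## The quarter turn -/

/-- `quarterTurn` as a linear map. -/
def quarterTurnL (N : ℕ) : (Fin N → ℝ) →ₗ[ℝ] (Fin N → ℝ) where
  toFun := quarterTurn
  map_add' a b := by
    funext i
    simp only [quarterTurn, Pi.add_apply]
    split_ifs <;> ring
  map_smul' c a := by
    funext i
    simp only [quarterTurn, Pi.smul_apply, smul_eq_mul, RingHom.id_apply]
    split_ifs <;> ring

theorem quarterTurn_quarterTurn {N : ℕ} (hN : Even N) (a : Fin N → ℝ) :
    quarterTurn (quarterTurn a) = -a := by
  funext i
  obtain ⟨i, hi⟩ := i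
  by_cases h : Even i
  · have h1 : i + 1 < N := by
      rcases hN with ⟨M, rfl⟩
      rcases h with ⟨l, rfl⟩
      omega
    have h2 : ¬ Even (i + 1) := by rw [Nat.even_add_one]; simpa using h
    simp [quarterTurn, h, h1, h2]
  · have h0 : i ≠ 0 := by rintro rfl; exact h (by simp)
    have h1 : Even (i - 1) := by
      rcases Nat.not_even_iff_odd.1 h with ⟨l, rfl⟩
      simp
    have h2 : i - 1 + 1 = i := by omega
    simp [quarterTurn, h, h1, h2, hi]

/-- In matrix form the turned frame expansion becomes a linear combination of generating maps ⟨·,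
γ_{i,t}⟩ γ_{j,t}. -/
theorem quarterTurn_eq_sum {N : ℕ} (a : Fin N → ℝ) (j : Fin N) :
    quarterTurn a j = ∑ i, quarterTurn (fun l => if i = l then 1 else 0) j * a i := by
  have := congrFun (LinearMap.pi_apply_eq_sum_univ (quarterTurnL N) a) j
  rw [Finset.sum_apply] at this
  refine Eq.trans this (Finset.sum_congr rfl fun i _ => ?_)
  rw [Pi.smul_apply, smul_eq_mul, mul_comm]; rfl

namespace BumpData

variable {k : ℕ} (B : BumpData k)

/-! ## The moving frame `γ_{1,t}, …, γ_{k,t}` -/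

/-- The function `γ_j` as a test function. -/
def test (j : Fin k) : TestFun := ⟨B.γ j, B.smooth j, B.compact j⟩

theorem shifted_eq (j : Fin k) (t : ℝ) :
    B.shifted j t = ((B.test j).shift (Real.exp (1 / t))).toL2 := rfl

theorem rho_of_nonpos (j : Fin k) {t : ℝ} (ht : t ≤ 0) : B.rho j t = 0 := dif_neg ht.not_gt

theorem rho_of_pos (j : Fin k) {t : ℝ} (ht : 0 < t) :
    B.rho j t = (-expCoeff 2 1 t) • ((B.test j).deriv.shift (Real.exp (1 / t))).toL2 := by
  rw [rho, dif_pos ht]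
  apply Lp.ext
  filter_upwards [(B.memLp_rho j ht).coeFn_toLp, Lp.coeFn_smul (-expCoeff 2 1 t)
    ((B.test j).deriv.shift (Real.exp (1 / t))).toL2,
    ((B.test j).deriv.shift (Real.exp (1 / t))).coeFn_toL2] with s h1 h2 h3
  rw [h1, h2, Pi.smul_apply, h3]
  have h := ((B.test j).hasDerivAt (s + Real.exp (1 / t))).comp t
    ((hasDerivAt_exp_inv ht.ne').const_add s)
  refine Eq.trans h.deriv ?_
  rw [smul_eq_mul, mul_comm]; rfl

theorem inner_shift (i j : Fin k) (a : ℝ) :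
    inner ℝ ((B.test i).shift a).toL2 ((B.test j).shift a).toL2 = if i = j then 1 else 0 := by
  rw [← TestFun.integral_mul, ← B.orthonormal i j,
    ← integral_add_right_eq_self (fun s => B.γ i s * B.γ j s) a]
  apply integral_congr_ae
  filter_upwards [((B.test i).shift a).coeFn_toL2] with s hs
  rw [hs]; rfl

theorem inner_shifted (i j : Fin k) (t : ℝ) :
    inner ℝ (B.shifted i t) (B.shifted j t) = if i = j then 1 else 0 :=
  B.inner_shift i j _

/-- Translation is isometric on L²(ℝ), so the Gram matrix is constant in a; differentiate it. -/
theorem inner_shift_deriv (W : WeightData) (i j : Fin k) (a : ℝ) :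
    inner ℝ ((B.test i).shift a).toL2 ((B.test j).deriv.shift a).toL2
      + inner ℝ ((B.test i).deriv.shift a).toL2 ((B.test j).shift a).toL2 = 0 := by
  have h := (WeightData.hasDerivAt_toL2_shift (B.test i) W a).inner ℝ
    (WeightData.hasDerivAt_toL2_shift (B.test j) W a)
  have h' : HasDerivAt (fun a => inner ℝ ((B.test i).shift a).toL2 ((B.test j).shift a).toL2) 0 a :=
    by
    simp only [B.inner_shift]
    exact hasDerivAt_const a _
  exact h.unique h'

/-- The derivative of the orthonormality relations. -/
theorem inner_rho_add (W : WeightData) (i j : Fin k) {t : ℝ} (ht : 0 < t) :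
    inner ℝ (B.rho i t) (B.shifted j t) + inner ℝ (B.shifted i t) (B.rho j t) = 0 := by
  have h := B.inner_shift_deriv W i j (Real.exp (1 / t))
  rw [B.rho_of_pos i ht, B.rho_of_pos j ht, real_inner_smul_left, real_inner_smul_right,
    shifted_eq, shifted_eq, ← mul_add, add_comm, h, mul_zero]

theorem sum_inner_shifted (b : Fin k → ℝ) (t : ℝ) (i : Fin k) :
    inner ℝ (∑ j, b j • B.shifted j t) (B.shifted i t) = b i := by
  simp [sum_inner, real_inner_smul_left, B.inner_shifted]

theorem proj_of_pos {t : ℝ} (ht : 0 < t) (f : L2) :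
    B.proj t f = ∑ j, inner ℝ f (B.shifted j t) • B.shifted j t := if_pos ht

theorem proj_of_nonpos {t : ℝ} (ht : t ≤ 0) (f : L2) : B.proj t f = 0 := if_neg ht.not_gt

theorem inner_proj {t : ℝ} (ht : 0 < t) (f : L2) (i : Fin k) :
    inner ℝ (B.proj t f) (B.shifted i t) = inner ℝ f (B.shifted i t) := by
  rw [B.proj_of_pos ht, B.sum_inner_shifted (fun j => inner ℝ f (B.shifted j t))]

theorem proj_proj (t : ℝ) (f : L2) : B.proj t (B.proj t f) = B.proj t f := by
  by_cases ht : 0 < t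
  · rw [B.proj_of_pos ht (B.proj t f)]
    simp only [B.inner_proj ht]
    exact (B.proj_of_pos ht f).symm
  · rw [B.proj_of_nonpos (not_lt.1 ht), B.proj_of_nonpos (not_lt.1 ht)]

theorem xi_of_nonpos {t : ℝ} (ht : t ≤ 0) (f : L2) : B.xi t f = 0 := by
  simp [xi, B.rho_of_nonpos _ ht]

theorem xi_proj (t : ℝ) (f : L2) : B.xi t (B.proj t f) = B.xi t f := by
  by_cases ht : 0 < t
  · simp only [xi, B.inner_proj ht]
  · rw [B.xi_of_nonpos (not_lt.1 ht), B.xi_of_nonpos (not_lt.1 ht)]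

/-- Expanding f in the frame reduces this to the differentiated orthonormality relations. It is the
cancellation by which `coeff` recovers b from a tangent vector, whatever its component along ξ_t. -/
theorem inner_xi_add (W : WeightData) {t : ℝ} (ht : 0 < t) {f : L2} (hf : B.proj t f = f)
    (i : Fin k) : inner ℝ (B.xi t f) (B.shifted i t) + inner ℝ f (B.rho i t) = 0 := by
  have e : inner ℝ f (B.rho i t)
      = ∑ j, inner ℝ f (B.shifted j t) * inner ℝ (B.shifted j t) (B.rho i t) := by
    conv_lhs => rw [← hf, B.proj_of_pos ht, sum_inner]
    simp only [real_inner_smul_left]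
  rw [e, xi, sum_inner, ← Finset.sum_add_distrib]
  refine Finset.sum_eq_zero fun j _ => ?_
  rw [real_inner_smul_left, ← mul_add, B.inner_rho_add W j i ht, mul_zero]

/-- The `L²`-part of the vector tangent to `Γ_n^k` with the coordinates `δt` and `b`. -/
def tangentL2 (t : ℝ) (f : L2) (τ : ℝ) (b : Fin k → ℝ) : L2 :=
  if 0 < t then ∑ j, b j • B.shifted j t + τ • B.xi t f else 0

theorem tangentL2_of_pos {t : ℝ} (ht : 0 < t) (f : L2) (τ : ℝ) (b : Fin k → ℝ) :
    B.tangentL2 t f τ b = ∑ j, b j • B.shifted j t + τ • B.xi t f := if_pos ht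

theorem tangentL2_of_nonpos {t : ℝ} (ht : t ≤ 0) (f : L2) (τ : ℝ) (b : Fin k → ℝ) :
    B.tangentL2 t f τ b = 0 := if_neg ht.not_gt

/-- The coefficients `⟨h, γ_{j,t}⟩ + δt ⟨f, ρ_{j,t}⟩`. -/
def coeff (t : ℝ) (f : L2) (τ : ℝ) (h : L2) (j : Fin k) : ℝ :=
  inner ℝ h (B.shifted j t) + τ * inner ℝ f (B.rho j t)

theorem tangentL2_proj (t : ℝ) (f : L2) (τ : ℝ) (b : Fin k → ℝ) :
    B.tangentL2 t (B.proj t f) τ b = B.tangentL2 t f τ b := by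
  simp only [tangentL2, xi_proj]

theorem coeff_tangentL2 (W : WeightData) {t : ℝ} (ht : 0 < t) {f : L2} (hf : B.proj t f = f)
    (τ : ℝ) (b : Fin k → ℝ) : B.coeff t f τ (B.tangentL2 t f τ b) = b := by
  funext i
  rw [coeff, B.tangentL2_of_pos ht, inner_add_left, B.sum_inner_shifted, real_inner_smul_left,
    add_assoc, ← mul_add, B.inner_xi_add W ht hf, mul_zero, add_zero]

/-- The coefficients depend on the tangent vector only, and the map `b ↦ T b` of coefficients can be
applied to them. -/
theorem tangentL2_coeff_tangentL2 (W : WeightData) (T : (Fin k → ℝ) → Fin k → ℝ) {t : ℝ} {f : L2}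
    (hf : B.proj t f = f) (τ σ : ℝ) (b : Fin k → ℝ) :
    B.tangentL2 t f σ (T (B.coeff t f τ (B.tangentL2 t f τ b))) = B.tangentL2 t f σ (T b) := by
  -- For t ≤ 0 the coefficients cannot be recovered, but `tangentL2` then vanishes for every choice
  -- of them.
  by_cases ht : 0 < t
  · rw [B.coeff_tangentL2 W ht hf]
  · rw [B.tangentL2_of_nonpos (not_lt.1 ht), B.tangentL2_of_nonpos (not_lt.1 ht)]

end BumpData

/-! ## The retraction and its tangent map -/

namespace WeightData

variable {W : WeightData} {n : ℕ}

theorem toL2_ofL2 (f : L2) : Sobolev.toL2 (W.ofL2 f) = f := rfl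

variable (W n)

/-- The projection of `ℝⁿ ⊕ ℝ ⊕ L²(ℝ)` to `t`. -/
def timeL : ScLin (W.ambient n) (ScScale.const ℝ) :=
  (ScLin.fst _ _).comp (ScLin.snd _ _)

/-- The projection of `ℝⁿ ⊕ ℝ ⊕ L²(ℝ)` to `f`. -/
def funL : ScLin (W.ambient n) (W.shiftScale 0) where
  map m := (W.inclusion (show 0 + m ≤ m by omega)).comp
    ((ContinuousLinearMap.snd ℝ ℝ (W.Sobolev m)).comp
      (ContinuousLinearMap.snd ℝ (EuclideanSpace ℝ (Fin n)) (ℝ × W.Sobolev m)))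
  comm m x := Sobolev.toL2_injective (m := 0 + m)
    ((toL2_inclusion (show 0 + (m + 1) ≤ m + 1 by omega) x.2.2).trans
      (toL2_inclusion (show 0 + m ≤ m by omega) (Sobolev.incl W m x.2.2)).symm)

/-- The inclusion of `L²(ℝ)` into `ℝⁿ ⊕ ℝ ⊕ L²(ℝ)`. -/
def funInclL : ScLin (W.shiftScale 0) (W.ambient n) where
  map m := (ContinuousLinearMap.inr ℝ (EuclideanSpace ℝ (Fin n)) (ℝ × W.Sobolev m)).comp
    ((ContinuousLinearMap.inr ℝ ℝ (W.Sobolev m)).comp (W.inclusion (show m ≤ 0 + m by omega)))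
  comm m x := Prod.ext rfl (Prod.ext rfl (Sobolev.toL2_injective (m := m)
    ((toL2_inclusion (show m + 1 ≤ 0 + (m + 1) by omega) x).trans
      (toL2_inclusion (show m ≤ 0 + m by omega) (Sobolev.incl W (0 + m) x)).symm)))

variable {n}

/-- The operator `(a, f) ↦ (A a, 0)` on `ℝⁿ ⊕ ℝ ⊕ L²(ℝ)`. -/
def flatL (A : EuclideanSpace ℝ (Fin n) × ℝ →L[ℝ] EuclideanSpace ℝ (Fin n) × ℝ) :
    ScLin (W.ambient n) (W.ambient n) where
  map m :=
    let p : EuclideanSpace ℝ (Fin n) × ℝ × W.Sobolev m →L[ℝ] EuclideanSpace ℝ (Fin n) × ℝ :=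
      (ContinuousLinearMap.fst ℝ _ _).prod
        ((ContinuousLinearMap.fst ℝ _ _).comp (ContinuousLinearMap.snd ℝ _ _))
    ((ContinuousLinearMap.fst ℝ _ _).comp (A.comp p)).prod
      (((ContinuousLinearMap.snd ℝ _ _).comp (A.comp p)).prod 0)
  comm m _ := Prod.ext rfl (Prod.ext rfl (map_zero (Sobolev.incl W m)))

variable {W}

/-- The function `transMap` on a scale, as a map into `ℝⁿ ⊕ ℝ ⊕ L²(ℝ)`. -/
theorem funInclL_transMap {E : ScScale} (p q : ℕ) (u v : TestFun) (τ : ScLin E (ScScale.const ℝ))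
    {j : ℕ} (l : ScLin E (W.shiftScale j)) (x : E.level 0) :
    (W.funInclL n).map 0 (W.transMap 0 p q u v τ l x) =
      ((0, 0, W.transOp 0 p q u v (τ.map 0 x)
        (Sobolev.toL2 (show W.Sobolev (j + 0) from l.map 0 x))) :
        EuclideanSpace ℝ (Fin n) × ℝ × W.Sobolev 0) :=
  Prod.ext rfl (Prod.ext rfl (Sobolev.toL2_injective (m := 0)
    (toL2_inclusion (show 0 ≤ 0 + 0 by omega) _)))

theorem toL2_funL (x : EuclideanSpace ℝ (Fin n) × ℝ × W.Sobolev 0) :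
    Sobolev.toL2 (show W.Sobolev (0 + 0) from (W.funL n).map 0 x) = Sobolev.toL2 x.2.2 :=
  toL2_inclusion (show 0 + 0 ≤ 0 by omega) x.2.2

end WeightData

open WeightData

variable {k : ℕ}

theorem BumpData.toL2_transOp_self (W : WeightData) (B : BumpData k) (m : ℕ) (t : ℝ) (f : L2) :
    ∑ j, Sobolev.toL2 (W.transOp m 0 0 (B.test j) (B.test j) t f) = B.proj t f := by
  by_cases ht : 0 < t
  · rw [B.proj_of_pos ht]
    refine Finset.sum_congr rfl fun j _ => ?_
    rw [W.transOp_of_pos _ _ _ _ _ ht, expCoeff_zero, one_mul, map_smul]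
    rfl
  · simp only [B.proj_of_nonpos (not_lt.1 ht), W.transOp_of_nonpos _ _ _ _ _ (not_lt.1 ht)]
    simp

theorem toL2_sum {W : WeightData} {m : ℕ} {ι : Type*} (s : Finset ι) (f : ι → W.Sobolev m) :
    Sobolev.toL2 (∑ i ∈ s, f i) = ∑ i ∈ s, Sobolev.toL2 (f i) :=
  map_sum Sobolev.toL2 f s

theorem ambient_sum {W : WeightData} {n : ℕ} {ι : Type*} (s : Finset ι) (f : ι → W.Sobolev 0) :
    (∑ i ∈ s, (show (W.ambient n).level 0 from
      ((0, 0, f i) : EuclideanSpace ℝ (Fin n) × ℝ × W.Sobolev 0))) =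
      ((0, 0, ∑ i ∈ s, f i) : EuclideanSpace ℝ (Fin n) × ℝ × W.Sobolev 0) := by
  let L : W.Sobolev 0 →ₗ[ℝ] EuclideanSpace ℝ (Fin n) × ℝ × W.Sobolev 0 :=
    (LinearMap.inr ℝ _ _).comp (LinearMap.inr ℝ _ _)
  exact (map_sum L f s).symm

/-- A linear map plus generators with i = j = 0 and p = q = 0, the borderline case without loss of
regularity. -/
theorem gammaRetraction_eq (W : WeightData) (B : BumpData k) (n : ℕ) :
    gammaRetraction W B n = fun x => (W.flatL (ContinuousLinearMap.id ℝ _)).map 0 x +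
      ∑ j, (W.funInclL n).map 0
        (W.transMap 0 0 0 (B.test j) (B.test j) (W.timeL n) (W.funL n) x) := by
  funext x
  simp only [funInclL_transMap]
  refine Eq.trans ?_ (congrArg _ (ambient_sum Finset.univ _).symm)
  refine Prod.ext (add_zero _).symm (Prod.ext (add_zero _).symm
    (Eq.trans ?_ (zero_add _).symm))
  apply Sobolev.toL2_injective (m := 0)
  refine Eq.trans ?_ (toL2_sum _ _).symm
  refine (B.toL2_transOp_self W 0 _ _).symm.trans ?_
  exact Finset.sum_congr rfl fun j _ => congrArg (fun g => Sobolev.toL2 (W.transOp 0 0 0 (B.test j)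
    (B.test j) x.2.1 g)) (toL2_funL x).symm

theorem scGen_gammaRetraction (W : WeightData) (B : BumpData k) (n : ℕ) :
    ScGen W.IsTransMap (W.ambient n) (W.ambient n) (gammaRetraction W B n) := by
  rw [gammaRetraction_eq]
  exact (ScGen.lin _).add (ScGen.sum _ fun j _ => .postcomp _
    (.gen (.mk 0 0 0 0 le_rfl (fun _ => ⟨rfl, rfl⟩) _ _ _ _)))

theorem denseIncl_ambient (W : WeightData) (n : ℕ) : (W.ambient n).DenseIncl :=
  (W.isScBanach_ambient n).denseIncl

theorem isScRetraction_gammaRetraction (W : WeightData) (B : BumpData k) (n : ℕ) :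
    IsScRetraction (gammaRetraction W B n) where
  smooth := scSmooth_of_scGen (denseIncl_ambient W n) (scGen_gammaRetraction W B n)
  idem _ := Prod.ext rfl (Prod.ext rfl (congrArg W.ofL2 (B.proj_proj _ _)))

/-- Differentiating ∑ ⟨f, γ_{j,t}⟩ γ_{j,t} gives ⟨h, γ_j⟩ γ_j and δt ⟨f, ρ_j⟩ γ_j, which combine to
the coefficients, and δt ⟨f, γ_j⟩ ρ_j, which sums to δt ξ_t. -/
theorem BumpData.sum_transOpFDeriv (W : WeightData) (B : BumpData k) (t τ : ℝ) (f h : L2) :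
    ∑ j, Sobolev.toL2 (τ • W.transOpDeriv 0 0 0 (B.test j) (B.test j) t f
      + W.transOp 0 0 0 (B.test j) (B.test j) t h) = B.tangentL2 t f τ (B.coeff t f τ h) := by
  by_cases ht : 0 < t
  · rw [B.tangentL2_of_pos ht, BumpData.xi, Finset.smul_sum, ← Finset.sum_add_distrib]
    refine Finset.sum_congr rfl fun j _ => ?_
    rw [W.transOpDeriv_of_pos _ _ _ _ _ ht, W.transOp_of_pos _ _ _ _ _ ht, BumpData.coeff,
      B.rho_of_pos j ht, expCoeff_zero, real_inner_smul_right, shifted_eq]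
    simp only [map_add, map_sub, map_neg, map_smul, toL2_ofTest, Nat.cast_zero, neg_zero, zero_mul, sub_zero,
      zero_add, zero_smul, one_mul, zero_sub]
    module
  · rw [B.tangentL2_of_nonpos (not_lt.1 ht)]
    refine Finset.sum_eq_zero fun j _ => ?_
    rw [W.transOpDeriv_of_nonpos _ _ _ _ _ (not_lt.1 ht), W.transOp_of_nonpos _ _ _ _ _ (not_lt.1 ht)]
    simp

theorem hasScDerivAt_gammaRetraction (W : WeightData) (B : BumpData k) (n : ℕ)
    (x : EuclideanSpace ℝ (Fin n)) (t : ℝ) (f : W.Sobolev 1) :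
    ∃ A, HasScDerivAt (E := W.ambient n) (F := W.ambient n) (gammaRetraction W B n) A
      (ambientPt W x t f) ∧ ∀ a h, A (ambientVec W a h) = ambientVec W a
        (B.tangentL2 t (Sobolev.toL2 f) (a (Fin.last n))
          (B.coeff t (Sobolev.toL2 f) (a (Fin.last n)) h)) := by
  let X0 := EuclideanSpace ℝ (Fin n) × ℝ × W.Sobolev 0
  let X1 := EuclideanSpace ℝ (Fin n) × ℝ × W.Sobolev 1
  let e0 : X0 →L[ℝ] EuclideanSpace ℝ (Fin n) := ContinuousLinearMap.fst ℝ _ _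
  let τ0 : X0 →L[ℝ] ℝ :=
    (ContinuousLinearMap.fst ℝ ℝ (W.Sobolev 0)).comp (ContinuousLinearMap.snd ℝ _ _)
  let l0 : X0 →L[ℝ] L2 := (Sobolev.toL2L W 0).comp
    ((ContinuousLinearMap.snd ℝ ℝ (W.Sobolev 0)).comp (ContinuousLinearMap.snd ℝ _ _))
  let e1 : X1 →L[ℝ] EuclideanSpace ℝ (Fin n) := ContinuousLinearMap.fst ℝ _ _
  let q1 : X1 →L[ℝ] ℝ × W.Sobolev 1 := ContinuousLinearMap.snd ℝ _ _
  let τ1 : X1 →L[ℝ] ℝ := (ContinuousLinearMap.fst ℝ ℝ (W.Sobolev 1)).comp q1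
  let A : X0 →L[ℝ] X0 := e0.prod (τ0.prod (∑ j, W.transOpFDeriv 0 0 0 (B.test j) (B.test j) t
    (Sobolev.toL2 f) τ0 l0))
  let i : X1 →L[ℝ] X0 := (W.ambient n).incl 0
  have hl : ∀ y, l0 (i y) = Sobolev.toL2L W 1 (q1 y).2 := fun y => by
    change Sobolev.toL2L W 0 _ = _
    rw [Sobolev.toL2L_apply, Sobolev.toL2L_apply]
    rfl
  refine ⟨A, ?_, fun a h => ?_⟩
  · have h1 : HasFDerivAt (fun y : X1 => (e1 y, τ1 y, ∑ j, W.transOp 0 0 0 (B.test j) (B.test j)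
        (q1 y).1 (Sobolev.toL2 (q1 y).2))) (A.comp i) (x, t, f) := by
      have h2 : ∀ j, HasFDerivAt (fun y : X1 => W.transOp 0 0 0 (B.test j) (B.test j)
          (q1 y).1 (Sobolev.toL2 (q1 y).2)) ((W.transOpFDeriv 0 0 0 (B.test j) (B.test j) t
          (Sobolev.toL2 f) τ0 l0).comp i) (x, t, f) := fun j => by
        have h := (W.hasFDerivAt_transOp one_pos 0 0 (B.test j) (B.test j) t f).comp
          (f := q1) (x, t, f) q1.hasFDerivAt
        refine h.congr_fderiv ?_
        apply ContinuousLinearMap.ext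
        intro y
        change τ1 y • W.transOpDeriv 0 0 0 (B.test j) (B.test j) t (Sobolev.toL2 f)
            + W.transOp 0 0 0 (B.test j) (B.test j) t (Sobolev.toL2L W 1 (q1 y).2)
          = τ1 y • W.transOpDeriv 0 0 0 (B.test j) (B.test j) t (Sobolev.toL2 f)
            + W.transOp 0 0 0 (B.test j) (B.test j) t (l0 (i y))
        rw [hl]
      have h3 := (e1.hasFDerivAt (x := (x, t, f))).prodMk (τ1.hasFDerivAt.prodMk
        (HasFDerivAt.fun_sum (u := Finset.univ) fun j _ => h2 j))
      refine h3.congr_fderiv ?_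
      apply ContinuousLinearMap.ext
      intro y
      refine Prod.ext rfl (Prod.ext rfl ?_)
      change (∑ j, (W.transOpFDeriv 0 0 0 (B.test j) (B.test j) t
          (Sobolev.toL2 f) τ0 l0).comp i) y = (∑ j, W.transOpFDeriv 0 0 0 (B.test j) (B.test j) t
          (Sobolev.toL2 f) τ0 l0) (i y)
      simp only [sum_apply, ContinuousLinearMap.comp_apply]
    refine h1.congr_of_eventuallyEq (Filter.Eventually.of_forall fun y => ?_)
    refine Prod.ext rfl (Prod.ext rfl (Sobolev.toL2_injective (m := 0) ?_))
    exact (B.toL2_transOp_self W 0 _ _).symm.trans (toL2_sum _ _).symm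
  · refine Prod.ext rfl (Prod.ext rfl (Sobolev.toL2_injective (m := 0) ?_))
    change Sobolev.toL2 ((∑ j, W.transOpFDeriv 0 0 0 (B.test j) (B.test j) t
          (Sobolev.toL2 f) τ0 l0) _) = _
    have hs : ∀ z : X0, Sobolev.toL2 ((∑ j, W.transOpFDeriv 0 0 0 (B.test j) (B.test j) t
        (Sobolev.toL2 f) τ0 l0) z) = ∑ j, Sobolev.toL2 (W.transOpFDeriv 0 0 0 (B.test j) (B.test j) t
        (Sobolev.toL2 f) τ0 l0 z) := fun z => by rw [sum_apply, toL2_sum]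
    refine (hs _).trans ?_
    refine Eq.trans (Finset.sum_congr rfl fun j _ => ?_)
      (B.sum_transOpFDeriv W t (a (Fin.last n)) (Sobolev.toL2 f) h)
    change Sobolev.toL2 (a (Fin.last n) • _ + W.transOp 0 0 0 _ _ t
      (Sobolev.toL2L W 0 (W.ofL2 h))) = _
    rw [Sobolev.toL2L_apply, toL2_ofL2]

theorem scDeriv_gammaRetraction (W : WeightData) (B : BumpData k) (n : ℕ)
    (x : EuclideanSpace ℝ (Fin n)) (t : ℝ) (f : W.Sobolev 1) (a : Fin (n + 1) → ℝ) (h : L2) :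
    scDeriv (E := W.ambient n) (F := W.ambient n) (gammaRetraction W B n) (ambientPt W x t f)
      (ambientVec W a h) = ambientVec W a (B.tangentL2 t (Sobolev.toL2 f) (a (Fin.last n))
          (B.coeff t (Sobolev.toL2 f) (a (Fin.last n)) h)) := by
  obtain ⟨A, hA, hA'⟩ := hasScDerivAt_gammaRetraction W B n x t f
  rw [hA.scDeriv_eq (denseIncl_ambient W n 0), hA']

variable (W : WeightData) (B : BumpData k) {n : ℕ}

/-! ## The tangent bundle of `Γ_n^k` -/

/-- The splitting `ℝⁿ ⊕ ℝ = ℝ^{n+1}`. -/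
def coordEquiv (n : ℕ) : (EuclideanSpace ℝ (Fin n) × ℝ) ≃ₗ[ℝ] (Fin (n + 1) → ℝ) where
  toFun v := Fin.snoc (α := fun _ => ℝ) (fun i => v.1 i) v.2
  invFun a := (WithLp.toLp 2 fun i => a i.castSucc, a (Fin.last n))
  map_add' v w := by
    funext i
    refine Fin.lastCases ?_ (fun i => ?_) i <;> simp
  map_smul' c v := by
    funext i
    refine Fin.lastCases ?_ (fun i => ?_) i <;> simp
  left_inv v := by ext <;> simp
  right_inv a := by
    funext i
    refine Fin.lastCases ?_ (fun i => ?_) i <;> simp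

/-- The map `a ↦ a'` on `ℝⁿ ⊕ ℝ`. -/
def turnL (n : ℕ) : EuclideanSpace ℝ (Fin n) × ℝ →L[ℝ] EuclideanSpace ℝ (Fin n) × ℝ :=
  LinearMap.toContinuousLinearMap ((coordEquiv n).symm.toLinearMap ∘ₗ quarterTurnL (n + 1) ∘ₗ
    (coordEquiv n).toLinearMap)

theorem exists_eq_ambientVec (v : (W.ambient n).level 0) :
    ∃ (a : Fin (n + 1) → ℝ) (h : L2), v = ambientVec W a h :=
  ⟨coordEquiv n (v.1, v.2.1), Sobolev.toL2 (show W.Sobolev 0 from v.2.2), by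
    have h := (coordEquiv n).symm_apply_apply (v.1, v.2.1)
    exact Prod.ext (congrArg Prod.fst h).symm (Prod.ext (congrArg Prod.snd h).symm rfl)⟩

theorem ambientVec_injective {a a' : Fin (n + 1) → ℝ} {h h' : L2}
    (e : ambientVec W a h = ambientVec W a' h') : a = a' ∧ h = h' := by
  refine ⟨(coordEquiv n).symm.injective (Prod.ext
    (congrArg (fun v : EuclideanSpace ℝ (Fin n) × ℝ × W.Sobolev 0 => v.1) e)
    (congrArg (fun v : EuclideanSpace ℝ (Fin n) × ℝ × W.Sobolev 0 => v.2.1) e)), ?_⟩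
  exact congrArg (fun v : EuclideanSpace ℝ (Fin n) × ℝ × W.Sobolev 0 => Sobolev.toL2 v.2.2) e

theorem exists_eq_ambientPt (p : (W.ambient n).level 1) :
    ∃ (x : EuclideanSpace ℝ (Fin n)) (t : ℝ) (f : W.Sobolev 1), p = ambientPt W x t f :=
  ⟨p.1, p.2.1, p.2.2, rfl⟩

theorem ambientVec_add (a a' : Fin (n + 1) → ℝ) (h h' : L2) :
    ambientVec W (a + a') (h + h') = ambientVec W a h + ambientVec W a' h' := rfl

theorem ambientVec_smul (c : ℝ) (a : Fin (n + 1) → ℝ) (h : L2) :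
    ambientVec W (c • a) (c • h) = c • ambientVec W a h := rfl

/-- The projection `π_t` on `W^{1,δ_1}`. -/
def BumpData.projOne (t : ℝ) (f : W.Sobolev 1) : W.Sobolev 1 :=
  ∑ j, W.transOp 1 0 0 (B.test j) (B.test j) t (Sobolev.toL2 f)

theorem BumpData.toL2_projOne (t : ℝ) (f : W.Sobolev 1) :
    Sobolev.toL2 (B.projOne W t f) = B.proj t (Sobolev.toL2 f) :=
  (toL2_sum _ _).trans (B.toL2_transOp_self W 1 t _)

theorem BumpData.projOne_eq_self {t : ℝ} {f : W.Sobolev 1}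
    (hf : B.proj t (Sobolev.toL2 f) = Sobolev.toL2 f) : B.projOne W t f = f :=
  Sobolev.toL2_injective ((B.toL2_projOne W t f).trans hf)

theorem gammaRetraction_incl (x : EuclideanSpace ℝ (Fin n)) (t : ℝ) (f : W.Sobolev 1) :
    gammaRetraction W B n ((W.ambient n).incl 0 (ambientPt W x t f))
      = (W.ambient n).incl 0 (ambientPt W x t (B.projOne W t f)) :=
  Prod.ext rfl (Prod.ext rfl (Sobolev.toL2_injective (m := 0) (B.toL2_projOne W t f).symm))

theorem scTangentMap_gammaRetraction (x : EuclideanSpace ℝ (Fin n)) (t : ℝ) (f : W.Sobolev 1)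
    (a : Fin (n + 1) → ℝ) (h : L2) :
    scTangentMap (E := W.ambient n) (F := W.ambient n) (gammaRetraction W B n)
        (ambientPt W x t f, ambientVec W a h)
      = (ambientPt W x t (B.projOne W t f), ambientVec W a (B.tangentL2 t (Sobolev.toL2 f)
          (a (Fin.last n)) (B.coeff t (Sobolev.toL2 f) (a (Fin.last n)) h))) := by
  refine Prod.ext ?_ (scDeriv_gammaRetraction W B n x t f a h)
  change invFun ((W.ambient n).incl 0)
    (gammaRetraction W B n ((W.ambient n).incl 0 (ambientPt W x t f))) = _
  rw [gammaRetraction_incl]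
  exact leftInverse_invFun ((W.ambient n).incl_injective 0) _

/-- The tangent bundle of `Γ_n^k`. -/
theorem mem_tangentBundle_iff {x : EuclideanSpace ℝ (Fin n)} {t : ℝ} {f : W.Sobolev 1}
    {a : Fin (n + 1) → ℝ} {h : L2} :
    (show (W.ambient n).tangent.level 0 from (ambientPt W x t f, ambientVec W a h))
        ∈ tangentBundle (E := W.ambient n) (gammaRetraction W B n) ↔
      B.proj t (Sobolev.toL2 f) = Sobolev.toL2 f ∧
        ∃ b, h = B.tangentL2 t (Sobolev.toL2 f) (a (Fin.last n)) b := by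
  constructor
  · rintro ⟨⟨p, v⟩, hw⟩
    obtain ⟨x', t', f', rfl⟩ := exists_eq_ambientPt W p
    obtain ⟨a', h', rfl⟩ := exists_eq_ambientVec W v
    rw [scTangentMap_gammaRetraction] at hw
    obtain ⟨e1, e2⟩ := Prod.ext_iff.1 hw
    obtain ⟨rfl, rfl⟩ := ambientVec_injective W e2
    have et : t' = t := congrArg
      (fun v : EuclideanSpace ℝ (Fin n) × ℝ × W.Sobolev 1 => v.2.1) e1
    have ef : B.projOne W t' f' = f := congrArg
      (fun v : EuclideanSpace ℝ (Fin n) × ℝ × W.Sobolev 1 => v.2.2) e1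
    subst et ef
    rw [B.toL2_projOne]
    exact ⟨B.proj_proj _ _, _, (B.tangentL2_proj _ _ _ _).symm⟩
  · rintro ⟨hf, b, rfl⟩
    -- A vector of this form is its own preimage, because Tr fixes it.
    refine ⟨(ambientPt W x t f, ambientVec W a
      (B.tangentL2 t (Sobolev.toL2 f) (a (Fin.last n)) b)), ?_⟩
    rw [scTangentMap_gammaRetraction, B.projOne_eq_self W hf]
    exact congrArg (fun h => (ambientPt W x t f, ambientVec W a h))
      (B.tangentL2_coeff_tangentL2 W id hf _ _ b)

/-! ## The almost complex structure -/

/-- The map `(x, t, f; a, h) ↦ (x, t, π_t f; a', ∑ⱼ b'ⱼ γ_{j,t} + δxₙ ξ_t)` on `TE`, where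
`bⱼ = ⟨h, γ_{j,t}⟩ + δt ⟨f, ρ_{j,t}⟩`. -/
def turnMap (n : ℕ) (w : (W.ambient n).tangent.level 0) : (W.ambient n).tangent.level 0 :=
  ((scTangentMap (E := W.ambient n) (F := W.ambient n) (gammaRetraction W B n) w).1,
    let a := coordEquiv n (w.2.1, w.2.2.1)
    let t : ℝ := w.1.2.1
    let f : L2 := Sobolev.toL2 (show W.Sobolev 1 from w.1.2.2)
    let h : L2 := Sobolev.toL2 (show W.Sobolev 0 from w.2.2.2)
    ambientVec W (quarterTurn a) (B.tangentL2 t f (quarterTurn a (Fin.last n))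
      (quarterTurn (B.coeff t f (a (Fin.last n)) h))))

theorem turnMap_apply (x : EuclideanSpace ℝ (Fin n)) (t : ℝ) (f : W.Sobolev 1)
    (a : Fin (n + 1) → ℝ) (h : L2) :
    turnMap W B n (ambientPt W x t f, ambientVec W a h)
      = (ambientPt W x t (B.projOne W t f), ambientVec W (quarterTurn a)
          (B.tangentL2 t (Sobolev.toL2 f) (quarterTurn a (Fin.last n))
            (quarterTurn (B.coeff t (Sobolev.toL2 f) (a (Fin.last n)) h)))) := by
  have e : coordEquiv n ((ambientVec W a h).1, (ambientVec W a h).2.1) = a :=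
    (coordEquiv n).apply_symm_apply a
  have e1 := congrArg (fun w : (W.ambient n).level 1 × (W.ambient n).level 0 => w.1)
    (scTangentMap_gammaRetraction W B x t f a h)
  refine Prod.ext e1 ?_
  change ambientVec W (quarterTurn (coordEquiv n _)) (B.tangentL2 t (Sobolev.toL2 f)
    (quarterTurn (coordEquiv n _) _) (quarterTurn (B.coeff t (Sobolev.toL2 f)
      (coordEquiv n _ _) h))) = _
  rw [e]

theorem turnMap_mem (w : (W.ambient n).tangent.level 0) :
    turnMap W B n w ∈ tangentBundle (E := W.ambient n) (gammaRetraction W B n) := by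
  obtain ⟨p, v⟩ := w
  obtain ⟨x, t, f, rfl⟩ := exists_eq_ambientPt W p
  obtain ⟨a, h, rfl⟩ := exists_eq_ambientVec W v
  rw [turnMap_apply]
  refine (mem_tangentBundle_iff W B).2 ⟨?_, quarterTurn (B.coeff t (Sobolev.toL2 f)
    (a (Fin.last n)) h), ?_⟩
  · rw [B.toL2_projOne, B.proj_proj]
  · rw [B.toL2_projOne, B.tangentL2_proj]

/-- The tangent map of r does not change the coefficients when t > 0, and for t ≤ 0 they have no
effect. So J ∘ Tr is `turnMap` itself, and sc-smoothness of J on the retract becomes sc-smoothness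
of an explicit map on TE. -/
theorem turnMap_scTangentMap (w : (W.ambient n).tangent.level 0) :
    turnMap W B n (scTangentMap (E := W.ambient n) (F := W.ambient n) (gammaRetraction W B n) w)
      = turnMap W B n w := by
  obtain ⟨p, v⟩ := w
  obtain ⟨x, t, f, rfl⟩ := exists_eq_ambientPt W p
  obtain ⟨a, h, rfl⟩ := exists_eq_ambientVec W v
  have hf : B.proj t (Sobolev.toL2 (B.projOne W t f)) = Sobolev.toL2 (B.projOne W t f) := by
    rw [B.toL2_projOne, B.proj_proj]
  rw [scTangentMap_gammaRetraction, turnMap_apply, turnMap_apply, B.projOne_eq_self W hf,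
    ← B.tangentL2_proj t (Sobolev.toL2 f) (a (Fin.last n)),
    ← B.tangentL2_proj t (Sobolev.toL2 f) (quarterTurn a (Fin.last n)), ← B.toL2_projOne,
    B.tangentL2_coeff_tangentL2 W quarterTurn hf]

/-- The almost complex structure. -/
def turnStructure (n : ℕ) (w : tangentBundle (E := W.ambient n) (gammaRetraction W B n)) :
    tangentBundle (E := W.ambient n) (gammaRetraction W B n) :=
  ⟨turnMap W B n w.1, turnMap_mem W B w.1⟩

theorem turnStructure_apply {x : EuclideanSpace ℝ (Fin n)} {t : ℝ} {f : W.Sobolev 1}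
    {a : Fin (n + 1) → ℝ} {h : L2}
    (w : tangentBundle (E := W.ambient n) (gammaRetraction W B n))
    (hw : w.1 = (ambientPt W x t f, ambientVec W a h)) :
    ∃ b, h = B.tangentL2 t (Sobolev.toL2 f) (a (Fin.last n)) b ∧
      (turnStructure W B n w).1 = (ambientPt W x t f, ambientVec W (quarterTurn a)
        (B.tangentL2 t (Sobolev.toL2 f) (quarterTurn a (Fin.last n)) (quarterTurn b))) := by
  have hm := w.2
  rw [hw] at hm
  obtain ⟨hf, b, rfl⟩ := (mem_tangentBundle_iff W B).1 hm
  refine ⟨b, rfl, ?_⟩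
  change turnMap W B n w.1 = _
  rw [hw, turnMap_apply, B.projOne_eq_self W hf, B.tangentL2_coeff_tangentL2 W quarterTurn hf]

theorem isExplicitStructure_turnStructure :
    IsExplicitStructure W B n (turnStructure W B n) where
  nonpos x t f a h w ht hw := by
    obtain ⟨b, hb, hJ⟩ := turnStructure_apply W B w hw
    rw [B.tangentL2_of_nonpos ht] at hb hJ
    exact ⟨hb, hJ⟩
  pos x t f a h w ht hw := by
    obtain ⟨b, hb, hJ⟩ := turnStructure_apply W B w hw
    rw [B.tangentL2_of_pos ht] at hb hJ
    exact ⟨b, hb, hJ⟩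

/-! ## Smoothness of the almost complex structure -/

/-- The projection `(x, h) ↦ (x, 0)` of `TE`. -/
def ScLin.horizProj (E : ScScale) : ScLin E.tangent E.tangent where
  map m := (ContinuousLinearMap.inl ℝ (E.level (m + 1)) (E.level m)).comp
    (ContinuousLinearMap.fst ℝ (E.level (m + 1)) (E.level m))
  comm m _ := Prod.ext rfl (map_zero (E.incl m))

theorem flatL_turnL (a : Fin (n + 1) → ℝ) (h : L2) :
    (W.flatL (turnL n)).map 0 (ambientVec W a h) = ambientVec W (quarterTurn a) 0 := by
  have e : turnL n ((ambientVec W a h).1, (ambientVec W a h).2.1)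
      = (coordEquiv n).symm (quarterTurn a) :=
    congrArg (fun b => (coordEquiv n).symm (quarterTurn b))
      ((coordEquiv n).apply_symm_apply a)
  exact Prod.ext (congrArg (fun v : EuclideanSpace ℝ (Fin n) × ℝ => v.1) e)
    (Prod.ext (congrArg (fun v : EuclideanSpace ℝ (Fin n) × ℝ => v.2) e) rfl)

theorem funInclL_apply (y : W.Sobolev (0 + 0)) :
    (W.funInclL n).map 0 y = ambientVec W 0 (Sobolev.toL2 y) :=
  Prod.ext rfl (Prod.ext rfl (Sobolev.toL2_injective (m := 0)
    (toL2_inclusion (show 0 ≤ 0 + 0 by omega) y)))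

/-- The matrix of `quarterTurn`. -/
def turnMatrix (k : ℕ) (j i : Fin k) : ℝ := quarterTurn (fun l => if i = l then 1 else 0) j

/-- The reason for smoothness across t = 0: the vector part h enters only through operators with p =
q = 0, whereas the factor t^{-2} e^{1/t} from ρ_{j,t} meets only the base point f, which has one
level to spare. The signs -1 come from the derivative of e^{1/t}. -/
theorem BumpData.tangentL2_eq_transOp (m : ℕ) (t : ℝ) (f : L2) (τ σ : ℝ) (h : L2) :
    ∑ j, ∑ i, turnMatrix k j i • (Sobolev.toL2 (W.transOp m 0 0 (B.test i) (B.test j) t h)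
        + τ • (-1 : ℝ) • Sobolev.toL2 (W.transOp m 2 1 (B.test i).deriv (B.test j) t f))
      + σ • ∑ j, (-1 : ℝ) • Sobolev.toL2 (W.transOp m 2 1 (B.test j) (B.test j).deriv t f)
      = B.tangentL2 t f σ (quarterTurn (B.coeff t f τ h)) := by
  by_cases ht : 0 < t
  · rw [B.tangentL2_of_pos ht, BumpData.xi]
    congr 1
    · refine Finset.sum_congr rfl fun j _ => ?_
      rw [quarterTurn_eq_sum, Finset.sum_smul]
      refine Finset.sum_congr rfl fun i _ => ?_
      rw [W.transOp_of_pos _ _ _ _ _ ht, W.transOp_of_pos _ _ _ _ _ ht, BumpData.coeff,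
        B.rho_of_pos i ht, expCoeff_zero, real_inner_smul_right, shifted_eq, shifted_eq]
      simp only [map_smul, toL2_ofTest, turnMatrix]
      module
    · congr 1
      refine Finset.sum_congr rfl fun j _ => ?_
      rw [W.transOp_of_pos _ _ _ _ _ ht, B.rho_of_pos j ht, shifted_eq]
      simp only [map_smul, toL2_ofTest]
      module
  · simp only [B.tangentL2_of_nonpos (not_lt.1 ht), W.transOp_of_nonpos _ _ _ _ _ (not_lt.1 ht)]
    simp

/-- The `L²`-part of `turnMap`. -/
def turnFun (n : ℕ) (w : (W.ambient n).tangent.level 0) : (W.shiftScale 0).level 0 :=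
  let E := W.ambient n
  let τ := (W.timeL n).comp (ScLin.base E)
  (∑ j, ∑ i, turnMatrix k j i •
    (W.transMap 0 0 0 (B.test i) (B.test j) τ ((W.funL n).comp (ScLin.vec E)) w +
      (show ℝ from ((W.timeL n).comp (ScLin.vec E)).map 0 w) • (-1 : ℝ) •
        W.transMap 0 2 1 (B.test i).deriv (B.test j) τ (baseLift (W.funL n)) w)) +
  (show ℝ from ((W.timeL n).comp ((W.flatL (turnL n)).comp (ScLin.vec E))).map 0 w) •
    ∑ j, (-1 : ℝ) • W.transMap 0 2 1 (B.test j) (B.test j).deriv τ (baseLift (W.funL n)) w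

theorem scGen_turnFun (n : ℕ) :
    ScGen W.IsTransMap (W.ambient n).tangent (W.shiftScale 0) (turnFun W B n) := by
  refine (ScGen.sum _ fun j _ => ScGen.sum _ fun i _ => ScGen.const_smul _ (ScGen.add ?_
    (ScGen.smul _ (ScGen.const_smul _ ?_)))).add
    (ScGen.smul _ (ScGen.sum _ fun j _ => ScGen.const_smul _ ?_))
  · exact .gen (.mk 0 0 0 0 le_rfl (fun _ => ⟨rfl, rfl⟩) _ _ _ _)
  · exact .gen (.mk 0 1 2 1 zero_le_one (by omega) _ _ _ _)
  · exact .gen (.mk 0 1 2 1 zero_le_one (by omega) _ _ _ _)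

theorem toL2_turnFun (x : EuclideanSpace ℝ (Fin n)) (t : ℝ) (f : W.Sobolev 1)
    (a : Fin (n + 1) → ℝ) (h : L2) :
    Sobolev.toL2 (show W.Sobolev (0 + 0) from
        turnFun W B n (ambientPt W x t f, ambientVec W a h))
      = B.tangentL2 t (Sobolev.toL2 f) (quarterTurn a (Fin.last n))
          (quarterTurn (B.coeff t (Sobolev.toL2 f) (a (Fin.last n)) h)) := by
  have e1 : Sobolev.toL2 (show W.Sobolev (0 + 0) from (W.funL n).map 0 (ambientVec W a h)) = h :=
    toL2_funL _
  have e2 : Sobolev.toL2 (show W.Sobolev (0 + 1 + 0) from (baseLift (W.funL n)).map 0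
      (ambientPt W x t f, ambientVec W a h)) = Sobolev.toL2 f :=
    (toL2_baseLift (W.funL n) (ambientPt W x t f, ambientVec W a h)).trans (toL2_funL _)
  have e3 : (W.timeL n).map 0 ((W.flatL (turnL n)).map 0 (ambientVec W a h))
      = quarterTurn a (Fin.last n) := by
    rw [flatL_turnL]; rfl
  rw [← B.tangentL2_eq_transOp W (0 + 0)]
  let g : L2 := Sobolev.toL2 (show W.Sobolev (0 + 0) from (W.funL n).map 0 (ambientVec W a h))
  let g' : L2 := Sobolev.toL2 (show W.Sobolev (0 + 1 + 0) from (baseLift (W.funL n)).map 0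
      (ambientPt W x t f, ambientVec W a h))
  let σ : ℝ := (W.timeL n).map 0 ((W.flatL (turnL n)).map 0 (ambientVec W a h))
  change Sobolev.toL2 (∑ j, ∑ i, turnMatrix k j i • (W.transOp (0 + 0) 0 0 (B.test i) (B.test j) t g
        + a (Fin.last n) • (-1 : ℝ) • W.transOp (0 + 0) 2 1 (B.test i).deriv (B.test j) t g')
      + σ • ∑ j, (-1 : ℝ) • W.transOp (0 + 0) 2 1 (B.test j) (B.test j).deriv t g') = _
  rw [show g = h from e1, show g' = Sobolev.toL2 f from e2,
    show σ = quarterTurn a (Fin.last n) from e3]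
  simp only [map_add, map_smul, map_sum]

/-- The base component is that of Tr, so it is the horizontal part of the tangent map that the
generated class already contains; the vertical part is a linear turn of a plus `turnFun`. -/
theorem scSmooth_turnMap (n : ℕ) :
    ScSmooth (E := (W.ambient n).tangent) (F := (W.ambient n).tangent) (turnMap W B n) := by
  obtain ⟨T, hT, gT⟩ := (scGen_gammaRetraction W B n).exists_tangent (by
    rintro _ _ _ ⟨i, j, p, q, hij, hpq, u, v, τ, l⟩
    exact ⟨_, hasScTangent_transMap hij hpq u v τ l, scGen_transTangent hij hpq u v τ l⟩)
  have hT' := hT.scTangentMap_eq (denseIncl_ambient W n 0)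
  refine scSmooth_of_scGen (W := W) (denseIncl_ambient W n).tangent ?_
  have e : turnMap W B n = fun w => (ScLin.horizProj (W.ambient n)).map 0 (T w) +
      (ScLin.vert (W.ambient n)).map 0 ((W.flatL (turnL n)).map 0
        ((ScLin.vec (W.ambient n)).map 0 w) + (W.funInclL n).map 0 (turnFun W B n w)) := by
    funext w
    obtain ⟨p, v⟩ := w
    obtain ⟨x, t, f, rfl⟩ := exists_eq_ambientPt W p
    obtain ⟨a, h, rfl⟩ := exists_eq_ambientVec W v
    have e1 := (funInclL_apply (n := n) W _).trans
      (congrArg (ambientVec W 0) (toL2_turnFun W B x t f a h))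
    rw [turnMap_apply, ← hT', scTangentMap_gammaRetraction]
    refine Prod.ext (add_zero _).symm (Eq.trans ?_ (zero_add _).symm)
    refine Eq.trans ?_ (congrArg₂ (· + ·) (flatL_turnL W a h) e1).symm
    dsimp only
    rw [← ambientVec_add, add_zero, zero_add]
  rw [e]
  exact (gT.postcomp _).add (.postcomp _ (.add (.lin ((W.flatL (turnL n)).comp (ScLin.vec _)))
    (.postcomp _ (scGen_turnFun W B n))))

theorem scSmoothOnRetract_turnStructure (n : ℕ) :
    ScSmoothOnRetract (E := (W.ambient n).tangent) (F := (W.ambient n).tangent)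
      (scTangentMap (gammaRetraction W B n)) (scTangentMap (gammaRetraction W B n))
      (turnStructure W B n) := by
  have e : (fun w => ((turnStructure W B n) (rangeFactorization
      (scTangentMap (E := W.ambient n) (F := W.ambient n) (gammaRetraction W B n)) w)).1)
      = turnMap W B n := funext (turnMap_scTangentMap W B)
  unfold ScSmoothOnRetract
  rw [e]
  exact scSmooth_turnMap W B n

/-! ## Tangent spaces -/

namespace BumpData

theorem tangentL2_add (t : ℝ) (f : L2) (τ τ' : ℝ) (b b' : Fin k → ℝ) :
    B.tangentL2 t f (τ + τ') (b + b') = B.tangentL2 t f τ b + B.tangentL2 t f τ' b' := by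
  by_cases ht : 0 < t
  · simp only [B.tangentL2_of_pos ht, Pi.add_apply, add_smul, Finset.sum_add_distrib]
    abel
  · simp only [B.tangentL2_of_nonpos (not_lt.1 ht), add_zero]

theorem tangentL2_smul (t : ℝ) (f : L2) (c τ : ℝ) (b : Fin k → ℝ) :
    B.tangentL2 t f (c * τ) (c • b) = c • B.tangentL2 t f τ b := by
  by_cases ht : 0 < t
  · simp only [B.tangentL2_of_pos ht, Pi.smul_apply, smul_eq_mul, mul_smul, smul_add,
      Finset.smul_sum]
  · simp only [B.tangentL2_of_nonpos (not_lt.1 ht), smul_zero]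

theorem coeff_add (t : ℝ) (f : L2) (τ τ' : ℝ) (h h' : L2) :
    B.coeff t f (τ + τ') (h + h') = B.coeff t f τ h + B.coeff t f τ' h' := by
  funext j
  simp only [coeff, Pi.add_apply, inner_add_left]
  ring

theorem coeff_smul (t : ℝ) (f : L2) (c τ : ℝ) (h : L2) :
    B.coeff t f (c * τ) (c • h) = c • B.coeff t f τ h := by
  funext j
  simp only [coeff, Pi.smul_apply, real_inner_smul_left, smul_eq_mul]
  ring

/-- Both γ_{j,t} and ρ_{j,t} are multiples of translated test functions, so tangent vectors lie in
every level. All levels of a tangent space then coincide, and sc-continuity of J_p is automatic in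
finite dimension. -/
theorem tangentL2_mem_range (m : ℕ) (t : ℝ) (f : L2) (τ : ℝ) (b : Fin k → ℝ) :
    B.tangentL2 t f τ b ∈ LinearMap.range (Sobolev.toL2 (W := W) (m := m)) := by
  have hu : ∀ u : TestFun, u.toL2 ∈ LinearMap.range (Sobolev.toL2 (W := W) (m := m)) :=
    fun u => ⟨W.ofTest m u, rfl⟩
  by_cases ht : 0 < t
  · rw [B.tangentL2_of_pos ht]
    refine add_mem (sum_mem fun j _ => Submodule.smul_mem _ _ ?_)
      (Submodule.smul_mem _ _ (sum_mem fun j _ => Submodule.smul_mem _ _ ?_))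
    · exact hu ((B.test j).shift _)
    · rw [B.rho_of_pos j ht]
      exact Submodule.smul_mem _ _ (hu _)
  · rw [B.tangentL2_of_nonpos (not_lt.1 ht)]
    exact zero_mem _

end BumpData

theorem ambientPt_mem_regularPoints_iff {x : EuclideanSpace ℝ (Fin n)} {t : ℝ}
    {f : W.Sobolev 1} :
    ambientPt W x t f ∈ regularPoints (E := W.ambient n) (gammaRetraction W B n) ↔
      B.proj t (Sobolev.toL2 f) = Sobolev.toL2 f := by
  constructor
  · rintro ⟨y, hy⟩
    have h := (isScRetraction_gammaRetraction W B n).idem y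
    rw [hy] at h
    exact congrArg (fun v : EuclideanSpace ℝ (Fin n) × ℝ × W.Sobolev 0 => Sobolev.toL2 v.2.2) h
  · intro hf
    refine ⟨(W.ambient n).incl 0 (ambientPt W x t f), ?_⟩
    rw [gammaRetraction_incl, B.projOne_eq_self W hf]

theorem ambientVec_mem_range_iff (x : EuclideanSpace ℝ (Fin n)) {t : ℝ} {f : W.Sobolev 1}
    (hf : B.proj t (Sobolev.toL2 f) = Sobolev.toL2 f) {a : Fin (n + 1) → ℝ} {h : L2} :
    ambientVec W a h ∈ LinearMap.range (scDeriv (E := W.ambient n) (F := W.ambient n)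
        (gammaRetraction W B n) (ambientPt W x t f)).toLinearMap ↔
      ∃ b, h = B.tangentL2 t (Sobolev.toL2 f) (a (Fin.last n)) b := by
  constructor
  · rintro ⟨v, hv⟩
    obtain ⟨a', h', rfl⟩ := exists_eq_ambientVec W v
    have hv' := (scDeriv_gammaRetraction W B n x t f a' h').symm.trans hv
    obtain ⟨rfl, rfl⟩ := ambientVec_injective W hv'
    exact ⟨_, rfl⟩
  · rintro ⟨b, rfl⟩
    refine ⟨ambientVec W a (B.tangentL2 t (Sobolev.toL2 f) (a (Fin.last n)) b), ?_⟩
    refine (scDeriv_gammaRetraction W B n x t f a _).trans ?_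
    exact congrArg (ambientVec W a) (B.tangentL2_coeff_tangentL2 W id hf _ _ b)

/-- The parametrization of the tangent spaces of `Γ_n^k` by `ℝ^{n+1} ⊕ ℝᵏ`. -/
def tangentParam (n : ℕ) (t : ℝ) (f : L2) :
    (Fin (n + 1) → ℝ) × (Fin k → ℝ) →ₗ[ℝ] (W.ambient n).level 0 where
  toFun z := ambientVec W z.1 (B.tangentL2 t f (z.1 (Fin.last n)) z.2)
  map_add' _ _ := (congrArg (ambientVec W _) (B.tangentL2_add t f _ _ _ _)).trans
    (ambientVec_add W _ _ _ _)
  map_smul' c _ := (congrArg (ambientVec W _) (B.tangentL2_smul t f c _ _)).trans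
    (ambientVec_smul W _ _ _)

theorem range_scDeriv_eq (x : EuclideanSpace ℝ (Fin n)) {t : ℝ} {f : W.Sobolev 1}
    (hf : B.proj t (Sobolev.toL2 f) = Sobolev.toL2 f) :
    LinearMap.range (scDeriv (E := W.ambient n) (F := W.ambient n)
        (gammaRetraction W B n) (ambientPt W x t f)).toLinearMap
      = LinearMap.range (tangentParam W B n t (Sobolev.toL2 f)) := by
  ext v
  obtain ⟨a, h, rfl⟩ := exists_eq_ambientVec W v
  rw [ambientVec_mem_range_iff W B x hf]
  constructor
  · rintro ⟨b, rfl⟩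
    exact ⟨(a, b), rfl⟩
  · rintro ⟨⟨a', b⟩, hb⟩
    obtain ⟨rfl, rfl⟩ := ambientVec_injective W hb
    exact ⟨b, rfl⟩

/-- For t > 0 the coefficients invert the parametrization by (a, b); for t ≤ 0 it forgets b and is
injective in a. -/
theorem finrank_tangentSpace (x : EuclideanSpace ℝ (Fin n)) {t : ℝ} {f : W.Sobolev 1}
    (hf : B.proj t (Sobolev.toL2 f) = Sobolev.toL2 f) :
    Module.finrank ℝ ((tangentSpace (E := W.ambient n) (gammaRetraction W B n)
      (ambientPt W x t f)).level 0) = if 0 < t then n + 1 + k else n + 1 := by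
  have e : Module.finrank ℝ ((tangentSpace (E := W.ambient n) (gammaRetraction W B n)
      (ambientPt W x t f)).level 0)
      = Module.finrank ℝ (LinearMap.range (tangentParam W B n t (Sobolev.toL2 f))) := by
    rw [← range_scDeriv_eq W B x hf]
    rfl
  rw [e]
  split_ifs with ht
  · rw [LinearMap.finrank_range_of_inj]
    · simp
    · rintro ⟨a, b⟩ ⟨a', b'⟩ hz
      obtain ⟨rfl, h⟩ := ambientVec_injective W hz
      have := congrArg (B.coeff t (Sobolev.toL2 f) (a (Fin.last n))) h
      rw [B.coeff_tangentL2 W ht hf, B.coeff_tangentL2 W ht hf] at this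
      exact Prod.ext rfl this
  · have hr : LinearMap.range (tangentParam W B n t (Sobolev.toL2 f))
        = LinearMap.range ((tangentParam W B n t (Sobolev.toL2 f)).comp
          (LinearMap.inl ℝ (Fin (n + 1) → ℝ) (Fin k → ℝ))) := by
      ext v
      constructor
      · rintro ⟨⟨a, b⟩, rfl⟩
        refine ⟨a, congrArg (ambientVec W a) ?_⟩
        rw [B.tangentL2_of_nonpos (not_lt.1 ht), B.tangentL2_of_nonpos (not_lt.1 ht)]
      · rintro ⟨a, rfl⟩
        exact ⟨(a, 0), rfl⟩
    rw [hr, LinearMap.finrank_range_of_inj]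
    · simp
    · intro a a' hz
      exact (ambientVec_injective W hz).1

theorem finiteDimensional_tangentSpace {p : (W.ambient n).level 1}
    (hp : p ∈ regularPoints (E := W.ambient n) (gammaRetraction W B n)) :
    FiniteDimensional ℝ ((tangentSpace (E := W.ambient n) (gammaRetraction W B n) p).level 0) := by
  obtain ⟨x, t, f, rfl⟩ := exists_eq_ambientPt W p
  -- The rank is at least n + 1, whereas `finrank` would be zero in infinite dimension.
  apply Module.finite_of_finrank_pos
  rw [finrank_tangentSpace W B x ((ambientPt_mem_regularPoints_iff W B).1 hp)]
  split_ifs <;> omega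

theorem isEvenDimensional_gammaRetraction_iff :
    IsEvenDimensional (E := W.ambient n) (gammaRetraction W B n) ↔ Odd n ∧ Even k := by
  constructor
  · intro h
    have h0 : ∀ t, B.proj t (Sobolev.toL2 (0 : W.Sobolev 1)) = Sobolev.toL2 (0 : W.Sobolev 1) := by
      intro t
      simp [BumpData.proj]
    have hr : ∀ t : ℝ, Even (if 0 < t then n + 1 + k else n + 1) := fun t => by
      have hp := (ambientPt_mem_regularPoints_iff W B (n := n) (x := 0)).2 (h0 t)
      rw [← finrank_tangentSpace W B 0 (h0 t)]
      exact (h _ hp).resolve_left (not_not.2 (finiteDimensional_tangentSpace W B hp))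
    -- The points (0, t, 0) with t = 0 and t = 1 exhibit both dimensions, n + 1 and n + 1 + k.
    have h1 := hr 0
    have h2 := hr 1
    rw [if_neg (lt_irrefl _)] at h1
    rw [if_pos one_pos] at h2
    refine ⟨?_, (Nat.even_add.1 h2).1 h1⟩
    rwa [Nat.even_add_one, Nat.not_even_iff_odd] at h1
  · rintro ⟨hn, hk⟩ p hp
    obtain ⟨x, t, f, rfl⟩ := exists_eq_ambientPt W p
    rw [finrank_tangentSpace W B x ((ambientPt_mem_regularPoints_iff W B).1 hp)]
    right
    split_ifs
    · exact hn.add_one.add hk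
    · exact hn.add_one

theorem ScScale.sub_emb (E : ScScale) (S : Submodule ℝ (E.level 0)) :
    ∀ (m : ℕ) (x : (E.sub S).level m),
      ((E.sub S).emb m x : S.comap (E.emb 0).toLinearMap).1 = E.emb m x.1
  | 0, _ => rfl
  | m + 1, x => sub_emb E S m ((E.sub S).incl m x)

/-- On a finite-dimensional scale whose levels coincide, every linear map is sc-continuous. -/
theorem scContinuous_of_finiteDimensional {E : ScScale} [FiniteDimensional ℝ (E.level 0)]
    (hE : ∀ m, Surjective (E.emb m)) (A : E.level 0 →ₗ[ℝ] E.level 0) :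
    ScContinuous (E := E) (F := E) A := by
  intro m
  let e := LinearEquiv.ofBijective (E.emb m).toLinearMap ⟨E.emb_injective m, hE m⟩
  have : FiniteDimensional ℝ (E.level m) := e.symm.finiteDimensional
  let g : E.level m →ₗ[ℝ] E.level m := e.symm.toLinearMap ∘ₗ A ∘ₗ e.toLinearMap
  exact ⟨g, g.continuous_of_finiteDimensional, fun x => e.apply_symm_apply (A (e x))⟩

theorem ambient_emb (m : ℕ) (x : EuclideanSpace ℝ (Fin n) × ℝ × W.Sobolev m) :
    (W.ambient n).emb m x
      = ((x.1, x.2.1, W.ofL2 (Sobolev.toL2 x.2.2)) :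
        EuclideanSpace ℝ (Fin n) × ℝ × W.Sobolev 0) := by
  induction m with
  | zero => rfl
  | succ m ih => exact ih (x.1, x.2.1, Sobolev.incl W m x.2.2)

theorem tangentSpace_emb_surjective {p : (W.ambient n).level 1}
    (hp : p ∈ regularPoints (E := W.ambient n) (gammaRetraction W B n)) (m : ℕ) :
    Surjective ((tangentSpace (E := W.ambient n) (gammaRetraction W B n) p).emb m) := by
  obtain ⟨x, t, f, rfl⟩ := exists_eq_ambientPt W p
  rintro ⟨v, hv⟩
  obtain ⟨a, h, rfl⟩ := exists_eq_ambientVec W v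
  obtain ⟨b, rfl⟩ := (ambientVec_mem_range_iff W B x
    ((ambientPt_mem_regularPoints_iff W B).1 hp)).1 hv
  obtain ⟨g, hg⟩ := B.tangentL2_mem_range W m t (Sobolev.toL2 f) (a (Fin.last n)) b
  let y : EuclideanSpace ℝ (Fin n) × ℝ × W.Sobolev m :=
    (WithLp.toLp 2 (fun i => a i.castSucc), a (Fin.last n), g)
  have hy : (W.ambient n).emb m y
      = ambientVec W a (B.tangentL2 t (Sobolev.toL2 f) (a (Fin.last n)) b) := by
    rw [ambient_emb, ← hg]; rfl
  refine ⟨⟨y, ?_⟩, Subtype.ext ((ScScale.sub_emb _ _ m _).trans hy)⟩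
  change (W.ambient n).emb m y ∈ LinearMap.range (scDeriv (E := W.ambient n) (F := W.ambient n)
    (gammaRetraction W B n) (ambientPt W x t f)).toLinearMap
  rw [hy]
  exact hv

/-! ### The fibres of the almost complex structure and the main theorem. -/

/-- The linear map `v ↦ J_p v` on the ambient space. -/
def turnLin (x : EuclideanSpace ℝ (Fin n)) (t : ℝ) (f : W.Sobolev 1) :
    (W.ambient n).level 0 →ₗ[ℝ] (W.ambient n).level 0 where
  toFun v := (turnMap W B n (ambientPt W x t f, v)).2
  map_add' v v' := by
    obtain ⟨a, h, rfl⟩ := exists_eq_ambientVec W v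
    obtain ⟨a', h', rfl⟩ := exists_eq_ambientVec W v'
    rw [← ambientVec_add, turnMap_apply, turnMap_apply, turnMap_apply]
    change ambientVec W _ _ = ambientVec W _ _ + ambientVec W _ _
    have hq : ∀ {N : ℕ} (b b' : Fin N → ℝ), quarterTurn (b + b') = quarterTurn b + quarterTurn b' :=
      fun b b' => (quarterTurnL _).map_add b b'
    rw [Pi.add_apply, B.coeff_add, hq, hq, Pi.add_apply, B.tangentL2_add, ambientVec_add]
  map_smul' c v := by
    obtain ⟨a, h, rfl⟩ := exists_eq_ambientVec W v
    rw [← ambientVec_smul, turnMap_apply, turnMap_apply]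
    change ambientVec W _ _ = c • ambientVec W _ _
    have hq : ∀ {N : ℕ} (b : Fin N → ℝ), quarterTurn (c • b) = c • quarterTurn b :=
      fun b => (quarterTurnL _).map_smul c b
    rw [Pi.smul_apply, smul_eq_mul, B.coeff_smul, hq, hq, Pi.smul_apply, smul_eq_mul,
      B.tangentL2_smul, ambientVec_smul]

theorem turnLin_apply (x : EuclideanSpace ℝ (Fin n)) {t : ℝ} {f : W.Sobolev 1}
    (hf : B.proj t (Sobolev.toL2 f) = Sobolev.toL2 f) (a : Fin (n + 1) → ℝ) (b : Fin k → ℝ) :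
    turnLin W B x t f (ambientVec W a (B.tangentL2 t (Sobolev.toL2 f) (a (Fin.last n)) b))
      = ambientVec W (quarterTurn a) (B.tangentL2 t (Sobolev.toL2 f) (quarterTurn a (Fin.last n))
        (quarterTurn b)) := by
  change (turnMap W B n (ambientPt W x t f, _)).2 = _
  rw [turnMap_apply]
  exact congrArg (ambientVec W _) (B.tangentL2_coeff_tangentL2 W quarterTurn hf _ _ b)

/-- In the coordinates (a, b) the fibre map is a pair of quarter turns. The coefficient of ξ_t
always equals the last entry of a, so the image is again tangent; n + 1 and k are even, so each turn
squares to -1. -/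
theorem isAlmostComplexStructure_turnStructure (hn : Odd n) (hk : Even k) :
    IsAlmostComplexStructure (E := W.ambient n) (gammaRetraction W B n)
      (turnStructure W B n) where
  smooth := scSmoothOnRetract_turnStructure W B n
  fibre p hp := by
    have := finiteDimensional_tangentSpace W B hp
    have hs := tangentSpace_emb_surjective W B hp
    obtain ⟨x, t, f, rfl⟩ := exists_eq_ambientPt W p
    have hf := (ambientPt_mem_regularPoints_iff W B).1 hp
    let S := LinearMap.range (scDeriv (E := W.ambient n) (F := W.ambient n)
        (gammaRetraction W B n) (ambientPt W x t f)).toLinearMap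
    have hS : ∀ v ∈ S, turnLin W B x t f v ∈ S ∧
        turnLin W B x t f (turnLin W B x t f v) = -v := by
      intro v hv
      obtain ⟨a, h, rfl⟩ := exists_eq_ambientVec W v
      obtain ⟨b, rfl⟩ := (ambientVec_mem_range_iff W B x hf).1 hv
      rw [turnLin_apply W B x hf]
      refine ⟨(ambientVec_mem_range_iff W B x hf).2 ⟨_, rfl⟩, ?_⟩
      -- Writing -a and -b as multiples by -1 lets the homogeneity of the parametrization pull the
      -- sign out.
      rw [turnLin_apply W B x hf, quarterTurn_quarterTurn hn.add_one, quarterTurn_quarterTurn hk,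
        Pi.neg_apply, neg_eq_neg_one_mul (a (Fin.last n)), ← neg_one_smul ℝ a,
        ← neg_one_smul ℝ b, B.tangentL2_smul, ambientVec_smul, neg_one_smul]
    refine ⟨(turnLin W B x t f).restrict (p := S) (q := S) fun v hv => (hS v hv).1,
      scContinuous_of_finiteDimensional hs _, fun v => Subtype.ext (hS v.1 v.2).2, fun v => ?_⟩
    obtain ⟨v, hv⟩ := v
    obtain ⟨a, h, rfl⟩ := exists_eq_ambientVec W v
    have hw := (mem_tangentBundle_iff W B (x := x)).2
      ⟨hf, (ambientVec_mem_range_iff W B x hf).1 hv⟩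
    refine ⟨⟨_, hw⟩, rfl, ?_⟩
    refine Prod.ext ?_ rfl
    change (turnMap W B n (ambientPt W x t f, ambientVec W a h)).1 = _
    rw [turnMap_apply, B.projOne_eq_self W hf]

theorem theorem3p5 (n k : ℕ) (W : WeightData) (B : BumpData k) :
    ((W.ambient n).IsScBanach ∧ (W.ambient n).IsReflexive ∧
      IsScRetraction (gammaRetraction W B n)) ∧
    (IsEvenDimensional (gammaRetraction W B n) ↔ Odd n ∧ Even k) ∧
    (IsEvenDimensional (gammaRetraction W B n) →
      ∃ J : tangentBundle (gammaRetraction W B n) → tangentBundle (gammaRetraction W B n),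
        IsAlmostComplexStructure (gammaRetraction W B n) J ∧ IsExplicitStructure W B n J) := by
  refine ⟨⟨W.isScBanach_ambient n, W.isReflexive_ambient n, isScRetraction_gammaRetraction W B n⟩,
    isEvenDimensional_gammaRetraction_iff W B, fun h => ?_⟩
  obtain ⟨hn, hk⟩ := (isEvenDimensional_gammaRetraction_iff W B).1 h
  exact ⟨turnStructure W B n, isAlmostComplexStructure_turnStructure W B hn hk,
    isExplicitStructure_turnStructure W B⟩

end
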